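/- **Setting.** Let $d\ge 2$ and let $\Gamma$ be a periodic graph in $\mathbf R^d$ with vertices $p_j+\mathbf v(n)$, $1\le j\le \mathsf s$, $n\in\mathbf Z^d$, where $\mathbf v(n)=\sum_i n_i\mathbf v_i$, $(\mathbf v_i)$ is a basis of $\mathbf R^d$, and $p_i-p_j$ is not in the lattice spanned by the $\mathbf v_i$ for $i\ne j$. The (simple, undirected) edges are invariant under lattice translations and all vertices have the same degree $d_g\ge1$. Functions on the vertices are written $u(n)=(u_1(n),\dots,u_{\mathsf s}(n))\in\mathbf C^{\mathsf s}$, $n\in\mathbf Z^d$; $\Delta_\Gamma$ is the mean over adjacent vertices, and $\mathcal L(\eta)$ is the Hermitian $\mathsf s\times\mathsf s$ symbol of $-\Delta_\Gamma$, i.e. the matrix by which $-\Delta_\Gamma$ acts on $\sum_n e^{-in\cdot\eta}u(n)$. Fix $E_0,\nu\in\mathbf R$, and for $h>0$ put $\Delta_{disc,h}=h^{-\nu}(\Delta_\Gamma+E_0)$, $\mathcal L_h(\eta)=h^{-\nu}(\mathcal L(h\eta)-E_0)$. Let $\lambda_1(\eta)\le\dots\le\lambda_{\mathsf s}(\eta)$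 be the eigenvalues of $\mathcal L(\eta)-E_0$ and $\lambda_{k,h}(\eta)=h^{-\nu}\lambda_k(h\eta)$ those of $\mathcal L_h(\eta)$. Fix an index $j$, an open set $\mathcal K_0\subset\mathbf R^d$ (a lift of an open subset of the torus $\mathbf T^d=(\mathbf R/2\pi\mathbf Z)^d$), and $d_1\in\mathcal K_0$; put $\mathcal K=\mathcal K_0-d_1$, $d_h=d_1/h$, $(\mathcal G_ha)(n)=e^{ihn\cdot d_h}a(n)$ and $P_h(\xi)=\lambda_{j,h}(\xi+d_h)$. Let $P:\mathbf R^d\to\mathbf R$, and let $\Pi_0(\xi)$ be an $\mathsf s\times\mathsf s$ matrix function. Conditions on an index outside $\{1,\dots,\mathsf s\}$ are void, except that (B-2-2) requires $j\ge2$. Assume: - (B-1) $\lambda_j\ge0$ on $\mathcal K_0$, and $d_1$ is its only zero in $\mathcal K_0$. - (B-2) Either (B-2-1): for some $\epsilon_1,\epsilon_2>0$, $\lambda_{j-1}<-\epsilon_1<\lambda_j<\epsilon_2<\lambda_{j+1}$ on $\overline{\mathcal K_0}$; or (B-2-2): $\lambda_{j-1}=-\lambda_j$ on $\mathcal K_0$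 and, for some $\epsilon_1,\epsilon_2>0$, $\lambda_{j-2}<-\epsilon_1<\lambda_{j-1}\le\lambda_j<\epsilon_2<\lambda_{j+1}$ on $\overline{\mathcal K_0}$. - (B-3) For every $\xi\ne0$, $P_h(\xi)\to P(\xi)$ as $h\to0^+$ together with all derivatives; $P$ is $C^\infty$ off $0$ and homogeneous of some degree $\gamma>0$; and for some $C,h_1>0$, $CP(\xi)\le P_h(\xi)\le C^{-1}P(\xi)$ for $0<h<h_1$, $\xi\in\mathcal K/h$. - (B-4) Let $\Pi_h(\xi)$ be the eigenprojection of $\mathcal L_h(\xi+d_h)$ for the eigenvalue $\lambda_{j,h}(\xi+d_h)$ in case (B-2-1), and the sum of those for $\lambda_{j-1,h}(\xi+d_h)$ and $\lambda_{j,h}(\xi+d_h)$ in case (B-2-2). For every $\xi\neq0$, $\Pi_0(\xi)$ is a projection, $\Pi_0$ is $C^\infty$ off $0$, and $\Pi_h(\xi)\to\Pi_0(\xi)$ as $h\to0^+$ together with all derivatives. - (C-1) $\lambda_j\ge0$ on $\mathbf T^d$, and $d_1$ is its only zero in $\mathbf T^d$. - (C-2) $\max_{\mathbf T^d}\lambda_{j-1}<0<\min_{\mathbf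 T^d}\lambda_{j+1}$. - (C-3) $P(\xi)=\sum_{|\alpha|=2M}a_\alpha\xi^\alpha$ for some integer $M\ge1$, and $P_h(\xi)\to P(\xi)$ as $h\to0^+$ for every $\xi\in\mathbf R^d$. Let $V:\mathbf R^d\to\mathbf R$ be continuous and compactly supported with $V\in H^r(\mathbf R^d)$ for some $r>d/2$, and let $f:\mathbf R^d\to\mathbf C^{\mathsf s}$ be continuous with $f\in H^{m,\sigma}(\mathbf R^d)$, i.e. $\langle x\rangle^{\sigma}f\in H^m(\mathbf R^d)$, $\langle x\rangle=(1+|x|^2)^{1/2}$, for some $m>[d/2]+1$ and $\sigma>d+1$. For $u\in\ell^2(\mathbf Z^d;\mathbf C^{\mathsf s})$ put $\widehat u(\xi)=(h/2\pi)^{d/2}\sum_n e^{-ihn\cdot\xi}u(n)$ (convergent in $L^2$ of $[-\pi/h,\pi/h]^d$), and let $\widetilde u(x)=(h/2\pi)^{d/2}\int_{[-\pi/h,\pi/h]^d}e^{ix\cdot\xi}\,\widehat u(\xi)\,d\xi$, $x\in\mathbf R^d$, be its interpolation. **Theorem.** Let $z\in\mathbf C\setminus\mathbf R$, $h_0>0$,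 and for $0<h<h_0$ let $u_h\in\ell^2(\mathbf Z^d;\mathbf C^{\mathsf s})$ be a solution of $$(-\mathcal G_h^*\Delta_{disc,h}\mathcal G_h+V_{disc,h}-z)u_h=f_h\quad\text{on }\mathbf Z^d,$$ where $(V_{disc,h}u)(n)=V(hn)u(n)$ and $f_h(n)=f(hn)$. Then there is a function $\widetilde u:\mathbf R^d\to\mathbf C^{\mathsf s}$ such that, as $h\to0^+$, $\widetilde u_h\to\widetilde u$ strongly in $L^{2,-s}(\mathbf R^d)$ for every $0<s<1/2$ (that is, $\langle x\rangle^{-s}\widetilde u_h\to\langle x\rangle^{-s}\widetilde u$ in $L^2(\mathbf R^d)$), and locally uniformly on $\mathbf R^d$. Moreover $\widetilde u\in L^2(\mathbf R^d)$, $P(D_x)\widetilde u\in L^2(\mathbf R^d)$, and $$\widetilde u=\Pi_0\widetilde u,\qquad (P(D_x)+V-z)\widetilde u=\Pi_0f,$$ where $P(D_x)$ and $\Pi_0=\Pi_0(D_x)$ are the Fourier multipliers with symbols $P(\xi)$ and $\Pi_0(\xi)$ with respect to the Fourier transform with kernel $(2\pi)^{-d/2}e^{-ix\cdot\xi}$.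 -/

import Mathlib

open Filter Topology MeasureTheory
open scoped FourierTransform ContDiff SchwartzMap

noncomputable section

namespace ContinuumLimit

/-- Configuration space and momentum space `ℝᵈ`. -/
abbrev Rd (d : ℕ) := EuclideanSpace ℝ (Fin d)

/-- The fibre `ℂˢ` over a point of `ℤᵈ`. -/
abbrev Cs (s : ℕ) := EuclideanSpace ℂ (Fin s)

/-- The label `n ∈ ℤᵈ` of a lattice point, seen as a vector of `ℝᵈ`. -/
def intVec {d : ℕ} (n : Fin d → ℤ) : Rd d := WithLp.toLp 2 fun i => (n i : ℝ)

/-! ### Periodic graphs, the Laplacian and its symbol -/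

/-- A periodic graph in `ℝᵈ` with `s` vertices per cell. The lattice `L` has the basis `v`, and the
vertices are the points `p j + ∑ i, n i • v i`, labelled by the pairs `(j, n)` (the labelling is
injective since `p i - p j ∉ L` for `i ≠ j`). The edges are invariant under translation by `L`, and
all vertices have the same positive degree `deg`. The graph of mesh size `h` is its image under
`x ↦ h x`, so the labels and the adjacency of labels do not depend on `h`. -/
structure PeriodicGraph (d s : ℕ) where
  v : Module.Basis (Fin d) ℝ (Rd d)
  p : Fin s → Rd d
  p_sub_notMem : ∀ i j, i ≠ j → p i - p j ∉ Submodule.span ℤ (Set.range v)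
  graph : SimpleGraph (Fin s × (Fin d → ℤ))
  adj_translate : ∀ (m : Fin d → ℤ) (a b : Fin s × (Fin d → ℤ)),
    graph.Adj a b → graph.Adj (a.1, m + a.2) (b.1, m + b.2)
  deg : ℕ
  deg_pos : 0 < deg
  ncard_neighborSet : ∀ a, (graph.neighborSet a).ncard = deg

variable {d s : ℕ}

/-- The Laplacian: the mean over the adjacent vertices. A function on the vertices is written
`u n j`, with value at the vertex `(j, n)`. -/
def laplacian (Γ : PeriodicGraph d s) (u : (Fin d → ℤ) → Cs s) (n : Fin d → ℤ) : Cs s :=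
  WithLp.toLp 2 fun j =>
    (1 / (Γ.deg : ℂ)) * ∑ᶠ b ∈ Γ.graph.neighborSet (j, n), u b.2 b.1

/-- The rescaled Laplacian `Δ_disc,h = h^(-ν) (Δ + E₀)`. -/
def laplacianDisc (Γ : PeriodicGraph d s) (ν E₀ h : ℝ) (u : (Fin d → ℤ) → Cs s)
    (n : Fin d → ℤ) : Cs s :=
  ((h ^ (-ν) : ℝ) : ℂ) • (laplacian Γ u n + (E₀ : ℂ) • u n)

/-- The gauge transformation `(G_h a)(n) = exp(i h n · d_h) a(n)`, where `d_h = d₁ / h`. -/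
def gauge (d₁ : Rd d) (h : ℝ) (a : (Fin d → ℤ) → Cs s) (n : Fin d → ℤ) : Cs s :=
  Complex.exp (Complex.I * (inner ℝ (h • intVec n) (h⁻¹ • d₁) : ℝ)) • a n

/-- The adjoint (and inverse) of the gauge transformation. -/
def gaugeAdj (d₁ : Rd d) (h : ℝ) (a : (Fin d → ℤ) → Cs s) (n : Fin d → ℤ) : Cs s :=
  Complex.exp (-(Complex.I * (inner ℝ (h • intVec n) (h⁻¹ • d₁) : ℝ))) • a n

/-- The symbol `𝓛(e^{-iη}, e^{iη})` of `-Δ`: the matrix by which `-Δ` acts on the Fourier series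
`∑ n, e^{-i n · η} u n`. -/
def symbol (Γ : PeriodicGraph d s) (η : Rd d) : Matrix (Fin s) (Fin s) ℂ :=
  Matrix.of fun j k =>
    -((1 / (Γ.deg : ℂ)) * ∑ᶠ l ∈ {l : Fin d → ℤ | Γ.graph.Adj (j, 0) (k, l)},
      Complex.exp (Complex.I * (inner ℝ (intVec l) η : ℝ)))

theorem adj_neg_iff (Γ : PeriodicGraph d s) (j k : Fin s) (l : Fin d → ℤ) :
    Γ.graph.Adj (k, 0) (j, -l) ↔ Γ.graph.Adj (j, 0) (k, l) := by
  constructor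
  · intro h
    simpa using (Γ.adj_translate l _ _ h).symm
  · intro h
    simpa using (Γ.adj_translate (-l) _ _ h).symm

theorem intVec_neg (l : Fin d → ℤ) : intVec (-l) = -intVec l := by
  ext i
  simp [intVec]

theorem symbol_isHermitian (Γ : PeriodicGraph d s) (η : Rd d) : (symbol Γ η).IsHermitian := by
  ext j k
  have key : ∀ g : (Fin d → ℤ) → ℂ,
      ∑ᶠ l ∈ {l : Fin d → ℤ | Γ.graph.Adj (k, 0) (j, l)}, g l
        = ∑ᶠ l ∈ {l : Fin d → ℤ | Γ.graph.Adj (j, 0) (k, l)}, g (-l) := by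
    intro g
    refine (finsum_mem_eq_of_bijOn (fun l => -l) ⟨?_, neg_injective.injOn, ?_⟩
      fun _ _ => rfl).symm
    · intro l hl
      exact (adj_neg_iff Γ j k l).2 hl
    · intro l hl
      refine ⟨-l, ?_, neg_neg l⟩
      exact (adj_neg_iff Γ k j l).2 hl
  have hconj : ∀ (S : Set (Fin d → ℤ)) (g : (Fin d → ℤ) → ℂ),
      (starRingEnd ℂ) (∑ᶠ l ∈ S, g l) = ∑ᶠ l ∈ S, (starRingEnd ℂ) (g l) := by
    intro S g
    have h1 := AddEquiv.map_finsum (starRingAut (R := ℂ)).toAddEquiv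
      (fun l => ∑ᶠ _ : l ∈ S, g l)
    have h2 : ∀ l, (starRingAut (R := ℂ)).toAddEquiv (∑ᶠ _ : l ∈ S, g l)
        = ∑ᶠ _ : l ∈ S, (starRingEnd ℂ) (g l) := fun l =>
      AddEquiv.map_finsum (starRingAut (R := ℂ)).toAddEquiv (fun _ : l ∈ S => g l)
    simp only [h2] at h1
    exact h1
  simp only [Matrix.conjTranspose_apply, symbol, Matrix.of_apply, RCLike.star_def, map_neg, map_mul,
    map_div₀, map_one, map_natCast, hconj]
  rw [key]
  simp [← Complex.exp_conj, intVec_neg, inner_neg_left]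

/-- The characteristic roots of `𝓛(e^{-iη}) - E₀`, in increasing order. -/
def charRoot (Γ : PeriodicGraph d s) (E₀ : ℝ) (k : Fin s) (η : Rd d) : ℝ :=
  (symbol_isHermitian Γ η).eigenvalues₀ (Fin.cast (Fintype.card_fin s).symm k.rev) - E₀

/-- The characteristic roots `λ_{k,h}(η) = h^(-ν) λ_k(e^{-ihη})` of `-Δ_disc,h`. -/
def charRootH (Γ : PeriodicGraph d s) (ν E₀ h : ℝ) (k : Fin s) (η : Rd d) : ℝ :=
  h ^ (-ν) * charRoot Γ E₀ k (h • η)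

/-- The symbol `𝓛_h(e^{-ihη})` of `-Δ_disc,h`. -/
def symbolH (Γ : PeriodicGraph d s) (ν E₀ h : ℝ) (η : Rd d) : Matrix (Fin s) (Fin s) ℂ :=
  ((h ^ (-ν) : ℝ) : ℂ) • (symbol Γ (h • η) - (E₀ : ℂ) • (1 : Matrix (Fin s) (Fin s) ℂ))

/-- `P_h(ξ) = λ_{j,h}(ξ + d_h)`, where `d_h = d₁ / h`. -/
def Ph (Γ : PeriodicGraph d s) (ν E₀ : ℝ) (j : Fin s) (d₁ : Rd d) (h : ℝ) (ξ : Rd d) : ℝ :=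
  charRootH Γ ν E₀ h j (ξ + h⁻¹ • d₁)

/-- The orthogonal projection onto the sum of the eigenspaces of `A` for the eigenvalues in `S`. -/
def eigenProjection (A : Matrix (Fin s) (Fin s) ℂ) (S : Set ℝ) : Matrix (Fin s) (Fin s) ℂ :=
  Matrix.toEuclideanLin.symm
    ((⨆ μ ∈ S, Module.End.eigenspace (Matrix.toEuclideanLin A) (μ : ℂ)).starProjection :
      Cs s →ₗ[ℂ] Cs s)

/-- `Π_h(ξ)`: the sum of the eigenprojections of `𝓛_h(e^{-ih(ξ + d_h)})` associated with the
eigenvalues `λ_{k,h}(ξ + d_h)`, `k ∈ J`. -/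
def PiH (Γ : PeriodicGraph d s) (ν E₀ : ℝ) (J : Set (Fin s)) (d₁ : Rd d) (h : ℝ) (ξ : Rd d) :
    Matrix (Fin s) (Fin s) ℂ :=
  eigenProjection (symbolH Γ ν E₀ h (ξ + h⁻¹ • d₁))
    ((fun k => charRootH Γ ν E₀ h k (ξ + h⁻¹ • d₁)) '' J)

/-! ### Hypotheses on the characteristic roots

The torus `ℝᵈ / (2πℤ)ᵈ` is described by `2π`-periodic functions on `ℝᵈ`; `K₀` is a lift to `ℝᵈ` of
an open subset of the torus, and `𝒦 = K₀ - d₁`, so that `ξ ∈ 𝒦 / h` means `h ξ + d₁ ∈ K₀`. -/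

/-- `λ_j` is nonnegative on the open set `K₀`, and vanishes there at `d₁ ∈ K₀` and only there. -/
def HypB1 (Γ : PeriodicGraph d s) (E₀ : ℝ) (j : Fin s) (K₀ : Set (Rd d)) (d₁ : Rd d) : Prop :=
  IsOpen K₀ ∧ d₁ ∈ K₀ ∧ (∀ η ∈ K₀, 0 ≤ charRoot Γ E₀ j η) ∧
    ∀ η ∈ K₀, charRoot Γ E₀ j η = 0 ↔ η = d₁

/-- Simple isolated root: `λ_{j-1} < -ε₁ < λ_j < ε₂ < λ_{j+1}` on the closure of `K₀`. -/
def HypB21 (Γ : PeriodicGraph d s) (E₀ : ℝ) (j : Fin s) (K₀ : Set (Rd d)) : Prop :=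
  ∃ ε₁ > 0, ∃ ε₂ > 0, ∀ η ∈ closure K₀,
    (∀ k, k < j → charRoot Γ E₀ k η < -ε₁) ∧
    -ε₁ < charRoot Γ E₀ j η ∧ charRoot Γ E₀ j η < ε₂ ∧
    (∀ k, j < k → ε₂ < charRoot Γ E₀ k η)

/-- Double root, `i` being the index `j - 1`: `λ_i = -λ_j` on `K₀`, and
`λ_{i-1} < -ε₁ < λ_i ≤ λ_j < ε₂ < λ_{j+1}` on the closure of `K₀`. -/
def HypB22 (Γ : PeriodicGraph d s) (E₀ : ℝ) (i j : Fin s) (K₀ : Set (Rd d)) : Prop :=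
  i.val + 1 = j.val ∧ (∀ η ∈ K₀, charRoot Γ E₀ i η = -charRoot Γ E₀ j η) ∧
  ∃ ε₁ > 0, ∃ ε₂ > 0, ∀ η ∈ closure K₀,
    (∀ k, k < i → charRoot Γ E₀ k η < -ε₁) ∧
    -ε₁ < charRoot Γ E₀ i η ∧ charRoot Γ E₀ i η ≤ charRoot Γ E₀ j η ∧
    charRoot Γ E₀ j η < ε₂ ∧
    (∀ k, j < k → ε₂ < charRoot Γ E₀ k η)

/-- `P_h → P` with all derivatives at every `ξ ≠ 0` (each `ξ` lies in `𝒦 / h` for small `h`), where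
`P` is smooth off `0` and homogeneous of degree `γ > 0`; and `C P ≤ P_h ≤ C⁻¹ P` on `𝒦 / h`. -/
def HypB3 (Γ : PeriodicGraph d s) (ν E₀ : ℝ) (j : Fin s) (K₀ : Set (Rd d)) (d₁ : Rd d)
    (P : Rd d → ℝ) : Prop :=
  ContDiffOn ℝ ∞ P {0}ᶜ ∧
  (∃ γ : ℝ, 0 < γ ∧ ∀ t : ℝ, 0 < t → ∀ ξ, P (t • ξ) = t ^ γ * P ξ) ∧
  (∀ ξ, ξ ≠ 0 → ∀ k : ℕ,
    Tendsto (fun h : ℝ => iteratedFDeriv ℝ k (Ph Γ ν E₀ j d₁ h) ξ) (𝓝[>] 0)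
      (𝓝 (iteratedFDeriv ℝ k P ξ))) ∧
  ∃ C > 0, ∃ h₁ > 0, ∀ h : ℝ, 0 < h → h < h₁ → ∀ ξ : Rd d, h • ξ + d₁ ∈ K₀ →
    C * P ξ ≤ Ph Γ ν E₀ j d₁ h ξ ∧ Ph Γ ν E₀ j d₁ h ξ ≤ C⁻¹ * P ξ

/-- `Π_h → Π₀` with all derivatives at every `ξ ≠ 0`, where `Π₀(ξ)` is a projection. -/
def HypB4 (Γ : PeriodicGraph d s) (ν E₀ : ℝ) (J : Set (Fin s)) (d₁ : Rd d)
    (Pi₀ : Rd d → Matrix (Fin s) (Fin s) ℂ) : Prop :=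
  (∀ ξ, ξ ≠ 0 → IsIdempotentElem (Pi₀ ξ)) ∧
  ∀ a b, ContDiffOn ℝ ∞ (fun ξ => Pi₀ ξ a b) {0}ᶜ ∧
    ∀ ξ, ξ ≠ 0 → ∀ k : ℕ,
      Tendsto (fun h : ℝ => iteratedFDeriv ℝ k (fun ζ => PiH Γ ν E₀ J d₁ h ζ a b) ξ) (𝓝[>] 0)
        (𝓝 (iteratedFDeriv ℝ k (fun ζ => Pi₀ ζ a b) ξ))

/-- `λ_j ≥ 0` on the torus, and `d₁` is its unique zero on the torus. -/
def HypC1 (Γ : PeriodicGraph d s) (E₀ : ℝ) (j : Fin s) (d₁ : Rd d) : Prop :=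
  (∀ η, 0 ≤ charRoot Γ E₀ j η) ∧
    ∀ η, charRoot Γ E₀ j η = 0 ↔ ∃ k : Fin d → ℤ, η = d₁ + (2 * Real.pi) • intVec k

/-- `max λ_{j-1} < 0 < min λ_{j+1}` on the torus. -/
def HypC2 (Γ : PeriodicGraph d s) (E₀ : ℝ) (j : Fin s) : Prop :=
  ∃ ε > 0, ∀ η, (∀ k, k < j → charRoot Γ E₀ k η ≤ -ε) ∧ (∀ k, j < k → ε ≤ charRoot Γ E₀ k η)

/-- `P_h → P` pointwise, where `P` is a homogeneous polynomial of degree `2 M`, `M ≥ 1`. -/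
def HypC3 (Γ : PeriodicGraph d s) (ν E₀ : ℝ) (j : Fin s) (d₁ : Rd d) (P : Rd d → ℝ) : Prop :=
  (∃ M : ℕ, 1 ≤ M ∧ ∃ p : MvPolynomial (Fin d) ℝ, p.IsHomogeneous (2 * M) ∧
    ∀ ξ : Rd d, P ξ = MvPolynomial.eval (fun i => ξ i) p) ∧
  ∀ ξ, Tendsto (fun h : ℝ => Ph Γ ν E₀ j d₁ h ξ) (𝓝[>] 0) (𝓝 (P ξ))

/-! ### Function spaces -/

/-- `⟨x⟩^σ u(x)`, where `⟨x⟩ = (1 + |x|²)^(1/2)`. -/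
def weighted {F : Type*} [NormedAddCommGroup F] [NormedSpace ℂ F] (σ : ℝ) (u : Rd d → F)
    (x : Rd d) : F :=
  (((1 + ‖x‖ ^ 2) ^ (σ / 2) : ℝ) : ℂ) • u x

/-- `u ∈ L^{2,σ}(ℝᵈ)`. -/
def MemL2w {F : Type*} [NormedAddCommGroup F] [NormedSpace ℂ F] (σ : ℝ) (u : Rd d → F) : Prop :=
  MemLp (weighted σ u) 2 volume

/-- `u ∈ H^{m,σ}(ℝᵈ)`, i.e. `⟨x⟩^σ u ∈ H^m(ℝᵈ)`, for a function `u` and `m ≥ 0`. -/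
def MemHw {F : Type*} [NormedAddCommGroup F] [InnerProductSpace ℂ F] [CompleteSpace F]
    (m σ : ℝ) (u : Rd d → F) : Prop :=
  ∃ g : Lp F 2 (volume : Measure (Rd d)), g =ᵐ[volume] weighted σ u ∧
    TemperedDistribution.MemSobolev m 2 (g : 𝓢'(Rd d, F))

/-- `F_h → u` in `L^{2,σ}(ℝᵈ)` as `h → 0+`. -/
def TendstoL2w (σ : ℝ) (F : ℝ → Rd d → Cs s) (u : Rd d → Cs s) : Prop :=
  (∀ᶠ h in 𝓝[>] (0 : ℝ), MemL2w σ (F h)) ∧ MemL2w σ u ∧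
    Tendsto (fun h : ℝ => eLpNorm (weighted σ (F h - u)) 2 volume) (𝓝[>] 0) (𝓝 0)

/-- `v = a(D_x) u` for `u, v ∈ L²` and a matrix symbol `a`: the unitary Fourier transform with
kernel `e^{-i x · ζ}` turns `a(D_x)` into multiplication by `a(ζ)`. Since `𝓕` has the kernel
`e^{-2πi x · ξ}`, one has `ζ = 2π ξ`. -/
def IsFourierMultiplier (a : Rd d → Matrix (Fin s) (Fin s) ℂ) (u v : Rd d → Cs s) : Prop :=
  ∃ (hu : MemLp u 2 volume) (hv : MemLp v 2 volume), ∀ᵐ ξ : Rd d,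
    (𝓕 (hv.toLp v) : Lp (Cs s) 2 (volume : Measure (Rd d))) ξ
      = Matrix.toEuclideanLin (a ((2 * Real.pi) • ξ))
          ((𝓕 (hu.toLp u) : Lp (Cs s) 2 (volume : Measure (Rd d))) ξ)

/-! ### Discrete Fourier transform and interpolation -/

/-- The cell `[-π/h, π/h]ᵈ` representing the torus of size `2π/h`. -/
def torusCell (d : ℕ) (h : ℝ) : Set (Rd d) := {ξ | ∀ i, |ξ i| ≤ Real.pi / h}

/-- One term of the Fourier series: `e^{-i h n · ξ} c`. -/
def fourierTerm (h : ℝ) (n : Fin d → ℤ) (c : Cs s) (ξ : Rd d) : Cs s :=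
  Complex.exp (-(Complex.I * (inner ℝ (h • intVec n) ξ : ℝ))) • c

theorem torusCell_volume_lt_top (h : ℝ) : volume (torusCell d h) < ⊤ := by
  refine (Bornology.IsBounded.measure_lt_top ?_)
  refine (Metric.isBounded_iff_subset_closedBall 0).2 ⟨∑ _i : Fin d, Real.pi / h, ?_⟩
  intro ξ hξ
  rw [mem_closedBall_zero_iff]
  have h1 : ‖ξ‖ ≤ ∑ i : Fin d, ‖ξ i‖ := by
    have := norm_sum_le (Finset.univ : Finset (Fin d))
      (fun i => ξ i • EuclideanSpace.basisFun (Fin d) ℝ i)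
    have h2 : ∑ i, ξ i • EuclideanSpace.basisFun (Fin d) ℝ i = ξ := by
      simpa using (EuclideanSpace.basisFun (Fin d) ℝ).sum_repr ξ
    rw [h2] at this
    simpa [norm_smul] using this
  exact h1.trans (Finset.sum_le_sum fun i _ => by simpa using hξ i)

theorem fourierTerm_memLp (h : ℝ) (n : Fin d → ℤ) (c : Cs s) :
    MemLp (fourierTerm h n c) 2 (volume.restrict (torusCell d h)) := by
  have : IsFiniteMeasure (volume.restrict (torusCell d h)) :=
    ⟨by simpa using torusCell_volume_lt_top h⟩
  refine MemLp.of_bound (C := ‖c‖) ?_ ?_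
  · refine Continuous.aestronglyMeasurable ?_
    unfold fourierTerm
    fun_prop
  · refine Eventually.of_forall fun ξ => ?_
    rw [fourierTerm, norm_smul, ← mul_neg, mul_comm, mul_comm Complex.I, ← Complex.ofReal_neg,
      Complex.norm_exp_ofReal_mul_I, mul_one]

/-- The discrete Fourier transform `û_h(ξ) = (h/2π)^{d/2} ∑ n, e^{-i h n · ξ} u(n)` of
`u ∈ ℓ²(ℤᵈ)`, the series converging in `L²` of the cell. -/
def discFourier (h : ℝ) (u : lp (fun _ : Fin d → ℤ => Cs s) 2) :
    Lp (Cs s) 2 (volume.restrict (torusCell d h)) :=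
  (((h / (2 * Real.pi)) ^ ((d : ℝ) / 2) : ℝ) : ℂ) •
    ∑' n : Fin d → ℤ, (fourierTerm_memLp h n (u n)).toLp (fourierTerm h n (u n))

/-- The interpolation `ũ_h(x) = (h/2π)^{d/2} ∫_{[-π/h, π/h]ᵈ} e^{i x · ξ} û_h(ξ) dξ`. -/
def interpolate (h : ℝ) (u : lp (fun _ : Fin d → ℤ => Cs s) 2) (x : Rd d) : Cs s :=
  (((h / (2 * Real.pi)) ^ ((d : ℝ) / 2) : ℝ) : ℂ) •
    ∫ ξ in torusCell d h, Complex.exp (Complex.I * (inner ℝ x ξ : ℝ)) • discFourier h u ξ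

/-- The gauge transformed discrete equation `(-G_h^* Δ_disc,h G_h + V_disc,h - z) u = f_h` on `ℤᵈ`,
where `V_disc,h` is multiplication by `V(hn)` and `f_h(n) = f(hn)`. -/
def SolvesDiscrete (Γ : PeriodicGraph d s) (ν E₀ : ℝ) (d₁ : Rd d) (V : Rd d → ℝ) (z : ℂ)
    (f : Rd d → Cs s) (h : ℝ) (u : (Fin d → ℤ) → Cs s) : Prop :=
  ∀ n : Fin d → ℤ,
    -gaugeAdj d₁ h (laplacianDisc Γ ν E₀ h (gauge d₁ h u)) n
      + (V (h • intVec n) : ℂ) • u n - z • u n = f (h • intVec n)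

end ContinuumLimit

end

noncomputable section

namespace ContinuumLimit

variable {d s : ℕ}

/-! The whole argument runs on the Fourier side. Put `G_h = dft h (u h)`. It lives on a cube of side
`h⁻¹` in the variable `η = ξ / 2π`, and its inverse Fourier transform is the interpolation, which
takes the values of `u h` on `hℤᵈ`. Convergence of `G_h` in `L¹` gives uniform convergence of the
interpolations. Together with a uniform `L²` bound it also gives convergence in `L^{2,-t}` for every
`t > 0`. So the aim is `G_h → G` in `L¹`.

Let `φ` and `k` be integrable with `𝓕⁻ φ = V` and `𝓕⁻ k = f`. The discrete equation becomes `(𝓛_h -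
z) G_h = Y_h`, where `Y_h` is the periodization of `k - φ * G_h` restricted to the cell
(`exists_fourier_equation`). In `L¹`, `Y_h` differs from `k - φ * G_h` by at most twice the mass of
the latter outside the cell (`lintegral_dft_sub_le`).

Compactness rests on two bounds. Self-adjointness and `Im z ≠ 0` bound `G_h` in `L²`
(`abs_im_mul_norm_solution_le`). The symbol is elliptic, `‖𝓛_h x‖ ≥ c ‖η‖^ν ‖x‖`, uniformly on the
cell and in `h` (`exists_norm_symLin_ge`), so at high frequency `G_h` is a small multiple of `Y_h`.
With Cauchy-Schwarz at low frequency this yields a uniform `L¹` bound and uniform tails for `φ *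
G_h` (`exists_lintegral_bound`, `exists_conv_tail_le`). Along a subsequence with weak `L²` limit
`G₀`, the convolutions converge pointwise, hence by tightness in `L¹`, so that `Y_h → k - φ * G₀` in
`L¹` (`exists_subseq_limit`).

The resolvents `(𝓛_h - z)⁻¹` are bounded by `|Im z|⁻¹`. Away from `η = 0` they converge to `(P -
z)⁻¹ Π₀`, because all roots other than the `j`-th have size at least a multiple of `h^(-ν)`
(`tendsto_resolvent`). Hence `G_h` itself converges in `L¹`, and its limit solves a closed equation
(`exists_subseq_isLimit`). That equation has at most one solution (`IsLimit.unique`), so the whole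
family converges.

Two structural facts simplify the limit. Condition (C-2) excludes the double root (`not_hypB22`).
For every `ξ ≠ 0`, `Π₀(ξ)` is the orthogonal projection onto the kernel of `𝓛(d₁) - E₀`, hence a
constant matrix (`Pi₀_eq`). A constant matrix commutes with `V`, which is why the limit equation
contains `V` itself and not `Π₀ V`. -/

/-! ### Tilings of `ℝᵈ` by cubes -/

/-- The half-open cube of side `T` centred at the origin. -/
def tile (d : ℕ) (T : ℝ) : Set (Rd d) := {x | ∀ i, x i ∈ Set.Ioc (-(T / 2)) (T / 2)}

/-- The closed cube of side `T` centred at the origin. -/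
def closedTile (d : ℕ) (T : ℝ) : Set (Rd d) := {x | ∀ i, |x i| ≤ T / 2}

theorem measurableSet_tile (T : ℝ) : MeasurableSet (tile d T) := by
  have : tile d T = ⋂ i, (fun x : Rd d => x i) ⁻¹' Set.Ioc (-(T / 2)) (T / 2) := by
    ext x; simp [tile]
  rw [this]
  exact MeasurableSet.iInter fun i =>
    (by fun_prop : Measurable fun x : Rd d => x i) measurableSet_Ioc

theorem isClosed_closedTile (T : ℝ) : IsClosed (closedTile d T) := by
  have : closedTile d T = ⋂ i, {x : Rd d | |x i| ≤ T / 2} := by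
    ext x; simp [closedTile]
  rw [this]
  exact isClosed_iInter fun i => isClosed_le (by fun_prop) continuous_const

theorem tile_subset_closedTile (T : ℝ) : tile d T ⊆ closedTile d T :=
  fun _ hx i => abs_le.2 ⟨(hx i).1.le, (hx i).2⟩

theorem volume_hyperplane (i : Fin d) (c : ℝ) : volume {x : Rd d | x i = c} = 0 := by
  have h := (PiLp.volume_preserving_ofLp (Fin d)).measure_preimage
    (s := {f : Fin d → ℝ | f i = c})
    ((measurableSet_eq_fun (measurable_pi_apply i) measurable_const).nullMeasurableSet)
  have h2 : volume {f : Fin d → ℝ | f i = c} = 0 :=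
    Measure.pi_hyperplane (α := fun _ : Fin d => ℝ) (fun _ => volume) i c
  rw [h2] at h
  exact h

theorem closedTile_ae_mem_openTile (T : ℝ) :
    ∀ᵐ x : Rd d, x ∈ closedTile d T → ∀ i, |x i| < T / 2 := by
  have : ∀ᵐ x : Rd d, ∀ i, x i ≠ T / 2 ∧ x i ≠ -(T / 2) := by
    rw [ae_all_iff]
    intro i
    refine Filter.Eventually.and ?_ ?_
    · simpa [ae_iff] using volume_hyperplane i (T / 2)
    · simpa [ae_iff] using volume_hyperplane i (-(T / 2))
  filter_upwards [this] with x hx hm i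
  refine lt_of_le_of_ne (hm i) fun h => ?_
  rcases eq_or_eq_neg_of_abs_eq h with h | h
  · exact (hx i).1 h
  · exact (hx i).2 h

@[simp] theorem intVec_apply (n : Fin d → ℤ) (i : Fin d) : intVec n i = n i := rfl

theorem intVec_add (m n : Fin d → ℤ) : intVec (m + n) = intVec m + intVec n := by
  ext i; simp

/-- The translates of the half-open cube by the lattice `T ℤᵈ`. -/
def tileAt (T : ℝ) (k : Fin d → ℤ) : Set (Rd d) := {x | x - T • intVec k ∈ tile d T}

theorem mem_tileAt {T : ℝ} {k : Fin d → ℤ} {x : Rd d} :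
    x ∈ tileAt T k ↔ x - T • intVec k ∈ tile d T := Iff.rfl

theorem measurableSet_tileAt (T : ℝ) (k : Fin d → ℤ) : MeasurableSet (tileAt T k) :=
  (by fun_prop : Measurable fun x : Rd d => x - T • intVec k) (measurableSet_tile T)

/-- The tile index is the coordinatewise rounding of `x / T`. This gives both the covering and the
disjointness of the half-open tiles. -/
theorem mem_tileAt_iff {T : ℝ} (hT : 0 < T) (k : Fin d → ℤ) (x : Rd d) :
    x ∈ tileAt T k ↔ ∀ i, k i = ⌈x i / T - 1 / 2⌉ := by
  refine forall_congr' fun i => ?_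
  rw [eq_comm, Int.ceil_eq_iff]
  simp only [PiLp.sub_apply, PiLp.smul_apply, intVec_apply, smul_eq_mul, Set.mem_Ioc]
  have e : x i = T * (x i / T) := by field_simp
  constructor
  · rintro ⟨h1, h2⟩
    constructor
    · rw [e] at h1
      nlinarith
    · rw [e] at h2
      nlinarith
  · rintro ⟨h1, h2⟩
    rw [e]
    constructor
    · nlinarith
    · nlinarith

theorem iUnion_tileAt {T : ℝ} (hT : 0 < T) : ⋃ k, tileAt T k = (Set.univ : Set (Rd d)) := by
  refine Set.eq_univ_of_forall fun x => Set.mem_iUnion.2 ⟨fun i => ⌈x i / T - 1 / 2⌉, ?_⟩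
  exact (mem_tileAt_iff hT _ x).2 fun _ => rfl

theorem pairwise_disjoint_tileAt {T : ℝ} (hT : 0 < T) :
    Pairwise (Function.onFun Disjoint (tileAt (d := d) T)) := by
  intro k l hkl
  refine Set.disjoint_left.2 fun x hk hl => hkl ?_
  ext i
  rw [(mem_tileAt_iff hT k x).1 hk i, (mem_tileAt_iff hT l x).1 hl i]

theorem tileAt_zero (T : ℝ) : tileAt T 0 = tile d T := by
  have : intVec (0 : Fin d → ℤ) = 0 := by ext i; simp
  simp [tileAt, this]

theorem setLIntegral_tileAt (T : ℝ) (k : Fin d → ℤ) (φ : Rd d → ENNReal) :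
    ∫⁻ x in tileAt T k, φ x = ∫⁻ x in tile d T, φ (x + T • intVec k) := by
  rw [← lintegral_indicator (measurableSet_tileAt T k), ← lintegral_indicator (measurableSet_tile T),
    ← lintegral_add_right_eq_self _ (T • intVec k)]
  congr 1 with x
  have hiff : x + T • intVec k ∈ tileAt T k ↔ x ∈ tile d T := by
    rw [mem_tileAt, add_sub_cancel_right]
  by_cases hx : x ∈ tile d T
  · rw [Set.indicator_of_mem hx, Set.indicator_of_mem (hiff.2 hx)]
  · rw [Set.indicator_of_notMem hx, Set.indicator_of_notMem (mt hiff.1 hx)]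

theorem setIntegral_tileAt {F : Type*} [NormedAddCommGroup F] [NormedSpace ℝ F]
    (T : ℝ) (k : Fin d → ℤ) (φ : Rd d → F) :
    ∫ x in tileAt T k, φ x = ∫ x in tile d T, φ (x + T • intVec k) := by
  rw [← integral_indicator (measurableSet_tileAt T k), ← integral_indicator (measurableSet_tile T),
    ← integral_add_right_eq_self _ (T • intVec k)]
  congr 1 with x
  have hiff : x + T • intVec k ∈ tileAt T k ↔ x ∈ tile d T := by
    rw [mem_tileAt, add_sub_cancel_right]
  by_cases hx : x ∈ tile d T
  · rw [Set.indicator_of_mem hx, Set.indicator_of_mem (hiff.2 hx)]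
  · rw [Set.indicator_of_notMem hx, Set.indicator_of_notMem (mt hiff.1 hx)]

theorem lintegral_eq_tsum_tile {T : ℝ} (hT : 0 < T) (φ : Rd d → ENNReal) :
    ∫⁻ x, φ x = ∑' k : Fin d → ℤ, ∫⁻ x in tile d T, φ (x + T • intVec k) := by
  rw [← setLIntegral_univ φ, ← iUnion_tileAt hT,
    lintegral_iUnion (measurableSet_tileAt T) (pairwise_disjoint_tileAt hT)]
  exact tsum_congr fun k => setLIntegral_tileAt T k φ

theorem hasSum_integral_tile {F : Type*} [NormedAddCommGroup F] [NormedSpace ℝ F]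
    {T : ℝ} (hT : 0 < T) {φ : Rd d → F} (hφ : Integrable φ) :
    HasSum (fun k : Fin d → ℤ => ∫ x in tile d T, φ (x + T • intVec k)) (∫ x, φ x) := by
  have := hasSum_integral_iUnion (measurableSet_tileAt T) (pairwise_disjoint_tileAt (d := d) hT)
    (f := φ) hφ.integrableOn
  rw [iUnion_tileAt hT, setIntegral_univ] at this
  simpa only [setIntegral_tileAt] using this

/-! ### Uniqueness of Fourier coefficients on a cell -/

/-- Sampling on `hℤᵈ` only sees `h η` modulo `ℤᵈ`: the samples are Fourier coefficients on the unit
torus. -/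
theorem fourierInv_lattice (F : Rd d → Cs s) (h : ℝ) (n : Fin d → ℤ) :
    𝓕⁻ F (h • intVec n)
      = ∫ η, UnitAddTorus.mFourier n (fun i => ((h * η i : ℝ) : UnitAddCircle)) • F η := by
  rw [Real.fourierInv_eq']
  congr 1 with η : 1
  congr 1
  simp only [UnitAddTorus.mFourier, ContinuousMap.coe_mk, fourier_coe_apply, ← Complex.exp_sum]
  congr 1
  simp only [PiLp.inner_apply, PiLp.smul_apply, intVec_apply, smul_eq_mul]
  push_cast
  rw [Finset.mul_sum, Finset.sum_mul]
  refine Finset.sum_congr rfl fun i _ => ?_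
  simp only [RCLike.inner_apply, conj_trivial]
  push_cast
  ring

/-- The integral is continuous in `φ` for the sup norm, and trigonometric polynomials are dense in
the continuous functions on the torus. -/
theorem integral_torus_mul_eq_zero {F : Rd d → Cs s} (hF : Integrable F) (h : ℝ)
    (hc : ∀ n : Fin d → ℤ, 𝓕⁻ F (h • intVec n) = 0) (φ : C(UnitAddTorus (Fin d), ℂ)) :
    ∫ η, φ (fun i => ((h * η i : ℝ) : UnitAddCircle)) • F η = 0 := by
  have hq : Continuous fun η : Rd d => (fun i => ((h * η i : ℝ) : UnitAddCircle)) := by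
    refine continuous_pi fun i => (AddCircle.continuous_mk' (1 : ℝ)).comp ?_
    fun_prop
  have hint : ∀ ψ : C(UnitAddTorus (Fin d), ℂ),
      Integrable fun η : Rd d => ψ (fun i => ((h * η i : ℝ) : UnitAddCircle)) • F η := by
    intro ψ
    exact hF.bdd_smul (𝕜 := ℂ) ‖ψ‖ (ψ.continuous.comp hq).aestronglyMeasurable
      (Eventually.of_forall fun η => ψ.norm_coe_le_norm _)
  have hmem : φ ∈ (Submodule.span ℂ (Set.range
      (UnitAddTorus.mFourier (d := Fin d)))).topologicalClosure := by
    rw [UnitAddTorus.span_mFourier_closure_eq_top]; trivial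
  have hspan : ∀ ψ ∈ Submodule.span ℂ (Set.range (UnitAddTorus.mFourier (d := Fin d))),
      ∫ η, ψ (fun i => ((h * η i : ℝ) : UnitAddCircle)) • F η = 0 := by
    intro ψ hψ
    induction hψ using Submodule.span_induction with
    | mem x hx =>
      obtain ⟨n, rfl⟩ := hx
      rw [← fourierInv_lattice]; exact hc n
    | zero => simp
    | add x y _ _ hx hy =>
      simp only [ContinuousMap.add_apply, add_smul]
      rw [integral_add (hint x) (hint y), hx, hy, add_zero]
    | smul c x _ hx =>
      simp only [ContinuousMap.smul_apply, smul_assoc]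
      rw [integral_smul, hx, smul_zero]
  have hcl : IsClosed {ψ : C(UnitAddTorus (Fin d), ℂ) |
      ∫ η, ψ (fun i => ((h * η i : ℝ) : UnitAddCircle)) • F η = 0} := by
    refine isClosed_eq ?_ continuous_const
    refine (LipschitzWith.of_dist_le_mul (K := Real.toNNReal (∫ η, ‖F η‖)) fun ψ χ => ?_).continuous
    rw [dist_eq_norm, ← integral_sub (hint ψ) (hint χ)]
    refine (norm_integral_le_integral_norm _).trans ?_
    rw [Real.coe_toNNReal _ (by positivity), ← integral_mul_const]
    refine integral_mono_of_nonneg (Eventually.of_forall fun _ => norm_nonneg _)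
      (hF.norm.mul_const _) (Eventually.of_forall fun η => ?_)
    simp only [← sub_smul, norm_smul]
    rw [mul_comm, dist_eq_norm]
    gcongr
    exact (ψ - χ).norm_coe_le_norm _
  exact closure_minimal (fun ψ hψ => hspan ψ hψ) hcl hmem

/-- The open cube of side `h⁻¹` embeds injectively in the torus, so the indicator of `S` is pulled
back from that of the closed image of `S`. The latter is a bounded pointwise limit of continuous
functions, for which the integral vanishes. -/
theorem setIntegral_compact_eq_zero {F : Rd d → Cs s} (hF : Integrable F) {h : ℝ} (hh : 0 < h)
    (hsupp : ∀ᵐ η, η ∉ closedTile d h⁻¹ → F η = 0)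
    (hc : ∀ n : Fin d → ℤ, 𝓕⁻ F (h • intVec n) = 0) {S : Set (Rd d)} (hS : IsCompact S)
    (hSs : S ⊆ {η | ∀ i, |η i| < h⁻¹ / 2}) : ∫ η in S, F η = 0 := by
  set q : Rd d → UnitAddTorus (Fin d) := fun η i => ((h * η i : ℝ) : UnitAddCircle) with hqdef
  have hq : Continuous q := by
    refine continuous_pi fun i => (AddCircle.continuous_mk' (1 : ℝ)).comp ?_
    fun_prop
  have hK : IsClosed (q '' S) := (hS.image hq).isClosed
  have hδ : ∀ n : ℕ, (0 : ℝ) < 1 / ((n : ℝ) + 1) := fun n => by positivity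
  have hlim := thickenedIndicator_tendsto_indicator_closure hδ
    tendsto_one_div_add_atTop_nhds_zero_nat (q '' S)
  rw [hK.closure_eq, tendsto_pi_nhds] at hlim
  have hpre : ∀ᵐ η, Set.indicator (q '' S) (fun _ => (1 : ℝ)) (q η) • F η = S.indicator F η := by
    filter_upwards [hsupp, closedTile_ae_mem_openTile (d := d) h⁻¹] with η h1 h2
    by_cases hη : η ∈ closedTile d h⁻¹
    · have h3 := h2 hη
      by_cases hηS : η ∈ S
      · have : q η ∈ q '' S := ⟨η, hηS, rfl⟩
        simp [hηS, this]
      · have : q η ∉ q '' S := by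
          rintro ⟨ζ, hζ, he⟩
          apply hηS
          have h4 := hSs hζ
          have : ζ = η := by
            ext i
            -- After multiplication by `h`, the open cube lies in one fundamental domain `[-1/2,
            -- 1/2)` per coordinate, where the projection to the circle is injective.
            have hmem : ∀ x : ℝ, |x| < h⁻¹ / 2 → h * x ∈ Set.Ico (-(1/2) : ℝ) (-(1/2) + 1) := by
              intro x hx
              have hx' := abs_lt.1 hx
              have e : h * (h⁻¹ / 2) = 1 / 2 := by field_simp
              constructor <;> nlinarith
            have h5 := (AddCircle.coe_eq_coe_iff_of_mem_Ico (hmem _ (h4 i)) (hmem _ (h3 i))).1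
              (congrFun he i)
            exact mul_left_cancel₀ hh.ne' h5
          exact this ▸ hζ
        simp [hηS, this]
    · have h5 : η ∉ S := fun hS' => hη fun i => (hSs hS' i).le
      simp [h1 hη, h5]
  rw [← integral_indicator hS.measurableSet, ← integral_congr_ae hpre]
  refine tendsto_nhds_unique (f := fun n : ℕ =>
    ∫ η, (((thickenedIndicator (hδ n) (q '' S)) (q η) : NNReal) : ℝ) • F η) (l := atTop) ?_ ?_
  · refine tendsto_integral_of_dominated_convergence (fun η => ‖F η‖) ?_ hF.norm ?_ ?_
    · intro n
      refine AEStronglyMeasurable.smul (𝕜 := ℝ) (Continuous.aestronglyMeasurable ?_)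
        hF.aestronglyMeasurable
      exact NNReal.continuous_coe.comp ((thickenedIndicator (hδ n) (q '' S)).continuous.comp hq)
    · intro n
      refine Eventually.of_forall fun η => ?_
      rw [norm_smul]
      refine mul_le_of_le_one_left (norm_nonneg _) ?_
      rw [Real.norm_of_nonneg (NNReal.coe_nonneg _)]
      exact_mod_cast thickenedIndicator_le_one (hδ n) (q '' S) (q η)
    · refine Eventually.of_forall fun η => ?_
      have h1 := (NNReal.continuous_coe.tendsto _).comp (hlim (q η))
      have h2 : (((q '' S).indicator (fun _ => (1 : NNReal)) (q η) : NNReal) : ℝ)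
          = (q '' S).indicator (fun _ => (1 : ℝ)) (q η) := by
        by_cases hm : q η ∈ q '' S <;> simp [hm]
      rw [h2] at h1
      exact Tendsto.smul_const (M := ℝ) h1 (F η)
  · refine tendsto_const_nhds.congr fun n => ?_
    have := integral_torus_mul_eq_zero hF h hc
      ⟨fun t => ((((thickenedIndicator (hδ n) (q '' S)) t : NNReal) : ℝ) : ℂ),
        Complex.continuous_ofReal.comp (NNReal.continuous_coe.comp
          (thickenedIndicator (hδ n) (q '' S)).continuous)⟩
    rw [← this]
    congr 1

/-- This uniqueness principle identifies functions carried by the cell through their lattice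
samples; every identity for `dft` below comes from it. The open cube is exhausted by smaller closed
cubes, and its faces are null. -/
theorem ae_eq_zero_of_fourierInv_lattice {F : Rd d → Cs s} (hF : Integrable F) {h : ℝ} (hh : 0 < h)
    (hsupp : ∀ᵐ η, η ∉ closedTile d h⁻¹ → F η = 0)
    (hc : ∀ n : Fin d → ℤ, 𝓕⁻ F (h • intVec n) = 0) : F =ᵐ[volume] 0 := by
  have hbdd : ∀ T : ℝ, IsCompact (closedTile d T) := by
    intro T
    refine Metric.isCompact_of_isClosed_isBounded (isClosed_closedTile T) ?_
    refine (Metric.isBounded_iff_subset_closedBall 0).2 ⟨∑ _i : Fin d, T / 2, fun x hx => ?_⟩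
    rw [mem_closedBall_zero_iff]
    have := norm_sum_le (Finset.univ : Finset (Fin d))
      (fun i => x i • EuclideanSpace.basisFun (Fin d) ℝ i)
    have h2 : ∑ i, x i • EuclideanSpace.basisFun (Fin d) ℝ i = x := by
      simpa using (EuclideanSpace.basisFun (Fin d) ℝ).sum_repr x
    rw [h2] at this
    refine this.trans (Finset.sum_le_sum fun i _ => ?_)
    simpa [norm_smul] using hx i
  set K : ℕ → Set (Rd d) := fun n => closedTile d ((1 - 1 / ((n : ℝ) + 1)) * h⁻¹) with hK
  have hKU : ∀ n, K n ⊆ {η : Rd d | ∀ i, |η i| < h⁻¹ / 2} := by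
    intro n x hx i
    refine (hx i).trans_lt ?_
    have : (0 : ℝ) < 1 / ((n : ℝ) + 1) := by positivity
    have : 0 < h⁻¹ := by positivity
    nlinarith
  have hmono : Monotone K := by
    intro m n hmn x hx i
    refine (hx i).trans ?_
    have : (1 : ℝ) / ((n : ℝ) + 1) ≤ 1 / ((m : ℝ) + 1) := by gcongr
    gcongr
  refine ae_eq_zero_of_forall_setIntegral_isClosed_eq_zero hF fun S hS => ?_
  have hU : ⋃ n, S ∩ K n = S ∩ {η : Rd d | ∀ i, |η i| < h⁻¹ / 2} := by
    rw [← Set.inter_iUnion]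
    congr 1
    refine Set.Subset.antisymm (Set.iUnion_subset hKU) fun x hx => ?_
    have : ∀ᶠ n : ℕ in atTop, ∀ i, |x i| < (1 - 1 / ((n : ℝ) + 1)) * h⁻¹ / 2 := by
      rw [eventually_all]
      intro i
      have ht : Tendsto (fun n : ℕ => (1 - 1 / ((n : ℝ) + 1)) * h⁻¹ / 2) atTop
          (𝓝 ((1 - 0) * h⁻¹ / 2)) :=
        ((tendsto_one_div_add_atTop_nhds_zero_nat.const_sub 1).mul_const _).div_const _
      rw [sub_zero, one_mul] at ht
      exact ht.eventually_const_lt (hx i)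
    obtain ⟨n, hn⟩ := this.exists
    exact Set.mem_iUnion.2 ⟨n, fun i => (hn i).le⟩
  have hlim := tendsto_setIntegral_of_monotone (μ := volume) (f := F) (s := fun n => S ∩ K n)
    (fun n => hS.measurableSet.inter (isClosed_closedTile _).measurableSet)
    (fun m n hmn => Set.inter_subset_inter_right _ (hmono hmn)) hF.integrableOn
  rw [hU] at hlim
  have hz : ∀ n, ∫ η in S ∩ K n, F η = 0 := fun n =>
    setIntegral_compact_eq_zero hF hh hsupp hc ((hbdd _).inter_left hS)
      (Set.inter_subset_right.trans (hKU n))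
  simp only [hz] at hlim
  have h0 := tendsto_nhds_unique hlim tendsto_const_nhds
  rw [← h0]
  have hUo : IsOpen {η : Rd d | ∀ i, |η i| < h⁻¹ / 2} := by
    simp only [Set.ofPred_forall]
    exact isOpen_iInter_of_finite fun i => isOpen_lt (by fun_prop) continuous_const
  rw [← integral_indicator hS.measurableSet,
    ← integral_indicator (hS.measurableSet.inter hUo.measurableSet)]
  refine integral_congr_ae ?_
  filter_upwards [hsupp, closedTile_ae_mem_openTile (d := d) h⁻¹] with η h1 h2
  by_cases hη : ∀ i, |η i| < h⁻¹ / 2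
  · by_cases hηS : η ∈ S <;> simp [hηS, hη]
  · have : F η = 0 := h1 fun hm => hη (h2 hm)
    simp [Set.indicator, this]

/-! ### The discrete Fourier transform -/

theorem integral_exp_cell_one {h : ℝ} (hh : 0 < h) (k : ℤ) :
    ∫ x in Set.Icc (-(Real.pi / h)) (Real.pi / h), Complex.exp (Complex.I * ((h * k * x : ℝ) : ℂ))
      = if k = 0 then ((2 * Real.pi / h : ℝ) : ℂ) else 0 := by
  have hle : -(Real.pi / h) ≤ Real.pi / h := by
    have : 0 < Real.pi / h := by positivity
    linarith
  rw [integral_Icc_eq_integral_Ioc, ← intervalIntegral.integral_of_le hle]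
  split_ifs with hk
  · subst hk
    simp only [Int.cast_zero, mul_zero, zero_mul, Complex.ofReal_zero, Complex.exp_zero,
      intervalIntegral.integral_const, Complex.real_smul, mul_one]
    congr 1
    ring
  · have hc : Complex.I * ((h * k : ℝ) : ℂ) ≠ 0 := by
      refine mul_ne_zero Complex.I_ne_zero ?_
      simp [hh.ne', hk]
    have e : ∀ x : ℝ, Complex.I * ((h * k * x : ℝ) : ℂ) = Complex.I * ((h * k : ℝ) : ℂ) * x := by
      intro x; push_cast; ring
    simp_rw [e]
    rw [integral_exp_mul_complex hc]
    -- The two endpoints differ by `k` full periods, so the antiderivative takes the same value at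
    -- both.
    have h1 : Complex.I * ((h * k : ℝ) : ℂ) * ((Real.pi / h : ℝ) : ℂ)
        = Complex.I * ((h * k : ℝ) : ℂ) * ((-(Real.pi / h) : ℝ) : ℂ)
          + k * (2 * Real.pi * Complex.I) := by
      have : (h : ℂ) ≠ 0 := by exact_mod_cast hh.ne'
      push_cast
      field_simp
      ring
    rw [h1, Complex.exp_add, Complex.exp_int_mul_two_pi_mul_I]
    simp

theorem measurableSet_torusCell (h : ℝ) : MeasurableSet (torusCell d h) := by
  have : torusCell d h = ⋂ i, {x : Rd d | |x i| ≤ Real.pi / h} := by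
    ext x; simp [torusCell]
  rw [this]
  exact (isClosed_iInter fun i => isClosed_le (by fun_prop) continuous_const).measurableSet

instance isFiniteMeasure_torusCell (h : ℝ) :
    IsFiniteMeasure (volume.restrict (torusCell d h)) :=
  ⟨by simpa using torusCell_volume_lt_top h⟩

theorem integral_exp_torusCell {h : ℝ} (hh : 0 < h) (k : Fin d → ℤ) :
    ∫ ξ in torusCell d h, Complex.exp (Complex.I * (inner ℝ (h • intVec k) ξ : ℝ))
      = if k = 0 then (((2 * Real.pi / h) ^ d : ℝ) : ℂ) else 0 := by
  rw [← integral_indicator (measurableSet_torusCell h)]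
  have hmp := (PiLp.volume_preserving_toLp (Fin d))
  rw [← hmp.integral_comp (MeasurableEquiv.toLp 2 (Fin d → ℝ)).measurableEmbedding]
  have e : ∀ x : Fin d → ℝ, (torusCell d h).indicator
      (fun ξ => Complex.exp (Complex.I * (inner ℝ (h • intVec k) ξ : ℝ))) (WithLp.toLp 2 x)
      = ∏ i, (Set.Icc (-(Real.pi / h)) (Real.pi / h)).indicator
          (fun t : ℝ => Complex.exp (Complex.I * ((h * k i * t : ℝ) : ℂ))) (x i) := by
    intro x
    by_cases hx : WithLp.toLp 2 x ∈ torusCell d h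
    · have hx' : ∀ i, x i ∈ Set.Icc (-(Real.pi / h)) (Real.pi / h) := fun i => abs_le.1 (hx i)
      rw [Set.indicator_of_mem hx]
      simp_rw [fun i => Set.indicator_of_mem (hx' i)
        (fun t : ℝ => Complex.exp (Complex.I * ((h * k i * t : ℝ) : ℂ)))]
      rw [← Complex.exp_sum, ← Finset.mul_sum, ← Complex.ofReal_sum]
      congr 3
      simp only [PiLp.inner_apply, PiLp.smul_apply, intVec_apply, smul_eq_mul, RCLike.inner_apply,
        conj_trivial]
      exact Finset.sum_congr rfl fun i _ => mul_comm _ _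
    · rw [Set.indicator_of_notMem hx]
      have : ∃ i, x i ∉ Set.Icc (-(Real.pi / h)) (Real.pi / h) := by
        by_contra hcon
        push Not at hcon
        exact hx fun i => abs_le.2 (hcon i)
      obtain ⟨i, hi⟩ := this
      exact (Finset.prod_eq_zero (Finset.mem_univ i) (Set.indicator_of_notMem hi _)).symm
  simp_rw [e]
  rw [integral_fintype_prod_volume_eq_prod (𝕜 := ℂ) (E := fun _ : Fin d => ℝ)
    (fun i => (Set.Icc (-(Real.pi / h)) (Real.pi / h)).indicator
          (fun t : ℝ => Complex.exp (Complex.I * ((h * k i * t : ℝ) : ℂ))))]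
  simp_rw [integral_indicator measurableSet_Icc, integral_exp_cell_one hh]
  split_ifs with hk
  · subst hk
    simp [div_pow]
  · obtain ⟨i, hi⟩ := Function.ne_iff.1 hk
    exact Finset.prod_eq_zero (Finset.mem_univ i) (if_neg hi)

theorem inner_fourierTerm (h : ℝ) (n m : Fin d → ℤ) (a b : Cs s) (ξ : Rd d) :
    inner ℂ (fourierTerm h n a ξ) (fourierTerm h m b ξ)
      = Complex.exp (Complex.I * (inner ℝ (h • intVec (n - m)) ξ : ℝ)) * inner ℂ a b := by
  simp only [fourierTerm, inner_smul_left, inner_smul_right, ← Complex.exp_conj, map_neg, map_mul,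
    Complex.conj_I, Complex.conj_ofReal]
  rw [← mul_assoc, ← Complex.exp_add]
  congr 2
  have : intVec (n - m) = intVec n - intVec m := by ext i; simp
  rw [this, inner_sub_left, conj_trivial]
  push_cast
  ring

/-- The normalisation `(h / 2π)^{d/2}`. -/
def cellConst (d : ℕ) (h : ℝ) : ℝ := (h / (2 * Real.pi)) ^ ((d : ℝ) / 2)

theorem cellConst_sq {h : ℝ} (hh : 0 < h) : cellConst d h ^ 2 = (h / (2 * Real.pi)) ^ d := by
  rw [cellConst, ← Real.rpow_natCast, ← Real.rpow_mul (by positivity)]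
  rw [show ((d : ℝ) / 2) * ((2 : ℕ) : ℝ) = (d : ℝ) by push_cast; ring, Real.rpow_natCast]

theorem inner_toLp_fourierTerm {h : ℝ} (hh : 0 < h) (n m : Fin d → ℤ) (a b : Cs s) :
    inner ℂ ((cellConst d h : ℂ) • (fourierTerm_memLp h n a).toLp (fourierTerm h n a))
      ((cellConst d h : ℂ) • (fourierTerm_memLp h m b).toLp (fourierTerm h m b))
      = if n = m then inner ℂ a b else 0 := by
  rw [inner_smul_left, inner_smul_right, L2.inner_def]
  have e : ∫ ξ, inner ℂ ((fourierTerm_memLp h n a).toLp (fourierTerm h n a) ξ)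
      ((fourierTerm_memLp h m b).toLp (fourierTerm h m b) ξ) ∂(volume.restrict (torusCell d h))
      = ∫ ξ in torusCell d h,
        Complex.exp (Complex.I * (inner ℝ (h • intVec (n - m)) ξ : ℝ)) * inner ℂ a b := by
    refine integral_congr_ae ?_
    filter_upwards [(fourierTerm_memLp h n a).coeFn_toLp, (fourierTerm_memLp h m b).coeFn_toLp]
      with ξ h1 h2
    rw [h1, h2, inner_fourierTerm]
  rw [e, integral_mul_const, integral_exp_torusCell hh, Complex.conj_ofReal]
  simp only [sub_eq_zero]
  split_ifs with hnm
  · rw [← mul_assoc, ← mul_assoc, ← Complex.ofReal_mul, ← pow_two, cellConst_sq hh,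
      ← Complex.ofReal_mul, ← mul_pow]
    have : h / (2 * Real.pi) * (2 * Real.pi / h) = 1 := by
      have := hh.ne'
      have := Real.pi_ne_zero
      field_simp
    simp [this]
  · simp

/-- The isometric embedding of the fibre over `n` into `L²` of the cell. -/
def fourierIso {h : ℝ} (hh : 0 < h) (n : Fin d → ℤ) :
    Cs s →ₗᵢ[ℂ] Lp (Cs s) 2 (volume.restrict (torusCell d h)) :=
  LinearMap.isometryOfInner
    { toFun := fun c => (cellConst d h : ℂ) • (fourierTerm_memLp h n c).toLp (fourierTerm h n c)
      map_add' := fun a b => by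
        rw [← smul_add]
        congr 1
        rw [← MemLp.toLp_add]
        congr 1
        ext1 ξ
        simp [fourierTerm]
      map_smul' := fun c a => by
        rw [RingHom.id_apply, smul_comm]
        congr 1
        rw [← MemLp.toLp_const_smul]
        congr 1
        ext1 ξ
        simp only [fourierTerm, Pi.smul_apply]
        rw [smul_comm] }
    fun a b => by
      simpa using inner_toLp_fourierTerm hh n n a b

theorem orthogonalFamily_fourierIso {h : ℝ} (hh : 0 < h) :
    OrthogonalFamily ℂ (fun _ : Fin d → ℤ => Cs s) (fourierIso (d := d) (s := s) hh) := by
  intro n m hnm a b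
  exact (inner_toLp_fourierTerm hh n m a b).trans (if_neg hnm)

/-- The Fourier series is the isometry attached to an orthogonal family, from which Parseval
follows. -/
theorem discFourier_eq {h : ℝ} (hh : 0 < h) (u : lp (fun _ : Fin d → ℤ => Cs s) 2) :
    discFourier h u = (orthogonalFamily_fourierIso hh).linearIsometry u := by
  rw [OrthogonalFamily.linearIsometry_apply, discFourier, ← tsum_const_smul'']
  rfl

theorem inner_discFourier {h : ℝ} (hh : 0 < h) (u v : lp (fun _ : Fin d → ℤ => Cs s) 2) :
    inner ℂ (discFourier h u) (discFourier h v) = inner ℂ u v := by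
  rw [discFourier_eq hh, discFourier_eq hh, LinearIsometry.inner_map_map]

/-- Parseval against a vector `c` placed at `n` gives `⟨c, u n⟩`. Written out, the same `L²` inner
product is the interpolation integral at `h n`, paired with `c`. -/
theorem interpolate_lattice {h : ℝ} (hh : 0 < h) (u : lp (fun _ : Fin d → ℤ => Cs s) 2)
    (n : Fin d → ℤ) : interpolate h u (h • intVec n) = u n := by
  classical
  refine ext_inner_left ℂ fun c => ?_
  have h1 := (orthogonalFamily_fourierIso (s := s) hh).linearIsometry.inner_map_map
    (lp.single 2 n c) u
  rw [OrthogonalFamily.linearIsometry_apply_single, ← discFourier_eq hh,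
    lp.inner_single_left] at h1
  rw [← h1]
  have hint : Integrable (fun ξ => Complex.exp (Complex.I * (inner ℝ (h • intVec n) ξ : ℝ)) •
      discFourier h u ξ) (volume.restrict (torusCell d h)) := by
    refine Integrable.bdd_smul (𝕜 := ℂ) ((Lp.memLp (discFourier h u)).integrable (by norm_num)) 1
      (Continuous.aestronglyMeasurable (by fun_prop)) (Eventually.of_forall fun ξ => ?_)
    rw [mul_comm, Complex.norm_exp_ofReal_mul_I]
  change _ = inner ℂ ((cellConst d h : ℂ) • (fourierTerm_memLp h n c).toLp (fourierTerm h n c)) _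
  rw [interpolate, inner_smul_right, ← integral_inner hint, inner_smul_left, Complex.conj_ofReal,
    L2.inner_def]
  change (cellConst d h : ℂ) * _ = _
  congr 1
  refine integral_congr_ae ?_
  filter_upwards [(fourierTerm_memLp h n c).coeFn_toLp] with ξ h1
  rw [h1]
  simp only [fourierTerm, inner_smul_left, inner_smul_right, ← Complex.exp_conj, map_neg, map_mul,
    Complex.conj_I, Complex.conj_ofReal]
  ring_nf

/-- The discrete Fourier transform as a function on `ℝᵈ` (vanishing off a cell), in the frequency
variable `η = ξ / 2π` and normalised so that its inverse Fourier transform is the interpolation. -/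
def dft (h : ℝ) (u : lp (fun _ : Fin d → ℤ => Cs s) 2) : Rd d → Cs s :=
  (closedTile d h⁻¹).indicator fun η =>
    (((2 * Real.pi) ^ d * cellConst d h : ℝ) : ℂ) • discFourier h u ((2 * Real.pi) • η)

theorem smul_mem_torusCell {h : ℝ} (hh : 0 < h) (η : Rd d) :
    (2 * Real.pi) • η ∈ torusCell d h ↔ η ∈ closedTile d h⁻¹ := by
  refine forall_congr' fun i => ?_
  have := Real.pi_pos
  rw [PiLp.smul_apply, smul_eq_mul, abs_mul, abs_of_pos (by positivity)]
  have e : Real.pi / h = 2 * Real.pi * (h⁻¹ / 2) := by field_simp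
  rw [e, mul_le_mul_iff_right₀ (by positivity)]

theorem dft_eq_indicator {h : ℝ} (hh : 0 < h) (u : lp (fun _ : Fin d → ℤ => Cs s) 2) (η : Rd d) :
    dft h u η = (((2 * Real.pi) ^ d * cellConst d h : ℝ) : ℂ) •
      (torusCell d h).indicator (discFourier h u) ((2 * Real.pi) • η) := by
  by_cases hη : η ∈ closedTile d h⁻¹
  · rw [dft, Set.indicator_of_mem hη, Set.indicator_of_mem ((smul_mem_torusCell hh η).2 hη)]
  · rw [dft, Set.indicator_of_notMem hη,
      Set.indicator_of_notMem (mt (smul_mem_torusCell hh η).1 hη), smul_zero]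

theorem dft_of_notMem (h : ℝ) (u : lp (fun _ : Fin d → ℤ => Cs s) 2) {η : Rd d}
    (hη : η ∉ closedTile d h⁻¹) : dft h u η = 0 := Set.indicator_of_notMem hη _

theorem stronglyMeasurable_dft (h : ℝ) (u : lp (fun _ : Fin d → ℤ => Cs s) 2) :
    StronglyMeasurable (dft h u) := by
  refine StronglyMeasurable.indicator ?_ (isClosed_closedTile _).measurableSet
  exact StronglyMeasurable.const_smul (𝕜 := ℂ) ((Lp.stronglyMeasurable
    (discFourier h u)).comp_measurable (measurable_const_smul (2 * Real.pi))) _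

theorem integrable_dft {h : ℝ} (hh : 0 < h) (u : lp (fun _ : Fin d → ℤ => Cs s) 2) :
    Integrable (dft h u) := by
  rw [show dft h u = _ from funext (dft_eq_indicator hh u)]
  refine Integrable.smul (𝕜 := ℂ) _ ?_
  refine Integrable.comp_smul (f := (torusCell d h).indicator (discFourier h u)) ?_
    (by positivity : (2 * Real.pi : ℝ) ≠ 0)
  rw [integrable_indicator_iff (measurableSet_torusCell h)]
  exact (Lp.memLp (discFourier h u)).integrable (by norm_num)

theorem integral_comp_two_pi_smul {F : Type*} [NormedAddCommGroup F] [NormedSpace ℝ F]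
    (φ : Rd d → F) :
    ∫ η, φ ((2 * Real.pi) • η) = ((2 * Real.pi) ^ d)⁻¹ • ∫ ξ, φ ξ := by
  rw [Measure.integral_comp_smul, finrank_euclideanSpace_fin, abs_of_pos (by positivity)]

theorem fourierInv_dft {h : ℝ} (hh : 0 < h) (u : lp (fun _ : Fin d → ℤ => Cs s) 2) :
    𝓕⁻ (dft h u) = interpolate h u := by
  ext1 x
  rw [Real.fourierInv_eq', interpolate]
  have e : ∀ η : Rd d, Complex.exp (↑(2 * Real.pi * inner ℝ η x) * Complex.I) • dft h u η
      = (fun ξ => (((2 * Real.pi) ^ d * cellConst d h : ℝ) : ℂ) • (torusCell d h).indicator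
        (fun ξ => Complex.exp (Complex.I * (inner ℝ x ξ : ℝ)) • discFourier h u ξ) ξ)
          ((2 * Real.pi) • η) := by
    intro η
    rw [dft_eq_indicator hh, smul_comm]
    dsimp only
    congr 1
    by_cases hη : (2 * Real.pi) • η ∈ torusCell d h
    · rw [Set.indicator_of_mem hη, Set.indicator_of_mem hη]
      congr 2
      rw [inner_smul_right, real_inner_comm, mul_comm]
    · rw [Set.indicator_of_notMem hη, Set.indicator_of_notMem hη, smul_zero]
  simp_rw [e]
  rw [integral_comp_two_pi_smul (fun ξ => (((2 * Real.pi) ^ d * cellConst d h : ℝ) : ℂ) •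
    (torusCell d h).indicator
        (fun ξ => Complex.exp (Complex.I * (inner ℝ x ξ : ℝ)) • discFourier h u ξ) ξ),
    integral_smul, integral_indicator (measurableSet_torusCell h), Complex.coe_smul, smul_smul,
    ← mul_assoc, inv_mul_cancel₀ (by positivity), one_mul, cellConst, Complex.coe_smul]

theorem fourierInv_dft_lattice {h : ℝ} (hh : 0 < h) (u : lp (fun _ : Fin d → ℤ => Cs s) 2)
    (n : Fin d → ℤ) : 𝓕⁻ (dft h u) (h • intVec n) = u n := by
  rw [fourierInv_dft hh, interpolate_lattice hh]

/-- Plancherel with the mesh weight `h ^ d`: this factor makes `ℓ²` norms of samples comparable with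
`L²` norms on `ℝᵈ`. -/
theorem integral_inner_dft {h : ℝ} (hh : 0 < h) (u v : lp (fun _ : Fin d → ℤ => Cs s) 2) :
    ∫ η, inner ℂ (dft h u η) (dft h v η) = (h ^ d : ℝ) * inner ℂ u v := by
  have e : ∀ η : Rd d, inner ℂ (dft h u η) (dft h v η)
      = (fun ξ => (((2 * Real.pi) ^ d * cellConst d h : ℝ) ^ 2 : ℂ) * (torusCell d h).indicator
        (fun ξ => inner ℂ (discFourier h u ξ) (discFourier h v ξ)) ξ) ((2 * Real.pi) • η) := by
    intro η
    rw [dft_eq_indicator hh, dft_eq_indicator hh, inner_smul_left, inner_smul_right,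
      Complex.conj_ofReal]
    dsimp only
    rw [pow_two, mul_assoc]
    congr 2
    by_cases hη : (2 * Real.pi) • η ∈ torusCell d h
    · simp only [Set.indicator_of_mem hη]
    · simp only [Set.indicator_of_notMem hη, inner_zero_left]
  simp_rw [e]
  rw [integral_comp_two_pi_smul (fun ξ => (((2 * Real.pi) ^ d * cellConst d h : ℝ) ^ 2 : ℂ) *
    (torusCell d h).indicator
        (fun ξ => inner ℂ (discFourier h u ξ) (discFourier h v ξ)) ξ), integral_const_mul,
    integral_indicator (measurableSet_torusCell h), ← L2.inner_def, inner_discFourier hh,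
    Complex.real_smul, ← mul_assoc, ← Complex.ofReal_pow, mul_pow _ (cellConst d h), cellConst_sq hh,
    ← Complex.ofReal_mul]
  congr 2
  have := hh.ne'
  have := Real.pi_ne_zero
  rw [div_pow]
  field_simp

theorem memLp_dft {h : ℝ} (hh : 0 < h) (u : lp (fun _ : Fin d → ℤ => Cs s) 2) :
    MemLp (dft h u) 2 := by
  have h1 : MemLp ((torusCell d h).indicator (discFourier h u)) 2 := by
    rw [memLp_indicator_iff_restrict (measurableSet_torusCell h)]
    exact Lp.memLp (discFourier h u)
  rw [memLp_two_iff_integrable_sq_norm (stronglyMeasurable_dft h u).aestronglyMeasurable]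
  have h2 := (memLp_two_iff_integrable_sq_norm h1.1).1 h1
  have h3 := h2.comp_smul (by positivity : (2 * Real.pi : ℝ) ≠ 0)
  refine (h3.const_mul (‖(((2 * Real.pi) ^ d * cellConst d h : ℝ) : ℂ)‖ ^ 2)).congr
    (Eventually.of_forall fun η => ?_)
  dsimp only
  rw [dft_eq_indicator hh, norm_smul]
  ring

theorem integral_norm_sq_dft {h : ℝ} (hh : 0 < h) (u : lp (fun _ : Fin d → ℤ => Cs s) 2) :
    ∫ η, ‖dft h u η‖ ^ 2 = h ^ d * ‖u‖ ^ 2 := by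
  have h1 := integral_inner_dft hh u u
  simp only [inner_self_eq_norm_sq_to_K] at h1
  have h2 : (((∫ η, ‖dft h u η‖ ^ 2 : ℝ)) : ℂ) = ((h ^ d * ‖u‖ ^ 2 : ℝ) : ℂ) := by
    rw [← integral_complex_ofReal]
    push_cast at h1 ⊢
    exact h1
  exact_mod_cast h2

/-! ### The discrete Laplacian on the Fourier side -/

theorem finite_neighborSet (Γ : PeriodicGraph d s) (a : Fin s × (Fin d → ℤ)) :
    (Γ.graph.neighborSet a).Finite := by
  refine Set.finite_of_ncard_ne_zero ?_
  rw [Γ.ncard_neighborSet]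
  exact Γ.deg_pos.ne'

/-- The neighbours of the vertex `(j, 0)`. -/
def nbr (Γ : PeriodicGraph d s) (j : Fin s) : Finset (Fin s × (Fin d → ℤ)) :=
  (finite_neighborSet Γ (j, 0)).toFinset

theorem mem_nbr {Γ : PeriodicGraph d s} {j : Fin s} {p : Fin s × (Fin d → ℤ)} :
    p ∈ nbr Γ j ↔ Γ.graph.Adj (j, 0) p := by
  simp [nbr]

theorem laplacian_apply (Γ : PeriodicGraph d s) (u : (Fin d → ℤ) → Cs s) (n : Fin d → ℤ)
    (j : Fin s) :
    laplacian Γ u n j = (1 / (Γ.deg : ℂ)) * ∑ p ∈ nbr Γ j, u (n + p.2) p.1 := by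
  change (1 / (Γ.deg : ℂ)) * ∑ᶠ b ∈ Γ.graph.neighborSet (j, n), u b.2 b.1 = _
  congr 1
  rw [← finsum_mem_finset_eq_sum]
  symm
  refine finsum_mem_eq_of_bijOn (fun p => (p.1, n + p.2)) ⟨?_, ?_, ?_⟩ fun _ _ => rfl
  · intro p hp
    simpa using Γ.adj_translate n _ _ (mem_nbr.1 hp)
  · rintro ⟨a, b⟩ _ ⟨a', b'⟩ _ h
    simpa using h
  · rintro ⟨k, l⟩ hb
    refine ⟨(k, -n + l), ?_, by simp⟩
    simpa [mem_nbr] using Γ.adj_translate (-n) _ _ hb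

theorem symbol_apply (Γ : PeriodicGraph d s) (η : Rd d) (x : Cs s) (j : Fin s) :
    Matrix.toEuclideanLin (symbol Γ η) x j
      = -((1 / (Γ.deg : ℂ)) * ∑ p ∈ nbr Γ j,
          Complex.exp (Complex.I * (inner ℝ (intVec p.2) η : ℝ)) * x p.1) := by
  have hfin : ∀ k, {l : Fin d → ℤ | Γ.graph.Adj (j, 0) (k, l)}.Finite := by
    intro k
    refine Set.Finite.of_finite_image (f := fun l => ((k, l) : Fin s × (Fin d → ℤ))) ?_ ?_
    · refine (finite_neighborSet Γ (j, 0)).subset ?_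
      rintro _ ⟨l, hl, rfl⟩
      exact hl
    · intro a _ b _ h
      simpa using h
  have h1 : Matrix.toEuclideanLin (symbol Γ η) x j = ∑ k, symbol Γ η j k * x k := by
    simp [Matrix.toLpLin_apply, Matrix.mulVec, dotProduct]
  rw [h1]
  simp only [symbol, Matrix.of_apply, finsum_mem_eq_finite_toFinset_sum _ (hfin _)]
  simp only [neg_mul, Finset.sum_neg_distrib, mul_assoc, Finset.sum_mul, ← Finset.mul_sum]
  congr 2
  rw [Finset.sum_sigma']
  refine Finset.sum_bij' (fun p _ => (p.1, p.2)) (fun p _ => ⟨p.1, p.2⟩) ?_ ?_ ?_ ?_ ?_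
  · rintro ⟨k, l⟩ h
    simpa [mem_nbr] using h
  · rintro ⟨k, l⟩ h
    simpa [mem_nbr] using h
  · simp
  · simp
  · simp

theorem symbolH_apply (Γ : PeriodicGraph d s) (ν E₀ h : ℝ) (η : Rd d) (x : Cs s) :
    Matrix.toEuclideanLin (symbolH Γ ν E₀ h η) x
      = ((h ^ (-ν) : ℝ) : ℂ) • (Matrix.toEuclideanLin (symbol Γ (h • η)) x - (E₀ : ℂ) • x) := by
  rw [symbolH, map_smul, map_sub, map_smul, LinearMap.smul_apply, LinearMap.sub_apply,
    LinearMap.smul_apply]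
  simp [Matrix.toLpLin_apply]

theorem integrable_exp_smul {F : Rd d → Cs s} (hF : Integrable F) (x : Rd d) :
    Integrable fun η => Complex.exp (↑(2 * Real.pi * inner ℝ η x) * Complex.I) • F η := by
  refine Integrable.bdd_smul (𝕜 := ℂ) hF 1
    (Continuous.aestronglyMeasurable (by fun_prop)) (Eventually.of_forall fun ξ => ?_)
  rw [Complex.norm_exp_ofReal_mul_I]

theorem fourierInv_sub_apply {F G : Rd d → Cs s} (hF : Integrable F) (hG : Integrable G)
    (x : Rd d) : 𝓕⁻ (F - G) x = 𝓕⁻ F x - 𝓕⁻ G x := by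
  simp only [Real.fourierInv_eq', Pi.sub_apply, smul_sub]
  exact integral_sub (integrable_exp_smul hF x) (integrable_exp_smul hG x)

theorem fourierInv_add_apply {F G : Rd d → Cs s} (hF : Integrable F) (hG : Integrable G)
    (x : Rd d) : 𝓕⁻ (F + G) x = 𝓕⁻ F x + 𝓕⁻ G x := by
  simp only [Real.fourierInv_eq', Pi.add_apply, smul_add]
  exact integral_add (integrable_exp_smul hF x) (integrable_exp_smul hG x)

theorem norm_fourierInv_le (F : Rd d → Cs s) (x : Rd d) : ‖𝓕⁻ F x‖ ≤ ∫ η, ‖F η‖ := by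
  rw [Real.fourierInv_eq']
  refine (norm_integral_le_integral_norm _).trans (le_of_eq ?_)
  congr 1 with η
  rw [norm_smul, Complex.norm_exp_ofReal_mul_I, one_mul]

theorem fourierInv_apply_coord {F : Rd d → Cs s} (hF : Integrable F) (x : Rd d) (j : Fin s) :
    𝓕⁻ F x j = ∫ η, Complex.exp (↑(2 * Real.pi * inner ℝ η x) * Complex.I) * F η j := by
  rw [Real.fourierInv_eq']
  exact ((EuclideanSpace.proj j : Cs s →L[ℂ] ℂ).integral_comp_comm (integrable_exp_smul hF x)).symm

theorem integrable_coord {F : Rd d → Cs s} (hF : Integrable F) (j : Fin s) :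
    Integrable fun η => F η j :=
  (EuclideanSpace.proj j : Cs s →L[ℂ] ℂ).integrable_comp hF

theorem continuous_symbol_entry (Γ : PeriodicGraph d s) (x : Cs s) (j : Fin s) :
    Continuous fun η => Matrix.toEuclideanLin (symbol Γ η) x j := by
  simp only [symbol_apply]
  fun_prop

theorem continuous_symbol (Γ : PeriodicGraph d s) : Continuous (symbol Γ) := by
  refine continuous_matrix fun i k => ?_
  have := continuous_symbol_entry Γ (EuclideanSpace.single k 1) i
  simpa [Matrix.toLpLin_apply] using this

theorem continuous_symbolH (Γ : PeriodicGraph d s) (ν E₀ h : ℝ) :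
    Continuous (symbolH Γ ν E₀ h) := by
  unfold symbolH
  have := continuous_symbol Γ
  fun_prop

theorem norm_exp_I_mul (t : ℝ) : ‖Complex.exp (Complex.I * (t : ℂ))‖ = 1 := by
  rw [mul_comm, Complex.norm_exp_ofReal_mul_I]

/-- The factor `e^{i l · h(2πη + d_h)}` of a neighbour in the cell shifted by `l` moves the sampling
point from `h n` to `h (n + l)` and leaves the phase `e^{i l · d₁}`, exactly the phase produced by
conjugating with the gauge. -/
theorem fourierInv_symbol_apply {h : ℝ} (hh : 0 < h) (Γ : PeriodicGraph d s) (ν E₀ : ℝ)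
    (d₁ : Rd d) {G : Rd d → Cs s} (hG : Integrable G)
    (hBG : Integrable fun η => Matrix.toEuclideanLin
      (symbolH Γ ν E₀ h ((2 * Real.pi) • η + h⁻¹ • d₁)) (G η)) (n : Fin d → ℤ) :
    𝓕⁻ (fun η => Matrix.toEuclideanLin
      (symbolH Γ ν E₀ h ((2 * Real.pi) • η + h⁻¹ • d₁)) (G η)) (h • intVec n)
      = -gaugeAdj d₁ h (laplacianDisc Γ ν E₀ h
          (gauge d₁ h fun m => 𝓕⁻ G (h • intVec m))) n := by
  have hphase : ∀ m : Fin d → ℤ, (inner ℝ (h • intVec m) (h⁻¹ • d₁) : ℝ) = inner ℝ (intVec m) d₁ := by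
    intro m
    rw [real_inner_smul_left, real_inner_smul_right, ← mul_assoc, mul_inv_cancel₀ hh.ne', one_mul]
  ext j
  have hterm : ∀ (l : Fin d → ℤ) (k : Fin s),
      ∫ η, Complex.exp (↑(2 * Real.pi * inner ℝ η (h • intVec n)) * Complex.I) *
        (Complex.exp (Complex.I * (inner ℝ (intVec l) (h • ((2 * Real.pi) • η + h⁻¹ • d₁)) : ℝ))
          * G η k) = Complex.exp (Complex.I * (inner ℝ (intVec l) d₁ : ℝ)) *
            𝓕⁻ G (h • intVec (n + l)) k := by
    intro l k
    rw [fourierInv_apply_coord hG, ← integral_const_mul]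
    congr 1 with η
    rw [← mul_assoc, ← mul_assoc, ← Complex.exp_add, ← Complex.exp_add]
    congr 2
    rw [smul_add, inner_add_right, smul_smul h h⁻¹, mul_inv_cancel₀ hh.ne', one_smul, intVec_add]
    simp only [inner_smul_right, inner_add_right, real_inner_comm η]
    push_cast
    ring
  have hexp : ∀ (t : Rd d → ℝ), Continuous t → ∀ φ : Rd d → ℂ, Integrable φ →
      Integrable fun η => Complex.exp (↑(t η) * Complex.I) * φ η := by
    intro t ht φ hφ
    refine Integrable.bdd_smul (𝕜 := ℂ) hφ 1
      (Continuous.aestronglyMeasurable (by fun_prop)) (Eventually.of_forall fun ξ => ?_)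
    rw [Complex.norm_exp_ofReal_mul_I]
  have hexp' : ∀ (t : Rd d → ℝ), Continuous t → ∀ φ : Rd d → ℂ, Integrable φ →
      Integrable fun η => Complex.exp (Complex.I * ↑(t η)) * φ η := by
    intro t ht φ hφ
    simpa only [mul_comm] using hexp t ht φ hφ
  rw [fourierInv_apply_coord hBG]
  simp only [symbolH_apply, PiLp.smul_apply, PiLp.sub_apply, symbol_apply, smul_eq_mul]
  have hL : ∀ η : Rd d, Complex.exp (↑(2 * Real.pi * inner ℝ η (h • intVec n)) * Complex.I) *
      (((h ^ (-ν) : ℝ) : ℂ) * (-((1 / (Γ.deg : ℂ)) * ∑ p ∈ nbr Γ j, Complex.exp (Complex.I *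
        (inner ℝ (intVec p.2) (h • ((2 * Real.pi) • η + h⁻¹ • d₁)) : ℝ)) * G η p.1) -
          (E₀ : ℂ) * G η j))
      = ((h ^ (-ν) : ℝ) : ℂ) * (-((1 / (Γ.deg : ℂ)) * ∑ p ∈ nbr Γ j,
          Complex.exp (↑(2 * Real.pi * inner ℝ η (h • intVec n)) * Complex.I) *
          (Complex.exp (Complex.I * (inner ℝ (intVec p.2)
            (h • ((2 * Real.pi) • η + h⁻¹ • d₁)) : ℝ)) * G η p.1)) - (E₀ : ℂ) *
            (Complex.exp (↑(2 * Real.pi * inner ℝ η (h • intVec n)) * Complex.I) * G η j)) := by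
    intro η
    rw [← Finset.mul_sum]
    ring
  simp_rw [hL]
  have hi1 : ∀ p ∈ nbr Γ j, Integrable fun η : Rd d =>
      Complex.exp (↑(2 * Real.pi * inner ℝ η (h • intVec n)) * Complex.I) *
          (Complex.exp (Complex.I * (inner ℝ (intVec p.2)
            (h • ((2 * Real.pi) • η + h⁻¹ • d₁)) : ℝ)) * G η p.1) := fun p _ =>
    hexp _ (by fun_prop) _ (hexp' _ (by fun_prop) _ (integrable_coord hG p.1))
  have hi2 : Integrable fun η : Rd d =>
      Complex.exp (↑(2 * Real.pi * inner ℝ η (h • intVec n)) * Complex.I) * G η j :=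
    hexp _ (by fun_prop) _ (integrable_coord hG j)
  rw [integral_const_mul, integral_sub ((integrable_finsetSum _ hi1).const_mul _).fun_neg
    (hi2.const_mul _), integral_neg, integral_const_mul, integral_finsetSum _ hi1,
    integral_const_mul, ← fourierInv_apply_coord hG]
  simp_rw [hterm]
  simp only [gaugeAdj, laplacianDisc, PiLp.neg_apply, PiLp.smul_apply, PiLp.add_apply, smul_eq_mul,
    laplacian_apply, gauge, hphase]
  have hsum : ∑ p ∈ nbr Γ j, Complex.exp (Complex.I * (inner ℝ (intVec (n + p.2)) d₁ : ℝ)) *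
        𝓕⁻ G (h • intVec (n + p.2)) p.1
      = Complex.exp (Complex.I * (inner ℝ (intVec n) d₁ : ℝ)) * ∑ p ∈ nbr Γ j,
        Complex.exp (Complex.I * (inner ℝ (intVec p.2) d₁ : ℝ)) *
          𝓕⁻ G (h • intVec (n + p.2)) p.1 := by
    rw [Finset.mul_sum]
    refine Finset.sum_congr rfl fun p _ => ?_
    rw [← mul_assoc, ← Complex.exp_add, intVec_add n, inner_add_left]
    push_cast
    ring_nf
  rw [hsum]
  have hone : Complex.exp (-(Complex.I * (inner ℝ (intVec n) d₁ : ℝ))) *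
      Complex.exp (Complex.I * (inner ℝ (intVec n) d₁ : ℝ)) = 1 := by
    rw [← Complex.exp_add]; simp
  generalize Complex.exp (-(Complex.I * (inner ℝ (intVec n) d₁ : ℝ))) = a at hone ⊢
  generalize Complex.exp (Complex.I * (inner ℝ (intVec n) d₁ : ℝ)) = b at hone ⊢
  generalize (∑ p ∈ nbr Γ j, Complex.exp (Complex.I * (inner ℝ (intVec p.2) d₁ : ℝ)) *
          𝓕⁻ G (h • intVec (n + p.2)) p.1) = S
  linear_combination (((h ^ (-ν) : ℝ) : ℂ) * (1 / (Γ.deg : ℂ) * S + E₀ * 𝓕⁻ G (h • intVec n) j))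
    * hone

theorem integrable_symbolH_apply (h : ℝ) (Γ : PeriodicGraph d s) (ν E₀ : ℝ)
    (d₁ : Rd d) {G : Rd d → Cs s} (hG : Integrable G) :
    Integrable fun η => Matrix.toEuclideanLin
      (symbolH Γ ν E₀ h ((2 * Real.pi) • η + h⁻¹ • d₁)) (G η) := by
  have hc : ∀ j, Integrable fun η => Matrix.toEuclideanLin
      (symbolH Γ ν E₀ h ((2 * Real.pi) • η + h⁻¹ • d₁)) (G η) j := by
    intro j
    simp only [symbolH_apply, PiLp.smul_apply, PiLp.sub_apply, symbol_apply, smul_eq_mul]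
    refine Integrable.const_mul (((integrable_finsetSum _ fun p _ => ?_).const_mul _).neg.sub
      ((integrable_coord hG j).const_mul _)) _
    refine Integrable.bdd_smul (𝕜 := ℂ) (integrable_coord hG p.1) 1
      (Continuous.aestronglyMeasurable (by fun_prop)) (Eventually.of_forall fun ξ => ?_)
    rw [norm_exp_I_mul]
  have : (fun η => Matrix.toEuclideanLin
      (symbolH Γ ν E₀ h ((2 * Real.pi) • η + h⁻¹ • d₁)) (G η))
      = fun η => ∑ j, (Matrix.toEuclideanLin
        (symbolH Γ ν E₀ h ((2 * Real.pi) • η + h⁻¹ • d₁)) (G η) j) •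
          EuclideanSpace.basisFun (Fin s) ℂ j := by
    ext1 η
    simpa using ((EuclideanSpace.basisFun (Fin s) ℂ).sum_repr (Matrix.toEuclideanLin
      (symbolH Γ ν E₀ h ((2 * Real.pi) • η + h⁻¹ • d₁)) (G η))).symm
  rw [this]
  exact integrable_finsetSum _ fun j _ => (hc j).smul_const _

/-- Both sides vanish off the cell and have the same samples on `hℤᵈ`. -/
theorem dft_laplacianDisc {h : ℝ} (hh : 0 < h) (Γ : PeriodicGraph d s) (ν E₀ : ℝ) (d₁ : Rd d)
    (u y : lp (fun _ : Fin d → ℤ => Cs s) 2)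
    (hy : ∀ n, y n = -gaugeAdj d₁ h (laplacianDisc Γ ν E₀ h (gauge d₁ h u)) n) :
    ∀ᵐ η, dft h y η = Matrix.toEuclideanLin
      (symbolH Γ ν E₀ h ((2 * Real.pi) • η + h⁻¹ • d₁)) (dft h u η) := by
  have hG := integrable_dft hh u
  have hBG := integrable_symbolH_apply h Γ ν E₀ d₁ hG
  have key := ae_eq_zero_of_fourierInv_lattice ((integrable_dft hh y).sub hBG) hh ?_ ?_
  · filter_upwards [key] with η hη
    exact sub_eq_zero.1 hη
  · refine Eventually.of_forall fun η hη => ?_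
    simp [dft_of_notMem h _ hη]
  · intro n
    have h1 := fourierInv_symbol_apply hh Γ ν E₀ d₁ hG hBG n
    have h2 : (fun m => 𝓕⁻ (dft h u) (h • intVec m)) = u := funext (fourierInv_dft_lattice hh u)
    rw [h2, ← hy n] at h1
    rw [fourierInv_sub_apply (integrable_dft hh y) hBG, fourierInv_dft_lattice hh, h1, sub_self]

/-! ### Aliasing -/

theorem exp_lattice_periodic {h : ℝ} (hh : 0 < h) (n k : Fin d → ℤ) (η : Rd d) :
    Complex.exp (↑(2 * Real.pi * inner ℝ (η + h⁻¹ • intVec k) (h • intVec n)) * Complex.I)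
      = Complex.exp (↑(2 * Real.pi * inner ℝ η (h • intVec n)) * Complex.I) := by
  have e : (inner ℝ (h⁻¹ • intVec k) (h • intVec n) : ℝ) = ((∑ i, k i * n i : ℤ) : ℝ) := by
    rw [real_inner_smul_left, real_inner_smul_right, ← mul_assoc, inv_mul_cancel₀ hh.ne', one_mul]
    simp only [PiLp.inner_apply, intVec_apply, RCLike.inner_apply, conj_trivial]
    push_cast
    exact Finset.sum_congr rfl fun i _ => mul_comm _ _
  rw [inner_add_left, e]
  have e2 : ((2 * Real.pi * (inner ℝ η (h • intVec n) + ((∑ i, k i * n i : ℤ) : ℝ)) : ℝ) : ℂ)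
        * Complex.I
      = ((2 * Real.pi * inner ℝ η (h • intVec n) : ℝ) : ℂ) * Complex.I
        + ((∑ i, k i * n i : ℤ) : ℂ) * (2 * Real.pi * Complex.I) := by
    push_cast
    ring
  rw [e2, Complex.exp_add, Complex.exp_int_mul_two_pi_mul_I, mul_one]

/-- The periodization of `g` with respect to the lattice `T ℤᵈ`. -/
def periodize (T : ℝ) (g : Rd d → Cs s) (η : Rd d) : Cs s :=
  ∑' k : Fin d → ℤ, g (η + T • intVec k)

/-- By Tonelli, the sum of the translates has integral `∫ ‖g‖` over one tile. -/
theorem ae_summable_translates {T : ℝ} (hT : 0 < T) {g : Rd d → Cs s} (hg : Integrable g) :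
    ∀ᵐ η ∂(volume.restrict (tile d T)), Summable fun k : Fin d → ℤ => ‖g (η + T • intVec k)‖ := by
  have h1 : ∀ k : Fin d → ℤ, AEMeasurable (fun η => ‖g (η + T • intVec k)‖ₑ)
      (volume.restrict (tile d T)) := fun k =>
    (hg.comp_add_right (T • intVec k)).aestronglyMeasurable.enorm.restrict
  have h2 : ∫⁻ η in tile d T, ∑' k : Fin d → ℤ, ‖g (η + T • intVec k)‖ₑ ≠ ⊤ := by
    rw [lintegral_tsum h1, ← lintegral_eq_tsum_tile hT (fun η => ‖g η‖ₑ)]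
    exact hg.hasFiniteIntegral.ne
  filter_upwards [ae_lt_top' (AEMeasurable.tsum h1) h2] with η hη
  have := ENNReal.summable_toReal hη.ne
  simpa using this

theorem integrableOn_periodize {T : ℝ} (hT : 0 < T) {g : Rd d → Cs s} (hg : Integrable g) :
    IntegrableOn (periodize T g) (tile d T) := by
  have hm : ∀ k : Fin d → ℤ, AEStronglyMeasurable (fun η => g (η + T • intVec k))
      (volume.restrict (tile d T)) := fun k =>
    (hg.comp_add_right (T • intVec k)).aestronglyMeasurable.restrict
  refine ⟨aestronglyMeasurable_of_tendsto_ae (atTop : Filter (Finset (Fin d → ℤ)))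
    (f := fun S η => ∑ k ∈ S, g (η + T • intVec k)) (fun S => ?_) ?_, ?_⟩
  · exact Finset.aestronglyMeasurable_fun_sum S fun k _ => hm k
  · filter_upwards [ae_summable_translates hT hg] with η hη
    exact hη.of_norm.hasSum
  · refine lt_of_le_of_lt (lintegral_mono fun η => enorm_tsum_le_tsum_enorm) ?_
    rw [lintegral_tsum fun k => (hm k).enorm, ← lintegral_eq_tsum_tile hT (fun η => ‖g η‖ₑ)]
    exact hg.hasFiniteIntegral

/-- Unfolding, as in Poisson summation: the character is `h⁻¹ℤᵈ`-periodic, so the integral over `ℝᵈ`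
folds onto one tile. -/
theorem integral_exp_smul_periodize {h : ℝ} (hh : 0 < h) {g : Rd d → Cs s} (hg : Integrable g)
    (n : Fin d → ℤ) :
    ∫ η in tile d h⁻¹, Complex.exp (↑(2 * Real.pi * inner ℝ η (h • intVec n)) * Complex.I) •
      periodize h⁻¹ g η = 𝓕⁻ g (h • intVec n) := by
  have hT : 0 < h⁻¹ := inv_pos.2 hh
  have hφ := integrable_exp_smul hg (h • intVec n)
  have h1 := hasSum_integral_tile hT hφ
  have h2 := hasSum_integral_tile hT hφ.norm
  have h3 := hasSum_integral_of_summable_integral_norm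
    (F := fun (k : Fin d → ℤ) η => (fun η =>
      Complex.exp (↑(2 * Real.pi * inner ℝ η (h • intVec n)) * Complex.I) • g η)
        (η + h⁻¹ • intVec k)) (μ := volume.restrict (tile d h⁻¹))
    (fun k => (hφ.comp_add_right (h⁻¹ • intVec k)).restrict) h2.summable
  have h4 := h3.unique h1
  rw [Real.fourierInv_eq', ← h4]
  congr 1 with η : 1
  simp_rw [exp_lattice_periodic hh]
  rw [tsum_const_smul'']
  rfl

theorem dft_ae_eq_periodize {h : ℝ} (hh : 0 < h) {g : Rd d → Cs s} (hg : Integrable g)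
    (u : lp (fun _ : Fin d → ℤ => Cs s) 2) (hu : ∀ n, u n = 𝓕⁻ g (h • intVec n)) :
    dft h u =ᵐ[volume] (tile d h⁻¹).indicator (periodize h⁻¹ g) := by
  have hT : 0 < h⁻¹ := inv_pos.2 hh
  have hp : Integrable ((tile d h⁻¹).indicator (periodize h⁻¹ g)) :=
    (integrableOn_periodize hT hg).integrable_indicator (measurableSet_tile _)
  have key := ae_eq_zero_of_fourierInv_lattice ((integrable_dft hh u).sub hp) hh ?_ ?_
  · filter_upwards [key] with η hη
    exact sub_eq_zero.1 hη
  · refine Eventually.of_forall fun η hη => ?_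
    rw [Pi.sub_apply, dft_of_notMem h _ hη,
      Set.indicator_of_notMem (mt (fun hm => tile_subset_closedTile _ hm) hη), sub_zero]
  · intro n
    rw [fourierInv_sub_apply (integrable_dft hh u) hp, fourierInv_dft_lattice hh, hu,
      ← integral_exp_smul_periodize hh hg n, Real.fourierInv_eq',
      ← integral_indicator (measurableSet_tile _), sub_eq_zero]
    congr 1 with η : 1
    exact Set.indicator_smul_apply _ (fun η =>
      Complex.exp (↑(2 * Real.pi * inner ℝ η (h • intVec n)) * Complex.I)) (periodize h⁻¹ g) η

/-- Inside the tile the error is the sum of the translates with `k ≠ 0`, evaluated at points outside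
the tile; outside, it is `g` itself. Each part costs the mass of `g` off the tile once, hence the
factor `2`. -/
theorem lintegral_dft_sub_le {h : ℝ} (hh : 0 < h) {g : Rd d → Cs s} (hg : Integrable g)
    (u : lp (fun _ : Fin d → ℤ => Cs s) 2) (hu : ∀ n, u n = 𝓕⁻ g (h • intVec n)) :
    ∫⁻ η, ‖dft h u η - g η‖ₑ ≤ 2 * ∫⁻ η in (tile d h⁻¹)ᶜ, ‖g η‖ₑ := by
  classical
  have hT : 0 < h⁻¹ := inv_pos.2 hh
  have hae := dft_ae_eq_periodize hh hg u hu
  rw [← lintegral_add_compl _ (measurableSet_tile (d := d) h⁻¹), two_mul]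
  refine add_le_add ?_ ?_
  · have e1 : ∫⁻ η in tile d h⁻¹, ‖dft h u η - g η‖ₑ
        ≤ ∫⁻ η in tile d h⁻¹, ∑' k : Fin d → ℤ, (tile d h⁻¹)ᶜ.indicator (fun η => ‖g η‖ₑ)
          (η + h⁻¹ • intVec k) := by
      refine lintegral_mono_ae ?_
      filter_upwards [ae_restrict_of_ae hae, ae_summable_translates hT hg,
        ae_restrict_mem (measurableSet_tile h⁻¹)] with η h1 h2 h3
      rw [h1, Set.indicator_of_mem h3, periodize,
        h2.of_norm.tsum_eq_add_tsum_ite (0 : Fin d → ℤ)]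
      have h0 : intVec (0 : Fin d → ℤ) = 0 := by ext i; simp
      rw [h0, smul_zero, add_zero, add_sub_cancel_left]
      refine enorm_tsum_le_tsum_enorm.trans (ENNReal.tsum_le_tsum fun k => ?_)
      split_ifs with hk
      · simp
      · have : η + h⁻¹ • intVec k ∈ (tile d h⁻¹)ᶜ := by
          intro hmem
          have ha : η + h⁻¹ • intVec k ∈ tileAt h⁻¹ (0 : Fin d → ℤ) := by rwa [tileAt_zero]
          have hb : η + h⁻¹ • intVec k ∈ tileAt h⁻¹ k := by
            rwa [mem_tileAt, add_sub_cancel_right]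
          exact Set.disjoint_left.1 (pairwise_disjoint_tileAt hT (Ne.symm hk)) ha hb
        rw [Set.indicator_of_mem this]
    refine e1.trans (le_of_eq ?_)
    rw [← lintegral_indicator (measurableSet_tile _).compl, lintegral_eq_tsum_tile hT,
      lintegral_tsum]
    intro k
    have hm : AEMeasurable ((tile d h⁻¹)ᶜ.indicator fun η => ‖g η‖ₑ) volume :=
      hg.aestronglyMeasurable.enorm.indicator (measurableSet_tile _).compl
    exact (hm.comp_quasiMeasurePreserving
      (measurePreserving_add_right volume (h⁻¹ • intVec k)).quasiMeasurePreserving).restrict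
  · refine lintegral_mono_ae ?_
    filter_upwards [ae_restrict_of_ae hae, ae_restrict_mem (measurableSet_tile h⁻¹).compl]
      with η h1 h2
    rw [h1, Set.indicator_of_notMem h2, zero_sub, enorm_neg]

theorem lintegral_dft_le {h : ℝ} (hh : 0 < h) {g : Rd d → Cs s} (hg : Integrable g)
    (u : lp (fun _ : Fin d → ℤ => Cs s) 2) (hu : ∀ n, u n = 𝓕⁻ g (h • intVec n)) :
    ∫⁻ η, ‖dft h u η‖ₑ ≤ ∫⁻ η, ‖g η‖ₑ := by
  have hT : 0 < h⁻¹ := inv_pos.2 hh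
  have hm : ∀ k : Fin d → ℤ, AEStronglyMeasurable (fun η => g (η + h⁻¹ • intVec k))
      (volume.restrict (tile d h⁻¹)) := fun k =>
    (hg.comp_add_right (h⁻¹ • intVec k)).aestronglyMeasurable.restrict
  have hae := dft_ae_eq_periodize hh hg u hu
  have e : ∀ᵐ η, ‖dft h u η‖ₑ = (tile d h⁻¹).indicator (fun η => ‖periodize h⁻¹ g η‖ₑ) η := by
    filter_upwards [hae] with η hη
    rw [hη, enorm_indicator_eq_indicator_enorm]
  rw [lintegral_congr_ae e, lintegral_indicator (measurableSet_tile _),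
    lintegral_eq_tsum_tile hT (fun η => ‖g η‖ₑ), ← lintegral_tsum fun k => (hm k).enorm]
  exact lintegral_mono fun η => enorm_tsum_le_tsum_enorm

/-! ### Spectral theory of the symbol -/

theorem exists_eigenbasis_symbol (Γ : PeriodicGraph d s) (E₀ : ℝ) (η : Rd d) :
    ∃ b : OrthonormalBasis (Fin s) ℂ (Cs s), ∀ k,
      Matrix.toEuclideanLin (symbol Γ η) (b k) = ((charRoot Γ E₀ k η + E₀ : ℝ) : ℂ) • b k := by
  set hH := symbol_isHermitian Γ η
  -- `eigenvalues₀` is decreasing, hence the reversal in `charRoot`; `σ` combines it with the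
  -- enumeration used by `eigenvalues`.
  let σ : Fin s ≃ Fin s :=
    (Fin.revPerm.trans (finCongr (Fintype.card_fin s).symm)).trans
      (Fintype.equivOfCardEq (Fintype.card_fin _))
  refine ⟨hH.eigenvectorBasis.reindex σ.symm, fun k => ?_⟩
  rw [OrthonormalBasis.reindex_apply, Equiv.symm_symm]
  have h1 := hH.mulVec_eigenvectorBasis (σ k)
  have h2 : hH.eigenvalues (σ k) = charRoot Γ E₀ k η + E₀ := by
    rw [charRoot, sub_add_cancel, Matrix.IsHermitian.eigenvalues]
    congr 1
    simp [σ]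
  rw [← h2]
  ext i
  have h3 := congrFun h1 i
  simpa [Matrix.toLpLin_apply] using h3

theorem exists_eigenbasis_symbolH (Γ : PeriodicGraph d s) (ν E₀ h : ℝ) (η : Rd d) :
    ∃ b : OrthonormalBasis (Fin s) ℂ (Cs s), ∀ k,
      Matrix.toEuclideanLin (symbolH Γ ν E₀ h η) (b k)
        = ((charRootH Γ ν E₀ h k η : ℝ) : ℂ) • b k := by
  obtain ⟨b, hb⟩ := exists_eigenbasis_symbol Γ E₀ (h • η)
  refine ⟨b, fun k => ?_⟩
  rw [symbolH_apply, hb, ← sub_smul, smul_smul, charRootH]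
  push_cast
  ring_nf

theorem apply_eq_sum_eigenbasis {T : Cs s →ₗ[ℂ] Cs s} {b : OrthonormalBasis (Fin s) ℂ (Cs s)}
    {μ : Fin s → ℝ} (hb : ∀ k, T (b k) = (μ k : ℂ) • b k) (k : Fin s) (x : Cs s) :
    inner ℂ (b k) (T x) = (μ k : ℂ) * inner ℂ (b k) x := by
  conv_lhs => rw [← b.sum_repr' x]
  simp only [map_sum, map_smul, hb, inner_sum, inner_smul_right]
  rw [Finset.sum_eq_single k]
  · simp [mul_comm]
  · intro l _ hl
    have := b.orthonormal.2 hl.symm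
    simp [this]
  · simp

theorem isSymmetric_of_eigenbasis {T : Cs s →ₗ[ℂ] Cs s} {b : OrthonormalBasis (Fin s) ℂ (Cs s)}
    {μ : Fin s → ℝ} (hb : ∀ k, T (b k) = (μ k : ℂ) • b k) : T.IsSymmetric := by
  intro x y
  rw [← b.sum_inner_mul_inner (T x) y, ← b.sum_inner_mul_inner x (T y)]
  refine Finset.sum_congr rfl fun k _ => ?_
  rw [apply_eq_sum_eigenbasis hb, ← inner_conj_symm, apply_eq_sum_eigenbasis hb, map_mul,
    inner_conj_symm, Complex.conj_ofReal]
  ring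

/-- Parseval in the eigenbasis. Components absent from `x` impose no condition on their eigenvalue,
which permits removing the small root with its projection. -/
theorem norm_apply_ge_of_eigenbasis {T : Cs s →ₗ[ℂ] Cs s}
    {b : OrthonormalBasis (Fin s) ℂ (Cs s)} {μ : Fin s → ℝ}
    (hb : ∀ k, T (b k) = (μ k : ℂ) • b k) {δ : ℝ} (hδ : 0 ≤ δ) {x : Cs s}
    (hx : ∀ k, inner ℂ (b k) x = 0 ∨ δ ≤ |μ k|) : δ * ‖x‖ ≤ ‖T x‖ := by
  refine (sq_le_sq₀ (by positivity) (norm_nonneg _)).1 ?_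
  rw [mul_pow, ← b.sum_sq_norm_inner_right x, ← b.sum_sq_norm_inner_right (T x), Finset.mul_sum]
  refine Finset.sum_le_sum fun k _ => ?_
  rw [apply_eq_sum_eigenbasis hb, norm_mul, mul_pow]
  rcases hx k with h0 | h1
  · simp [h0]
  · gcongr
    simpa using h1

theorem isSymmetric_symbolH (Γ : PeriodicGraph d s) (ν E₀ h : ℝ) (η : Rd d) :
    (Matrix.toEuclideanLin (symbolH Γ ν E₀ h η)).IsSymmetric := by
  obtain ⟨b, hb⟩ := exists_eigenbasis_symbolH Γ ν E₀ h η
  exact isSymmetric_of_eigenbasis hb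

/-- `Im ⟨x, (T - z) x⟩ = -Im z ‖x‖²` since `⟨x, T x⟩` is real; then Cauchy-Schwarz. -/
theorem abs_im_mul_norm_le {T : Cs s →ₗ[ℂ] Cs s} (hT : T.IsSymmetric) (z : ℂ) (x : Cs s) :
    |z.im| * ‖x‖ ≤ ‖T x - z • x‖ := by
  by_cases hx : x = 0
  · simp [hx]
  have hx' : 0 < ‖x‖ := norm_pos_iff.2 hx
  refine le_of_mul_le_mul_right ?_ hx'
  have h1 : (inner ℂ x (T x - z • x)).im = -z.im * ‖x‖ ^ 2 := by
    have h2 : (inner ℂ x (T x) : ℂ).im = 0 := by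
      have := hT x x
      rw [← inner_conj_symm] at this
      exact Complex.conj_eq_iff_im.1 this
    rw [inner_sub_right, inner_smul_right, Complex.sub_im, h2, inner_self_eq_norm_sq_to_K,
      Complex.mul_im]
    simp only [Complex.coe_algebraMap, ← Complex.ofReal_pow, Complex.ofReal_re, Complex.ofReal_im]
    ring
  have h3 := (Complex.abs_im_le_norm _).trans (norm_inner_le_norm (𝕜 := ℂ) x (T x - z • x))
  rw [h1, abs_mul, abs_neg, abs_of_nonneg (sq_nonneg ‖x‖)] at h3
  nlinarith

/-! ### The eigenprojection -/

/-- The projection `Π_h` as a linear map. -/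
abbrev PiHLin (Γ : PeriodicGraph d s) (ν E₀ : ℝ) (j : Fin s) (d₁ : Rd d) (h : ℝ) (ξ : Rd d) :
    Cs s →ₗ[ℂ] Cs s :=
  Matrix.toEuclideanLin (PiH Γ ν E₀ {j} d₁ h ξ)

/-- The rescaled symbol at `ξ + d_h` as a linear map. -/
abbrev symLin (Γ : PeriodicGraph d s) (ν E₀ : ℝ) (d₁ : Rd d) (h : ℝ) (ξ : Rd d) :
    Cs s →ₗ[ℂ] Cs s :=
  Matrix.toEuclideanLin (symbolH Γ ν E₀ h (ξ + h⁻¹ • d₁))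

theorem PiHLin_eq (Γ : PeriodicGraph d s) (ν E₀ : ℝ) (j : Fin s) (d₁ : Rd d) (h : ℝ) (ξ : Rd d)
    (x : Cs s) :
    PiHLin Γ ν E₀ j d₁ h ξ x = (Module.End.eigenspace (symLin Γ ν E₀ d₁ h ξ)
      ((Ph Γ ν E₀ j d₁ h ξ : ℝ) : ℂ)).starProjection x := by
  simp only [PiHLin, PiH, eigenProjection, LinearEquiv.apply_symm_apply, Set.image_singleton,
    Set.mem_singleton_iff, iSup_iSup_eq_left]
  rfl

theorem symLin_PiHLin (Γ : PeriodicGraph d s) (ν E₀ : ℝ) (j : Fin s) (d₁ : Rd d) (h : ℝ)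
    (ξ : Rd d) (x : Cs s) :
    symLin Γ ν E₀ d₁ h ξ (PiHLin Γ ν E₀ j d₁ h ξ x)
      = (Ph Γ ν E₀ j d₁ h ξ : ℂ) • PiHLin Γ ν E₀ j d₁ h ξ x := by
  rw [← Module.End.mem_eigenspace_iff, PiHLin_eq]
  exact Submodule.starProjection_apply_mem _ _

theorem isSymmetric_PiHLin (Γ : PeriodicGraph d s) (ν E₀ : ℝ) (j : Fin s) (d₁ : Rd d) (h : ℝ)
    (ξ : Rd d) : (PiHLin Γ ν E₀ j d₁ h ξ).IsSymmetric := by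
  intro x y
  rw [PiHLin_eq, PiHLin_eq]
  exact Submodule.inner_starProjection_left_eq_right _ _ _

/-- The adjoint of `symLin_PiHLin`, both factors being symmetric. -/
theorem PiHLin_symLin (Γ : PeriodicGraph d s) (ν E₀ : ℝ) (j : Fin s) (d₁ : Rd d) (h : ℝ)
    (ξ : Rd d) (x : Cs s) :
    PiHLin Γ ν E₀ j d₁ h ξ (symLin Γ ν E₀ d₁ h ξ x)
      = (Ph Γ ν E₀ j d₁ h ξ : ℂ) • PiHLin Γ ν E₀ j d₁ h ξ x := by
  refine ext_inner_left ℂ fun y => ?_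
  rw [← isSymmetric_PiHLin, ← isSymmetric_symbolH, symLin_PiHLin, inner_smul_left,
    Complex.conj_ofReal, isSymmetric_PiHLin, inner_smul_right]

theorem norm_symLin_sub_PiHLin_ge (Γ : PeriodicGraph d s) (ν E₀ : ℝ) (j : Fin s) (d₁ : Rd d)
    (h : ℝ) (ξ : Rd d) {δ : ℝ} (hδ : 0 ≤ δ)
    (hgap : ∀ k, k ≠ j → δ ≤ |charRootH Γ ν E₀ h k (ξ + h⁻¹ • d₁)|) (x : Cs s) :
    δ * ‖x - PiHLin Γ ν E₀ j d₁ h ξ x‖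
      ≤ ‖symLin Γ ν E₀ d₁ h ξ (x - PiHLin Γ ν E₀ j d₁ h ξ x)‖ := by
  obtain ⟨b, hb⟩ := exists_eigenbasis_symbolH Γ ν E₀ h (ξ + h⁻¹ • d₁)
  refine norm_apply_ge_of_eigenbasis hb hδ fun k => ?_
  by_cases hk : k = j
  · left
    subst hk
    rw [PiHLin_eq]
    refine Submodule.inner_right_of_mem_orthogonal
      (K := Module.End.eigenspace (symLin Γ ν E₀ d₁ h ξ) ((Ph Γ ν E₀ k d₁ h ξ : ℝ) : ℂ)) ?_
      (Submodule.sub_starProjection_mem_orthogonal _)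
    rw [Module.End.mem_eigenspace_iff]
    exact hb k
  · exact Or.inr (hgap k hk)

theorem smul_add_inv_smul {h : ℝ} (hh : 0 < h) (ξ d₁ : Rd d) :
    h • (ξ + h⁻¹ • d₁) = h • ξ + d₁ := by
  rw [smul_add, smul_smul, mul_inv_cancel₀ hh.ne', one_smul]

theorem Ph_eq {h : ℝ} (hh : 0 < h) (Γ : PeriodicGraph d s) (ν E₀ : ℝ) (j : Fin s) (d₁ ξ : Rd d) :
    Ph Γ ν E₀ j d₁ h ξ = h ^ (-ν) * charRoot Γ E₀ j (h • ξ + d₁) := by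
  rw [Ph, charRootH, smul_add_inv_smul hh]

theorem abs_charRoot_ge {Γ : PeriodicGraph d s} {E₀ : ℝ} {j : Fin s} {ε : ℝ} (hε : 0 < ε)
    (hC : ∀ η, (∀ k, k < j → charRoot Γ E₀ k η ≤ -ε) ∧ (∀ k, j < k → ε ≤ charRoot Γ E₀ k η))
    (η : Rd d) {k : Fin s} (hk : k ≠ j) : ε ≤ |charRoot Γ E₀ k η| := by
  rcases lt_or_gt_of_ne hk with h | h
  · have := (hC η).1 k h
    rw [abs_of_neg (by linarith)]
    linarith
  · exact ((hC η).2 k h).trans (le_abs_self _)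

theorem continuous_toEuclideanLin_apply (x : Cs s) :
    Continuous fun A : Matrix (Fin s) (Fin s) ℂ => Matrix.toEuclideanLin A x := by
  have : ∀ A : Matrix (Fin s) (Fin s) ℂ, Matrix.toEuclideanLin A x
      = WithLp.toLp 2 (A.mulVec x.ofLp) := fun A => rfl
  simp_rw [this]
  fun_prop

theorem tendsto_Ph {Γ : PeriodicGraph d s} {ν E₀ : ℝ} {j : Fin s} {K₀ : Set (Rd d)} {d₁ : Rd d}
    {P : Rd d → ℝ} (hB3 : HypB3 Γ ν E₀ j K₀ d₁ P) {ξ : Rd d} (hξ : ξ ≠ 0) :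
    Tendsto (fun h : ℝ => Ph Γ ν E₀ j d₁ h ξ) (𝓝[>] 0) (𝓝 (P ξ)) := by
  have h1 := hB3.2.2.1 ξ hξ 0
  have h2 := (ContinuousMultilinearMap.apply ℝ (fun _ : Fin 0 => Rd d) ℝ ![]).continuous.tendsto
    (iteratedFDeriv ℝ 0 P ξ)
  simpa [Function.comp_def] using h2.comp h1

theorem tendsto_PiHLin {Γ : PeriodicGraph d s} {ν E₀ : ℝ} {j : Fin s} {d₁ : Rd d}
    {Pi₀ : Rd d → Matrix (Fin s) (Fin s) ℂ} (hB4 : HypB4 Γ ν E₀ {j} d₁ Pi₀) {ξ : Rd d}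
    (hξ : ξ ≠ 0) (x : Cs s) :
    Tendsto (fun h : ℝ => PiHLin Γ ν E₀ j d₁ h ξ x) (𝓝[>] 0)
      (𝓝 (Matrix.toEuclideanLin (Pi₀ ξ) x)) := by
  refine ((continuous_toEuclideanLin_apply x).tendsto _).comp ?_
  refine tendsto_pi_nhds.2 fun a => tendsto_pi_nhds.2 fun b => ?_
  have h1 := (hB4.2 a b).2 ξ hξ 0
  have h2 := (ContinuousMultilinearMap.apply ℝ (fun _ : Fin 0 => Rd d) ℂ ![]).continuous.tendsto
    (iteratedFDeriv ℝ 0 (fun ζ => Pi₀ ζ a b) ξ)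
  simpa [Function.comp_def] using h2.comp h1

/-- For small `h` the point `h ξ + d₁` lies in `K₀` and differs from `d₁`, so `P_h(ξ) > 0`, and `P_h
≤ C⁻¹ P` passes positivity on to `P`. -/
theorem pos_of_hypB3 {Γ : PeriodicGraph d s} {ν E₀ : ℝ} {j : Fin s} {K₀ : Set (Rd d)} {d₁ : Rd d}
    {P : Rd d → ℝ} (hB1 : HypB1 Γ E₀ j K₀ d₁) (hB3 : HypB3 Γ ν E₀ j K₀ d₁ P) {ξ : Rd d}
    (hξ : ξ ≠ 0) : 0 < P ξ := by
  obtain ⟨hopen, hd, hnn, hz⟩ := hB1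
  obtain ⟨C, hC, h₁, hh₁, hb⟩ := hB3.2.2.2
  have hc : Tendsto (fun h : ℝ => h • ξ + d₁) (𝓝[>] 0) (𝓝 d₁) := by
    have : Continuous fun h : ℝ => h • ξ + d₁ := by fun_prop
    have := this.tendsto 0
    simp only [zero_smul, zero_add] at this
    exact this.mono_left nhdsWithin_le_nhds
  have hev := (hc.eventually (hopen.mem_nhds hd)).and
    ((eventually_mem_nhdsWithin (a := (0 : ℝ)) (s := Set.Ioi 0)).and
      ((eventually_lt_nhds hh₁).filter_mono nhdsWithin_le_nhds))
  obtain ⟨h, hK, hpos, hlt⟩ := hev.exists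
  have hpos' : 0 < h := hpos
  have h1 := (hb h hpos' hlt ξ hK).2
  rw [Ph_eq hpos'] at h1
  have h2 : 0 < charRoot Γ E₀ j (h • ξ + d₁) := by
    refine lt_of_le_of_ne (hnn _ hK) fun h0 => ?_
    have := (hz _ hK).1 h0.symm
    have h3 : h • ξ = 0 := by simpa using this
    exact hξ ((smul_eq_zero.1 h3).resolve_left hpos'.ne')
  have h4 : 0 < h ^ (-ν) * charRoot Γ E₀ j (h • ξ + d₁) := by positivity
  have h5 := h4.trans_le h1
  exact pos_of_mul_pos_right h5 (by positivity)

/-- Since `P_h(2ξ) = 2^ν P_{2h}(ξ)`, the limit satisfies `P(2ξ) = 2^ν P(ξ)`. Homogeneity and `P(ξ) >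
0` then force the degree to be the scaling exponent. -/
theorem exponent_eq {Γ : PeriodicGraph d s} {ν E₀ : ℝ} {j : Fin s} {K₀ : Set (Rd d)} {d₁ : Rd d}
    {P : Rd d → ℝ} (hB1 : HypB1 Γ E₀ j K₀ d₁) (hB3 : HypB3 Γ ν E₀ j K₀ d₁ P) {γ : ℝ}
    (hγ : ∀ t : ℝ, 0 < t → ∀ ξ, P (t • ξ) = t ^ γ * P ξ) {ξ : Rd d} (hξ : ξ ≠ 0) : ν = γ := by
  have hP := pos_of_hypB3 hB1 hB3 hξ
  have h2ξ : (2 : ℝ) • ξ ≠ 0 := by simpa using hξ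
  have h1 := tendsto_Ph hB3 h2ξ
  have h2 := tendsto_Ph hB3 hξ
  have hs : Tendsto (fun h : ℝ => 2 * h) (𝓝[>] 0) (𝓝[>] 0) := by
    refine tendsto_nhdsWithin_iff.2 ⟨?_, ?_⟩
    · have : Continuous fun h : ℝ => 2 * h := by fun_prop
      have := this.tendsto 0
      rw [mul_zero] at this
      exact this.mono_left nhdsWithin_le_nhds
    · filter_upwards [self_mem_nhdsWithin] with h hh
      have : (0 : ℝ) < h := hh
      exact Set.mem_Ioi.2 (by positivity)
  have h3 := (h2.comp hs).const_mul ((2 : ℝ) ^ ν)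
  have h4 : P ((2 : ℝ) • ξ) = (2 : ℝ) ^ ν * P ξ := by
    refine tendsto_nhds_unique h1 (h3.congr' ?_)
    filter_upwards [self_mem_nhdsWithin] with h hh
    have hh' : (0 : ℝ) < h := hh
    rw [Function.comp_apply, Ph_eq hh', Ph_eq (by positivity), Real.mul_rpow (by norm_num) hh'.le,
      ← mul_assoc, ← mul_assoc, ← Real.rpow_add (by norm_num), add_neg_cancel, Real.rpow_zero,
      one_mul, smul_smul, mul_comm h 2]
  rw [hγ 2 (by norm_num)] at h4
  have h5 := mul_right_cancel₀ hP.ne' h4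
  exact ((Real.strictMono_rpow_of_base_gt_one one_lt_two).injective h5).symm

theorem tendsto_smul_add_nhds (ξ d₁ : Rd d) :
    Tendsto (fun h : ℝ => h • ξ + d₁) (𝓝[>] 0) (𝓝 d₁) := by
  have : Continuous fun h : ℝ => h • ξ + d₁ := by fun_prop
  have := this.tendsto 0
  simp only [zero_smul, zero_add] at this
  exact this.mono_left nhdsWithin_le_nhds

/-! ### The limit projection is constant -/

theorem charRootH_abs_ge {Γ : PeriodicGraph d s} {E₀ : ℝ} {j : Fin s} {ε : ℝ} (hε : 0 < ε)
    (hC : ∀ η, (∀ k, k < j → charRoot Γ E₀ k η ≤ -ε) ∧ (∀ k, j < k → ε ≤ charRoot Γ E₀ k η))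
    (ν : ℝ) {h : ℝ} (hh : 0 < h) (ξ : Rd d) {k : Fin s} (hk : k ≠ j) :
    h ^ (-ν) * ε ≤ |charRootH Γ ν E₀ h k ξ| := by
  rw [charRootH, abs_mul, abs_of_pos (by positivity : 0 < h ^ (-ν))]
  exact mul_le_mul_of_nonneg_left (abs_charRoot_ge hε hC _ hk) (by positivity)

section Projection

variable {Γ : PeriodicGraph d s} {ν E₀ : ℝ} {j : Fin s} {K₀ : Set (Rd d)} {d₁ : Rd d}
  {P : Rd d → ℝ} {Pi₀ : Rd d → Matrix (Fin s) (Fin s) ℂ}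

theorem isSymmetric_Pi₀ (hB4 : HypB4 Γ ν E₀ {j} d₁ Pi₀) {ξ : Rd d} (hξ : ξ ≠ 0) :
    (Matrix.toEuclideanLin (Pi₀ ξ)).IsSymmetric := by
  intro x y
  have h1 := (tendsto_PiHLin hB4 hξ x).inner (𝕜 := ℂ) (tendsto_const_nhds (x := y))
  have h2 := (tendsto_const_nhds (x := x)).inner (𝕜 := ℂ) (tendsto_PiHLin hB4 hξ y)
  exact tendsto_nhds_unique h1 (h2.congr fun h => (isSymmetric_PiHLin Γ ν E₀ j d₁ h ξ x y).symm)

/-- Along the ray, `λ_j = h^ν P_h(ξ)` with `P_h(ξ)` convergent. -/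
theorem tendsto_charRoot_ray (hν : 0 < ν) (hB3 : HypB3 Γ ν E₀ j K₀ d₁ P) {ξ : Rd d} (hξ : ξ ≠ 0) :
    Tendsto (fun h : ℝ => charRoot Γ E₀ j (h • ξ + d₁)) (𝓝[>] 0) (𝓝 0) := by
  have h1 : Tendsto (fun h : ℝ => h ^ ν) (𝓝[>] 0) (𝓝 0) := by
    have := (Real.continuousAt_rpow_const 0 ν (Or.inr hν.le)).tendsto
    rw [Real.zero_rpow hν.ne'] at this
    exact this.mono_left nhdsWithin_le_nhds
  have h2 := h1.mul (tendsto_Ph hB3 hξ)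
  rw [zero_mul] at h2
  refine h2.congr' ?_
  filter_upwards [self_mem_nhdsWithin] with h hh
  have hh' : 0 < h := hh
  rw [Ph_eq hh', ← mul_assoc, ← Real.rpow_add hh', add_neg_cancel, Real.rpow_zero, one_mul]

/-- `𝓛 - E₀` as a linear map. -/
def symA (Γ : PeriodicGraph d s) (E₀ : ℝ) (η : Rd d) : Cs s →ₗ[ℂ] Cs s :=
  Matrix.toEuclideanLin (symbol Γ η - (E₀ : ℂ) • (1 : Matrix (Fin s) (Fin s) ℂ))

theorem continuous_toEuclideanLin {X : Type*} [TopologicalSpace X]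
    {f : X → Matrix (Fin s) (Fin s) ℂ} {g : X → Cs s} (hf : Continuous f) (hg : Continuous g) :
    Continuous fun x => Matrix.toEuclideanLin (f x) (g x) := by
  have : ∀ x, Matrix.toEuclideanLin (f x) (g x)
      = WithLp.toLp 2 ((f x).mulVec (g x).ofLp) := fun _ => rfl
  simp_rw [this]
  fun_prop

theorem continuous_symA (Γ : PeriodicGraph d s) (E₀ : ℝ) {X : Type*} [TopologicalSpace X]
    {f : X → Rd d} {g : X → Cs s} (hf : Continuous f) (hg : Continuous g) :
    Continuous fun x => symA Γ E₀ (f x) (g x) := by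
  have h1 := continuous_symbol Γ
  exact continuous_toEuclideanLin
    ((h1.comp hf).sub continuous_const : Continuous fun x =>
      symbol Γ (f x) - (E₀ : ℂ) • (1 : Matrix (Fin s) (Fin s) ℂ)) hg

theorem tendsto_symA (Γ : PeriodicGraph d s) (E₀ : ℝ) {X : Type*} {l : Filter X}
    {f : X → Rd d} {g : X → Cs s} {a : Rd d} {b : Cs s} (hf : Tendsto f l (𝓝 a))
    (hg : Tendsto g l (𝓝 b)) : Tendsto (fun x => symA Γ E₀ (f x) (g x)) l
      (𝓝 (symA Γ E₀ a b)) := by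
  have h1 : Continuous fun p : Rd d × Cs s => symA Γ E₀ p.1 p.2 :=
    continuous_symA Γ E₀ continuous_fst continuous_snd
  have h2 : Tendsto (fun p : Rd d × Cs s => symA Γ E₀ p.1 p.2) (𝓝 (a, b))
    (𝓝 (symA Γ E₀ a b)) := h1.tendsto' _ _ rfl
  exact Tendsto.comp (g := fun p : Rd d × Cs s => symA Γ E₀ p.1 p.2) (f := fun x => (f x, g x))
    h2 (hf.prodMk_nhds hg)

theorem symLin_eq_smul_symA {h : ℝ} (hh : 0 < h) (Γ : PeriodicGraph d s) (ν E₀ : ℝ)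
    (d₁ ξ : Rd d) (x : Cs s) :
    symLin Γ ν E₀ d₁ h ξ x = ((h ^ (-ν) : ℝ) : ℂ) • symA Γ E₀ (h • ξ + d₁) x := by
  rw [symLin, symbolH, smul_add_inv_smul hh, map_smul, LinearMap.smul_apply,
    symA]

theorem symA_PiHLin {h : ℝ} (hh : 0 < h) (ξ : Rd d) (x : Cs s) :
    symA Γ E₀ (h • ξ + d₁) (PiHLin Γ ν E₀ j d₁ h ξ x)
      = (charRoot Γ E₀ j (h • ξ + d₁) : ℂ) • PiHLin Γ ν E₀ j d₁ h ξ x := by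
  have h1 := symLin_PiHLin Γ ν E₀ j d₁ h ξ x
  rw [symLin_eq_smul_symA hh, Ph_eq hh, Complex.ofReal_mul, mul_smul] at h1
  have hne : ((h ^ (-ν) : ℝ) : ℂ) ≠ 0 := by
    exact_mod_cast (by positivity : 0 < h ^ (-ν)).ne'
  exact smul_right_injective _ hne h1

/-- Limit of the eigenvalue equation: the eigenvalue tends to `0` while the symbol tends to its
value at `d₁`, so `Π₀(ξ)` maps into the kernel. -/
theorem symA_Pi₀ (hν : 0 < ν) (hB3 : HypB3 Γ ν E₀ j K₀ d₁ P) (hB4 : HypB4 Γ ν E₀ {j} d₁ Pi₀)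
    {ξ : Rd d} (hξ : ξ ≠ 0) (x : Cs s) :
    symA Γ E₀ d₁ (Matrix.toEuclideanLin (Pi₀ ξ) x) = 0 := by
  have h1 := tendsto_symA Γ E₀ (tendsto_smul_add_nhds ξ d₁) (tendsto_PiHLin hB4 hξ x)
  have h2 := ((Complex.continuous_ofReal.tendsto 0).comp (tendsto_charRoot_ray hν hB3 hξ)).smul
    (tendsto_PiHLin hB4 hξ x)
  rw [Complex.ofReal_zero, zero_smul] at h2
  refine tendsto_nhds_unique h1 (h2.congr' ?_)
  filter_upwards [self_mem_nhdsWithin] with h hh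
  exact (symA_PiHLin hh ξ x).symm

/-- The other roots stay at distance `ε` from `0`, so `ε ‖e - Π_h e‖` is at most the norm of the
symbol applied to `e - Π_h e`. For a kernel vector `e` this tends to `0`. -/
theorem Pi₀_apply_of_symA_eq_zero {ε : ℝ} (hε : 0 < ε)
    (hC : ∀ η, (∀ k, k < j → charRoot Γ E₀ k η ≤ -ε) ∧ (∀ k, j < k → ε ≤ charRoot Γ E₀ k η))
    (hν : 0 < ν) (hB3 : HypB3 Γ ν E₀ j K₀ d₁ P) (hB4 : HypB4 Γ ν E₀ {j} d₁ Pi₀)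
    {ξ : Rd d} (hξ : ξ ≠ 0) {e : Cs s} (he : symA Γ E₀ d₁ e = 0) :
    Matrix.toEuclideanLin (Pi₀ ξ) e = e := by
  have h1 := tendsto_symA Γ E₀ (tendsto_smul_add_nhds ξ d₁) (tendsto_const_nhds (x := e))
  rw [he] at h1
  have h2 := ((Complex.continuous_ofReal.tendsto 0).comp (tendsto_charRoot_ray hν hB3 hξ)).smul
    (tendsto_PiHLin hB4 hξ e)
  rw [Complex.ofReal_zero, zero_smul] at h2
  have h3 := (h1.sub h2).norm
  rw [sub_zero, norm_zero] at h3
  have h4 : Tendsto (fun h : ℝ => ε * ‖e - PiHLin Γ ν E₀ j d₁ h ξ e‖) (𝓝[>] 0) (𝓝 0) := by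
    refine squeeze_zero' (Eventually.of_forall fun h => by positivity) ?_ h3
    filter_upwards [self_mem_nhdsWithin] with h hh
    have hh' : 0 < h := hh
    have h5 := norm_symLin_sub_PiHLin_ge Γ ν E₀ j d₁ h ξ
      (by positivity : 0 ≤ h ^ (-ν) * ε) (fun k hk => charRootH_abs_ge hε hC ν hh' _ hk) e
    rw [symLin_eq_smul_symA hh', norm_smul, Complex.norm_real, Real.norm_of_nonneg (by positivity),
      mul_assoc] at h5
    have h6 := le_of_mul_le_mul_left h5 (by positivity)
    rw [map_sub, symA_PiHLin hh'] at h6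
    exact h6
  have h7 : Tendsto (fun h : ℝ => ε * ‖e - PiHLin Γ ν E₀ j d₁ h ξ e‖) (𝓝[>] 0)
      (𝓝 (ε * ‖e - Matrix.toEuclideanLin (Pi₀ ξ) e‖)) :=
    ((tendsto_const_nhds.sub (tendsto_PiHLin hB4 hξ e)).norm).const_mul ε
  have h8 := tendsto_nhds_unique h7 h4
  have h9 : ‖e - Matrix.toEuclideanLin (Pi₀ ξ) e‖ = 0 := by
    rcases mul_eq_zero.1 h8 with h | h
    · exact absurd h hε.ne'
    · exact h
  exact (sub_eq_zero.1 (norm_eq_zero.1 h9)).symm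

/-- For each `ξ ≠ 0` the map is symmetric, has values in the kernel at `d₁`, and fixes that kernel.
These properties determine it without reference to `ξ`. -/
theorem Pi₀_eq {ε : ℝ} (hε : 0 < ε)
    (hC : ∀ η, (∀ k, k < j → charRoot Γ E₀ k η ≤ -ε) ∧ (∀ k, j < k → ε ≤ charRoot Γ E₀ k η))
    (hν : 0 < ν) (hB3 : HypB3 Γ ν E₀ j K₀ d₁ P) (hB4 : HypB4 Γ ν E₀ {j} d₁ Pi₀)
    {ξ ξ' : Rd d} (hξ : ξ ≠ 0) (hξ' : ξ' ≠ 0) : Pi₀ ξ = Pi₀ ξ' := by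
  apply Matrix.toEuclideanLin.injective
  ext1 x
  refine ext_inner_left ℂ fun y => ?_
  rw [← isSymmetric_Pi₀ hB4 hξ,
    ← Pi₀_apply_of_symA_eq_zero hε hC hν hB3 hB4 hξ' (symA_Pi₀ hν hB3 hB4 hξ y),
    isSymmetric_Pi₀ hB4 hξ', isSymmetric_Pi₀ hB4 hξ,
    Pi₀_apply_of_symA_eq_zero hε hC hν hB3 hB4 hξ (symA_Pi₀ hν hB3 hB4 hξ' x)]

end Projection

/-- In the double case both roots vanish at `d₁`, whereas `λ_{j-1}` is bounded away from `0`. -/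
theorem not_hypB22 {Γ : PeriodicGraph d s} {E₀ : ℝ} {i j : Fin s} {K₀ : Set (Rd d)} {d₁ : Rd d}
    (hB1 : HypB1 Γ E₀ j K₀ d₁) (hC2 : HypC2 Γ E₀ j) : ¬HypB22 Γ E₀ i j K₀ := by
  rintro ⟨hij, hneg, -⟩
  obtain ⟨ε, hε, hC⟩ := hC2
  have h1 : charRoot Γ E₀ j d₁ = 0 := (hB1.2.2.2 d₁ hB1.2.1).2 rfl
  have h2 := hneg d₁ hB1.2.1
  have h3 := (hC d₁).1 i (by rw [Fin.lt_def]; omega)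
  rw [h2, h1] at h3
  linarith

/-! ### Ellipticity of the symbol on a cell -/

theorem norm_le_of_mem_closedTile {T : ℝ} {x : Rd d} (hx : x ∈ closedTile d T) :
    ‖x‖ ≤ d * (T / 2) := by
  have := norm_sum_le (Finset.univ : Finset (Fin d))
    (fun i => x i • EuclideanSpace.basisFun (Fin d) ℝ i)
  have h2 : ∑ i, x i • EuclideanSpace.basisFun (Fin d) ℝ i = x := by
    simpa using (EuclideanSpace.basisFun (Fin d) ℝ).sum_repr x
  rw [h2] at this
  refine this.trans ((Finset.sum_le_sum fun i _ => ?_).trans_eq (by simp : ∑ _i : Fin d, T / 2 = _))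
  simpa [norm_smul] using hx i

theorem isCompact_closedTile (T : ℝ) : IsCompact (closedTile d T) :=
  Metric.isCompact_of_isClosed_isBounded (isClosed_closedTile T)
    ((Metric.isBounded_iff_subset_closedBall 0).2 ⟨d * (T / 2), fun _ hx =>
      mem_closedBall_zero_iff.2 (norm_le_of_mem_closedTile hx)⟩)

theorem exists_eigenbasis_symA (Γ : PeriodicGraph d s) (E₀ : ℝ) (η : Rd d) :
    ∃ b : OrthonormalBasis (Fin s) ℂ (Cs s), ∀ k,
      symA Γ E₀ η (b k) = ((charRoot Γ E₀ k η : ℝ) : ℂ) • b k := by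
  obtain ⟨b, hb⟩ := exists_eigenbasis_symbol Γ E₀ η
  refine ⟨b, fun k => ?_⟩
  rw [symA, map_sub, map_smul, LinearMap.sub_apply, LinearMap.smul_apply, hb]
  have : Matrix.toEuclideanLin (1 : Matrix (Fin s) (Fin s) ℂ) (b k) = b k := by
    simp
  rw [this, ← sub_smul]
  push_cast
  ring_nf

theorem norm_symA_ge (Γ : PeriodicGraph d s) (E₀ : ℝ) (η : Rd d) {δ : ℝ} (hδ : 0 ≤ δ)
    (h : ∀ k, δ ≤ |charRoot Γ E₀ k η|) (x : Cs s) : δ * ‖x‖ ≤ ‖symA Γ E₀ η x‖ := by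
  obtain ⟨b, hb⟩ := exists_eigenbasis_symA Γ E₀ η
  exact norm_apply_ge_of_eigenbasis hb hδ fun k => Or.inr (h k)

theorem symA_ne_zero {Γ : PeriodicGraph d s} {E₀ : ℝ} {η : Rd d}
    (h : ∀ k, charRoot Γ E₀ k η ≠ 0) {x : Cs s} (hx : x ≠ 0) : symA Γ E₀ η x ≠ 0 := by
  obtain ⟨b, hb⟩ := exists_eigenbasis_symA Γ E₀ η
  intro h0
  apply hx
  rw [← b.sum_repr' x]
  refine Finset.sum_eq_zero fun k _ => ?_
  have h1 := apply_eq_sum_eigenbasis hb k x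
  rw [h0, inner_zero_right] at h1
  rw [(mul_eq_zero.1 h1.symm).resolve_left (by exact_mod_cast h k), zero_smul]

/-- The zeros form the coset `d₁ + 2πℤᵈ`, and the unit cell contains no integer point except `0`. -/
theorem eq_zero_of_mem_closedTile_one {Γ : PeriodicGraph d s} {E₀ : ℝ} {j : Fin s} {d₁ : Rd d}
    (hC1 : HypC1 Γ E₀ j d₁) {θ : Rd d} (hθ : θ ∈ closedTile d 1)
    (h0 : charRoot Γ E₀ j ((2 * Real.pi) • θ + d₁) = 0) : θ = 0 := by
  obtain ⟨k, hk⟩ := (hC1.2 _).1 h0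
  rw [add_comm, add_right_inj] at hk
  have h1 : θ = intVec k := smul_right_injective _ (by positivity : (2 * Real.pi : ℝ) ≠ 0) hk
  ext i
  have h2 := hθ i
  rw [h1, intVec_apply] at h2 ⊢
  have h3 : |k i| < 1 := by
    have : (|(k i : ℝ)|) < 1 := by linarith
    exact_mod_cast this
  simp [Int.abs_lt_one_iff.1 h3]

/-- `P` attains a positive minimum on the unit sphere; homogeneity extends the bound. -/
theorem exists_sphere_lower_bound {P : Rd d → ℝ} (hP : ContinuousOn P {0}ᶜ)
    (hpos : ∀ ξ, ξ ≠ 0 → 0 < P ξ) {γ : ℝ}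
    (hγ : ∀ t : ℝ, 0 < t → ∀ ξ, P (t • ξ) = t ^ γ * P ξ) :
    ∃ c > 0, ∀ ξ, ξ ≠ 0 → c * ‖ξ‖ ^ γ ≤ P ξ := by
  have hsub : Metric.sphere (0 : Rd d) 1 ⊆ {0}ᶜ := by
    intro x hx h0
    rw [Set.mem_singleton_iff.1 h0] at hx
    simp at hx
  by_cases hne : (Metric.sphere (0 : Rd d) 1).Nonempty
  · obtain ⟨x, hx, hmin⟩ := (isCompact_sphere (0 : Rd d) 1).exists_isMinOn hne (hP.mono hsub)
    refine ⟨P x, hpos x (hsub hx), fun ξ hξ => ?_⟩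
    have hn : 0 < ‖ξ‖ := norm_pos_iff.2 hξ
    have h1 : ‖ξ‖ • (‖ξ‖⁻¹ • ξ) = ξ := by rw [smul_smul, mul_inv_cancel₀ hn.ne', one_smul]
    have h2 := hγ ‖ξ‖ hn (‖ξ‖⁻¹ • ξ)
    rw [h1] at h2
    rw [h2, mul_comm]
    refine mul_le_mul_of_nonneg_left (hmin ?_) (by positivity)
    rw [mem_sphere_zero_iff_norm, norm_smul, norm_inv, norm_norm, inv_mul_cancel₀ hn.ne']
  · refine ⟨1, one_pos, fun ξ hξ => absurd ?_ hne⟩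
    refine ⟨‖ξ‖⁻¹ • ξ, ?_⟩
    rw [mem_sphere_zero_iff_norm, norm_smul, norm_inv, norm_norm,
      inv_mul_cancel₀ (norm_pos_iff.2 hξ).ne']

/-- Ellipticity before rescaling. Near `d₁` the `j`-th root is bounded below by a multiple of `P`
and the other roots by the gap. Away from `d₁` the symbol is injective, so compactness in the point
and the unit vector gives a positive constant. -/
theorem exists_norm_symA_ge {Γ : PeriodicGraph d s} {ν E₀ : ℝ} {j : Fin s} {K₀ : Set (Rd d)}
    {d₁ : Rd d} {P : Rd d → ℝ} (hν : 0 < ν) (hB1 : HypB1 Γ E₀ j K₀ d₁)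
    (hB3 : HypB3 Γ ν E₀ j K₀ d₁ P) (hC1 : HypC1 Γ E₀ j d₁) (hC2 : HypC2 Γ E₀ j)
    (hγ : ∀ t : ℝ, 0 < t → ∀ ξ, P (t • ξ) = t ^ ν * P ξ) :
    ∃ c > 0, ∀ θ ∈ closedTile d 1, ∀ x : Cs s,
      c * ‖θ‖ ^ ν * ‖x‖ ≤ ‖symA Γ E₀ ((2 * Real.pi) • θ + d₁) x‖ := by
  obtain ⟨ε, hε, hC⟩ := hC2
  obtain ⟨C, hCpos, h₁, hh₁, hb⟩ := hB3.2.2.2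
  obtain ⟨p, hp, hpb⟩ := exists_sphere_lower_bound hB3.1.continuousOn
    (fun ξ hξ => pos_of_hypB3 hB1 hB3 hξ) hγ
  obtain ⟨ρ, hρ, hball⟩ := Metric.isOpen_iff.1 hB1.1 d₁ hB1.2.1
  set R : ℝ := d * (1 / 2) + 1 with hR
  have hRpos : 0 < R := by positivity
  have hθR : ∀ θ ∈ closedTile d 1, ‖θ‖ ^ ν ≤ R ^ ν := fun θ hθ =>
    Real.rpow_le_rpow (norm_nonneg _) ((norm_le_of_mem_closedTile hθ).trans (by simp [hR])) hν.le
  have hRν : 0 < R ^ ν := by positivity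
  -- near the zero of `λ_j`
  have hnear : ∀ θ : Rd d, ‖(2 * Real.pi) • θ‖ < ρ →
      C * p * ‖θ‖ ^ ν ≤ charRoot Γ E₀ j ((2 * Real.pi) • θ + d₁) := by
    intro θ hθ
    have hnn : 0 ≤ charRoot Γ E₀ j ((2 * Real.pi) • θ + d₁) := hC1.1 _
    by_cases h0 : θ = 0
    · simpa [h0, Real.zero_rpow hν.ne'] using hC1.1 d₁
    set h : ℝ := h₁ / 2
    have hh : 0 < h := by positivity
    have hmem : h • (h⁻¹ • (2 * Real.pi) • θ) + d₁ ∈ K₀ := by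
      rw [smul_smul, mul_inv_cancel₀ hh.ne', one_smul]
      apply hball
      simpa [dist_eq_norm] using hθ
    have h1 := (hb h hh (half_lt_self hh₁) _ hmem).1
    rw [Ph_eq hh, smul_smul h h⁻¹, mul_inv_cancel₀ hh.ne', one_smul, hγ _ (by positivity),
      Real.inv_rpow hh.le, Real.rpow_neg hh.le] at h1
    have h2 := hpb ((2 * Real.pi) • θ) (by
      simp only [ne_eq, smul_eq_zero, not_or]
      exact ⟨by positivity, h0⟩)
    have hhν : 0 < (h ^ ν)⁻¹ := by positivity
    have h3 : C * P ((2 * Real.pi) • θ) ≤ charRoot Γ E₀ j ((2 * Real.pi) • θ + d₁) := by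
      refine le_of_mul_le_mul_left ?_ hhν
      linarith
    have h4 : ‖θ‖ ^ ν ≤ ‖(2 * Real.pi) • θ‖ ^ ν := by
      refine Real.rpow_le_rpow (norm_nonneg _) ?_ hν.le
      rw [norm_smul, Real.norm_of_nonneg (by positivity)]
      have := Real.pi_gt_three
      nlinarith [norm_nonneg θ]
    calc C * p * ‖θ‖ ^ ν ≤ C * p * ‖(2 * Real.pi) • θ‖ ^ ν := by gcongr
      _ = C * (p * ‖(2 * Real.pi) • θ‖ ^ ν) := by ring
      _ ≤ C * P ((2 * Real.pi) • θ) := by gcongr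
      _ ≤ _ := h3
  -- away from the zero, by compactness
  have hfar : ∃ c > 0, ∀ θ ∈ closedTile d 1, ρ ≤ ‖(2 * Real.pi) • θ‖ → ∀ x : Cs s,
      c * ‖x‖ ≤ ‖symA Γ E₀ ((2 * Real.pi) • θ + d₁) x‖ := by
    set S : Set (Rd d × Cs s) := (closedTile d 1 ∩ {θ | ρ ≤ ‖(2 * Real.pi) • θ‖}) ×ˢ
      Metric.sphere (0 : Cs s) 1 with hS
    have hScomp : IsCompact S := by
      refine IsCompact.prod ((isCompact_closedTile 1).inter_right ?_) (isCompact_sphere _ _)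
      exact isClosed_le continuous_const (by fun_prop)
    have hcont : Continuous fun q : Rd d × Cs s => ‖symA Γ E₀ ((2 * Real.pi) • q.1 + d₁) q.2‖ := by
      exact (continuous_symA Γ E₀ (by fun_prop) continuous_snd).norm
    have hex : ∃ c > 0, ∀ q ∈ S, c ≤ ‖symA Γ E₀ ((2 * Real.pi) • q.1 + d₁) q.2‖ := by
      by_cases hne : S.Nonempty
      · obtain ⟨q, hq, hmin⟩ := hScomp.exists_isMinOn hne hcont.continuousOn
        refine ⟨_, ?_, fun q' hq' => hmin hq'⟩
        obtain ⟨⟨hq1, hq2⟩, hq3⟩ := hq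
        refine norm_pos_iff.2 (symA_ne_zero (fun k hk => ?_) ?_)
        · by_cases hkj : k = j
          · subst hkj
            have := eq_zero_of_mem_closedTile_one hC1 hq1 hk
            have h3 : ρ ≤ ‖(2 * Real.pi) • q.1‖ := hq2
            rw [this, smul_zero, norm_zero] at h3
            linarith
          · have := abs_charRoot_ge hε hC ((2 * Real.pi) • q.1 + d₁) hkj
            rw [hk, abs_zero] at this
            linarith
        · intro h0
          rw [h0] at hq3
          simp at hq3
      · exact ⟨1, one_pos, fun q hq => absurd ⟨q, hq⟩ hne⟩
    obtain ⟨c, hc, hcb⟩ := hex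
    refine ⟨c, hc, fun θ hθ hθρ x => ?_⟩
    by_cases hx : x = 0
    · simp [hx]
    have hn : 0 < ‖x‖ := norm_pos_iff.2 hx
    have h1 := hcb (θ, ((‖x‖⁻¹ : ℝ) : ℂ) • x) ⟨⟨hθ, hθρ⟩, by
      rw [mem_sphere_zero_iff_norm, norm_smul, Complex.norm_real, norm_inv, norm_norm,
        inv_mul_cancel₀ hn.ne']⟩
    rw [map_smul, norm_smul, Complex.norm_real, norm_inv, norm_norm] at h1
    rwa [← le_div_iff₀ hn, div_eq_inv_mul]
  obtain ⟨c₂, hc₂, hfarb⟩ := hfar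
  -- Since `‖θ‖ ^ ν ≤ R ^ ν` on the unit cell, dividing by `R ^ ν` turns the two constant lower
  -- bounds into multiples of `‖θ‖ ^ ν`.
  refine ⟨min (C * p) (min (ε / R ^ ν) (c₂ / R ^ ν)), by positivity, fun θ hθ x => ?_⟩
  have hdiv : ∀ a : ℝ, 0 ≤ a → a / R ^ ν * ‖θ‖ ^ ν ≤ a := by
    intro a ha
    calc a / R ^ ν * ‖θ‖ ^ ν ≤ a / R ^ ν * R ^ ν := by
          exact mul_le_mul_of_nonneg_left
            (hθR θ hθ) (by positivity)
      _ = a := by field_simp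
  by_cases hcase : ‖(2 * Real.pi) • θ‖ < ρ
  · refine norm_symA_ge Γ E₀ _ (by positivity) (fun k => ?_) x
    by_cases hkj : k = j
    · subst hkj
      refine le_trans ?_ ((hnear θ hcase).trans (le_abs_self _))
      gcongr
      exact min_le_left _ _
    · refine le_trans ?_ (abs_charRoot_ge hε hC _ hkj)
      refine le_trans ?_ (hdiv ε hε.le)
      gcongr
      exact (min_le_right _ _).trans (min_le_left _ _)
  · refine le_trans ?_ (hfarb θ hθ (not_lt.1 hcase) x)
    gcongr
    refine le_trans ?_ (hdiv c₂ hc₂.le)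
    gcongr
    exact (min_le_right _ _).trans (min_le_right _ _)

/-- At `θ = h η` the factors `h^(-ν)` and `‖h η‖^ν` combine to `‖η‖^ν`, which makes the constant
independent of `h`. -/
theorem exists_norm_symLin_ge {Γ : PeriodicGraph d s} {ν E₀ : ℝ} {j : Fin s} {K₀ : Set (Rd d)}
    {d₁ : Rd d} {P : Rd d → ℝ} (hν : 0 < ν) (hB1 : HypB1 Γ E₀ j K₀ d₁)
    (hB3 : HypB3 Γ ν E₀ j K₀ d₁ P) (hC1 : HypC1 Γ E₀ j d₁) (hC2 : HypC2 Γ E₀ j)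
    (hγ : ∀ t : ℝ, 0 < t → ∀ ξ, P (t • ξ) = t ^ ν * P ξ) :
    ∃ c > 0, ∀ h : ℝ, 0 < h → ∀ η ∈ closedTile d h⁻¹, ∀ x : Cs s,
      c * ‖η‖ ^ ν * ‖x‖ ≤ ‖symLin Γ ν E₀ d₁ h ((2 * Real.pi) • η) x‖ := by
  obtain ⟨c, hc, hb⟩ := exists_norm_symA_ge hν hB1 hB3 hC1 hC2 hγ
  refine ⟨c, hc, fun h hh η hη x => ?_⟩
  have hmem : h • η ∈ closedTile d 1 := by
    intro i
    rw [PiLp.smul_apply, smul_eq_mul, abs_mul, abs_of_pos hh]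
    calc h * |η i| ≤ h * (h⁻¹ / 2) := by gcongr; exact hη i
      _ = 1 / 2 := by field_simp
  have h1 := hb _ hmem x
  rw [symLin_eq_smul_symA hh, norm_smul, Complex.norm_real, Real.norm_of_nonneg (by positivity),
    smul_comm h]
  rw [norm_smul, Real.norm_of_nonneg hh.le, Real.mul_rpow hh.le (norm_nonneg _)] at h1
  calc c * ‖η‖ ^ ν * ‖x‖ = h ^ (-ν) * (c * (h ^ ν * ‖η‖ ^ ν) * ‖x‖) := by
        have : h ^ (-ν) * h ^ ν = 1 := by rw [← Real.rpow_add hh, neg_add_cancel, Real.rpow_zero]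
        linear_combination -(c * ‖η‖ ^ ν * ‖x‖) * this
    _ ≤ _ := by gcongr

/-! ### Convergence of the resolvent of the symbol -/

/-- Split `x` by `Π_h`, which commutes with the symbol. On the range the equation is scalar, `(P_h -
z) Π_h x = Π_h v`. On the complement the symbol is at least `h^(-ν) ε`, which tends to infinity, so
that component tends to `0`. -/
theorem tendsto_resolvent {Γ : PeriodicGraph d s} {ν E₀ : ℝ} {j : Fin s} {K₀ : Set (Rd d)}
    {d₁ : Rd d} {P : Rd d → ℝ} {Pi₀ : Rd d → Matrix (Fin s) (Fin s) ℂ} (hν : 0 < ν)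
    (hB3 : HypB3 Γ ν E₀ j K₀ d₁ P) (hB4 : HypB4 Γ ν E₀ {j} d₁ Pi₀) (hC2 : HypC2 Γ E₀ j)
    {z : ℂ} (hz : z.im ≠ 0) {ξ : Rd d} (hξ : ξ ≠ 0) {v : Cs s} {x : ℝ → Cs s}
    (hx : ∀ᶠ h in 𝓝[>] (0 : ℝ), symLin Γ ν E₀ d₁ h ξ (x h) - z • x h = v) :
    Tendsto x (𝓝[>] 0) (𝓝 (((P ξ : ℂ) - z)⁻¹ • Matrix.toEuclideanLin (Pi₀ ξ) v)) := by
  obtain ⟨ε, hε, hC⟩ := hC2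
  have hPz : ∀ t : ℝ, (t : ℂ) - z ≠ 0 := fun t h0 => hz (by
    rw [← sub_eq_zero.1 h0, Complex.ofReal_im])
  have h1 : Tendsto (fun h : ℝ => ((Ph Γ ν E₀ j d₁ h ξ : ℂ) - z)⁻¹ • PiHLin Γ ν E₀ j d₁ h ξ v)
      (𝓝[>] 0) (𝓝 (((P ξ : ℂ) - z)⁻¹ • Matrix.toEuclideanLin (Pi₀ ξ) v)) := by
    refine Tendsto.smul ?_ (tendsto_PiHLin hB4 hξ v)
    exact (((Complex.continuous_ofReal.tendsto _).comp (tendsto_Ph hB3 hξ)).sub_const z).inv₀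
      (hPz _)
  have hbig : Tendsto (fun h : ℝ => h ^ (-ν) * ε - ‖z‖) (𝓝[>] 0) atTop := by
    have h2 : Tendsto (fun h : ℝ => h ^ (-ν)) (𝓝[>] 0) atTop :=
      tendsto_rpow_neg_nhdsGT_zero (by linarith)
    exact tendsto_atTop_add_const_right _ _ (h2.atTop_mul_const hε)
  have h3 : Tendsto (fun h : ℝ => x h - PiHLin Γ ν E₀ j d₁ h ξ (x h)) (𝓝[>] 0) (𝓝 0) := by
    have hlim : Tendsto (fun h : ℝ => (h ^ (-ν) * ε - ‖z‖)⁻¹ *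
        ‖v - PiHLin Γ ν E₀ j d₁ h ξ v‖) (𝓝[>] 0) (𝓝 0) := by
      have := hbig.inv_tendsto_atTop.mul
        (tendsto_const_nhds.sub (tendsto_PiHLin hB4 hξ v) : Tendsto (fun h : ℝ =>
          v - PiHLin Γ ν E₀ j d₁ h ξ v) (𝓝[>] 0) _).norm
      rwa [zero_mul] at this
    refine squeeze_zero_norm' ?_ hlim
    filter_upwards [hx, self_mem_nhdsWithin, hbig.eventually_gt_atTop 0] with h hxh hh hpos
    have hh' : 0 < h := hh
    rw [← div_eq_inv_mul, le_div_iff₀ hpos]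
    set w := x h - PiHLin Γ ν E₀ j d₁ h ξ (x h) with hw
    have h5 := norm_symLin_sub_PiHLin_ge Γ ν E₀ j d₁ h ξ
      (by positivity : 0 ≤ h ^ (-ν) * ε) (fun k hk => charRootH_abs_ge hε hC ν hh' _ hk) (x h)
    have h6 : symLin Γ ν E₀ d₁ h ξ w - z • w = v - PiHLin Γ ν E₀ j d₁ h ξ v := by
      rw [← hxh, hw]
      simp only [map_sub, map_smul, PiHLin_symLin, symLin_PiHLin, smul_sub]
      abel
    have h7 : ‖symLin Γ ν E₀ d₁ h ξ w‖ ≤ ‖v - PiHLin Γ ν E₀ j d₁ h ξ v‖ + ‖z‖ * ‖w‖ := by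
      rw [← h6, ← norm_smul]
      have := norm_add_le (symLin Γ ν E₀ d₁ h ξ w - z • w) (z • w)
      rwa [sub_add_cancel] at this
    linarith
  have h4 := h1.add h3
  rw [add_zero] at h4
  refine h4.congr' ?_
  filter_upwards [hx] with h hxh
  have h5 : PiHLin Γ ν E₀ j d₁ h ξ v = ((Ph Γ ν E₀ j d₁ h ξ : ℂ) - z) •
      PiHLin Γ ν E₀ j d₁ h ξ (x h) := by
    rw [← hxh, map_sub, map_smul, PiHLin_symLin, sub_smul]
  rw [h5, smul_smul, inv_mul_cancel₀ (hPz _), one_smul]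
  abel

/-! ### The inverse Fourier transform on `L¹` and on `L²`; Sobolev embedding -/

section Pairing

variable {F : Type*} [NormedAddCommGroup F]

/-- Fubini, in the form for a general pairing; the pairing `-⟨·,·⟩` produces the inverse transform.
-/
theorem integral_smul_fourierInv [NormedSpace ℂ F] [CompleteSpace F]
    {φ : Rd d → ℂ} {G : Rd d → F} (hφ : Integrable φ) (hG : Integrable G) :
    ∫ x, φ x • 𝓕⁻ G x = ∫ x, 𝓕⁻ φ x • G x := by
  have h := VectorFourier.integral_fourierIntegral_smul_eq_flip (μ := volume) (ν := volume)
    (L := -(innerₗ (Rd d))) (f := φ) (g := G) Real.continuous_fourierChar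
    (by simp only [LinearMap.neg_apply, innerₗ_apply_apply]; fun_prop) hφ hG
  have h1 : ∀ w, VectorFourier.fourierIntegral Real.fourierChar volume (-(innerₗ (Rd d))) φ w
      = 𝓕⁻ φ w := fun w => by
    simp [VectorFourier.fourierIntegral, Real.fourierInv_eq]
  have h2 : ∀ w, VectorFourier.fourierIntegral Real.fourierChar volume (-(innerₗ (Rd d))).flip G w
      = 𝓕⁻ G w := fun w => by
    simp [VectorFourier.fourierIntegral, Real.fourierInv_eq, real_inner_comm]
  simp_rw [h1, h2] at h
  exact h.symm

theorem continuous_fourierInv [NormedSpace ℂ F] {G : Rd d → F} (hG : Integrable G) :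
    Continuous (𝓕⁻ G) := by
  have h1 : Continuous (𝓕 G) :=
    VectorFourier.fourierIntegral_continuous Real.continuous_fourierChar
      (by simp only [innerₗ_apply_apply]; fun_prop) hG
  have h2 : (𝓕⁻ G) = fun x => 𝓕 G (-x) := by
    ext x; exact Real.fourierInv_eq_fourier_neg G x
  rw [h2]
  exact h1.comp continuous_neg

theorem ae_eq_of_integral_schwartz_smul_eq [NormedSpace ℂ F] [CompleteSpace F] {f g : Rd d → F}
    (hf : LocallyIntegrable f) (hg : LocallyIntegrable g)
    (h : ∀ φ : 𝓢(Rd d, ℂ), ∫ x, φ x • f x = ∫ x, φ x • g x) : f =ᵐ[volume] g := by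
  refine ae_eq_of_integral_contDiff_smul_eq hf hg fun a ha hac => ?_
  have hc : ContDiff ℝ ∞ fun x => (a x : ℂ) := Complex.ofRealCLM.contDiff.comp ha
  have hcs : HasCompactSupport fun x => (a x : ℂ) := hac.comp_left Complex.ofReal_zero
  have := h (hcs.toSchwartzMap hc)
  simpa using this

theorem Lp_locallyIntegrable (g : Lp F 2 (volume : Measure (Rd d))) : LocallyIntegrable g :=
  (Lp.memLp g).locallyIntegrable (by norm_num)

variable [InnerProductSpace ℂ F] [CompleteSpace F]

theorem integral_smul_fourierInv_Lp (φ : 𝓢(Rd d, ℂ)) (g : Lp F 2 (volume : Measure (Rd d))) :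
    ∫ x, φ x • (𝓕⁻ g : Lp F 2 (volume : Measure (Rd d))) x = ∫ x, 𝓕⁻ (φ : Rd d → ℂ) x • g x := by
  have h1 := Lp.fourierInv_toTemperedDistribution_eq g
  have h2 := congrArg (fun T : 𝓢'(Rd d, F) => T φ) h1
  simp only [TemperedDistribution.fourierInv_apply, Lp.toTemperedDistribution_apply] at h2
  rw [← h2, SchwartzMap.fourierInv_coe]

/-- The inverse Fourier transforms on `L¹` and on `L²` agree on `L¹ ∩ L²`. -/
theorem fourierInv_toLp_ae_eq {G : Rd d → F} (hG : Integrable G) (hG2 : MemLp G 2) :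
    (𝓕⁻ (hG2.toLp G) : Lp F 2 (volume : Measure (Rd d))) =ᵐ[volume] 𝓕⁻ G := by
  refine ae_eq_of_integral_schwartz_smul_eq (Lp_locallyIntegrable _)
    (continuous_fourierInv hG).locallyIntegrable fun φ => ?_
  rw [integral_smul_fourierInv_Lp, integral_smul_fourierInv φ.integrable hG]
  refine integral_congr_ae ?_
  filter_upwards [hG2.coeFn_toLp] with x hx
  rw [hx]

theorem memLp_fourierInv {G : Rd d → F} (hG : Integrable G) (hG2 : MemLp G 2) :
    MemLp (𝓕⁻ G) 2 :=
  (memLp_congr_ae (fourierInv_toLp_ae_eq hG hG2)).1 (Lp.memLp _)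

/-- A function of `L¹` whose inverse Fourier transform is in `L²` is its Fourier transform. -/
theorem fourier_toLp_fourierInv_ae_eq {G : Rd d → F} (hG : Integrable G) (hw : MemLp (𝓕⁻ G) 2) :
    (𝓕 (hw.toLp (𝓕⁻ G)) : Lp F 2 (volume : Measure (Rd d))) =ᵐ[volume] G := by
  set w := hw.toLp (𝓕⁻ G)
  refine ae_eq_of_integral_schwartz_smul_eq (Lp_locallyIntegrable _) hG.locallyIntegrable
    fun φ => ?_
  -- Testing with `𝓕 φ` makes the inverse transform on the test side return `φ`, both for the `L²`
  -- transform here and for the `L¹` one in `h2`.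
  have h1 := integral_smul_fourierInv_Lp (𝓕 φ) (𝓕 w)
  rw [FourierTransform.fourierInv_fourier_eq, ← SchwartzMap.fourierInv_coe,
    FourierTransform.fourierInv_fourier_eq] at h1
  have h2 := integral_smul_fourierInv (𝓕 φ : 𝓢(Rd d, ℂ)).integrable hG
  rw [← SchwartzMap.fourierInv_coe, FourierTransform.fourierInv_fourier_eq] at h2
  rw [← h1, ← h2]
  refine integral_congr_ae ?_
  filter_upwards [hw.coeFn_toLp] with x hx
  rw [hx]

theorem norm_sq_fourierInv {G : Rd d → F} (hG : Integrable G) (hG2 : MemLp G 2) :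
    ∫ x, ‖𝓕⁻ G x‖ ^ 2 = ∫ x, ‖G x‖ ^ 2 := by
  have h1 : ∀ g : Lp F 2 (volume : Measure (Rd d)), ∫ x, ‖g x‖ ^ 2 = ‖g‖ ^ 2 := fun g => by
    have := L2.inner_def (𝕜 := ℂ) g g
    rw [inner_self_eq_norm_sq_to_K] at this
    simp_rw [inner_self_eq_norm_sq_to_K] at this
    norm_cast at this
    exact this.symm
  have h2 := h1 (hG2.toLp G)
  have h3 := h1 (𝓕⁻ (hG2.toLp G))
  rw [← Lp.norm_fourier_eq (𝓕⁻ (hG2.toLp G)), FourierTransform.fourier_fourierInv_eq, ← h2] at h3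
  have h4 : ∫ x, ‖(𝓕⁻ (hG2.toLp G) : Lp F 2 (volume : Measure (Rd d))) x‖ ^ 2
      = ∫ x, ‖𝓕⁻ G x‖ ^ 2 :=
    integral_congr_ae ((fourierInv_toLp_ae_eq hG hG2).fun_comp fun v => ‖v‖ ^ 2)
  rw [← h4, h3]
  exact integral_congr_ae (hG2.coeFn_toLp.fun_comp fun v => ‖v‖ ^ 2)

/-- Sobolev embedding: a continuous function of `H^r`, `r > d / 2`, is the inverse Fourier transform
of an integrable function. -/
theorem exists_fourierInv_of_memHw {r : ℝ} (hr : (d : ℝ) / 2 < r) {f : Rd d → F}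
    (hfc : Continuous f) (hf : MemHw r 0 f) :
    ∃ G : Rd d → F, StronglyMeasurable G ∧ Integrable G ∧ MemLp G 2 ∧ 𝓕⁻ G = f := by
  obtain ⟨g, hgf, hg⟩ := hf
  -- The condition `r > d / 2` makes the Fourier transform integrable. The representative `v` is
  -- then compared with the `L²` transform as a distribution.
  obtain ⟨v, hv⟩ := hg.fourier_memL1 (by rw [finrank_euclideanSpace_fin]; linarith)
  have h1 : (v : Rd d → F) =ᵐ[volume] (𝓕 g : Lp F 2 (volume : Measure (Rd d))) := by
    refine ae_eq_of_integral_schwartz_smul_eq ((Lp.memLp v).locallyIntegrable le_rfl)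
      (Lp_locallyIntegrable _) fun φ => ?_
    rw [Lp.fourier_toTemperedDistribution_eq] at hv
    have := congrArg (fun T : 𝓢'(Rd d, F) => T φ) hv
    simp only [Lp.toTemperedDistribution_apply] at this
    exact this.symm
  have hI : Integrable v := L1.integrable_coeFn v
  have hM : MemLp v 2 := (memLp_congr_ae h1).2 (Lp.memLp _)
  refine ⟨v, Lp.stronglyMeasurable v, hI, hM, ?_⟩
  have h2 : hM.toLp v = 𝓕 g := by
    refine Lp.ext ?_
    exact hM.coeFn_toLp.trans h1
  have h3 := fourierInv_toLp_ae_eq hI hM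
  rw [h2, FourierTransform.fourierInv_fourier_eq] at h3
  have h4 : (𝓕⁻ (v : Rd d → F)) =ᵐ[volume] f := by
    refine h3.symm.trans (hgf.trans (Eventually.of_forall fun x => ?_))
    simp [weighted]
  exact (Continuous.ae_eq_iff_eq volume (continuous_fourierInv hI) hfc).1 h4

end Pairing

/-! ### The Bessel kernel -/

/-- The Gaussian with Fourier transform `exp (-t |x|²)`. -/
def gaussianKernel (d : ℕ) (t : ℝ) (ξ : Rd d) : ℝ :=
  (Real.pi / t) ^ ((d : ℝ) / 2) * Real.exp (-(Real.pi ^ 2 / t) * ‖ξ‖ ^ 2)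

theorem gaussianKernel_const {t : ℝ} (ht : 0 < t) :
    (Real.pi / t) ^ ((d : ℝ) / 2) * (Real.pi / (Real.pi ^ 2 / t)) ^ ((d : ℝ) / 2) = 1 := by
  have hpi := Real.pi_pos
  rw [← Real.mul_rpow (by positivity) (by positivity)]
  have : Real.pi / t * (Real.pi / (Real.pi ^ 2 / t)) = 1 := by field_simp
  rw [this, Real.one_rpow]

theorem gaussianKernel_nonneg {t : ℝ} (ht : 0 < t) (ξ : Rd d) : 0 ≤ gaussianKernel d t ξ := by
  have hpi := Real.pi_pos
  unfold gaussianKernel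
  positivity

theorem integrable_gaussianKernel {t : ℝ} (ht : 0 < t) : Integrable (gaussianKernel d t) := by
  have hb : 0 < ((Real.pi ^ 2 / t : ℝ) : ℂ).re := by
    rw [Complex.ofReal_re]; have := Real.pi_pos; positivity
  have h := (GaussianFourier.integrable_cexp_neg_mul_sq_norm_add hb 0 (0 : Rd d)).re
  refine (h.const_mul ((Real.pi / t) ^ ((d : ℝ) / 2))).congr (Eventually.of_forall fun ξ => ?_)
  simp only [gaussianKernel, zero_mul, add_zero]
  congr 1
  rw [← Complex.exp_ofReal_re]
  push_cast
  rfl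

theorem integral_gaussianKernel {t : ℝ} (ht : 0 < t) : ∫ ξ, gaussianKernel d t ξ = 1 := by
  simp only [gaussianKernel]
  rw [integral_const_mul, GaussianFourier.integral_rexp_neg_mul_sq_norm
    (by have := Real.pi_pos; positivity), finrank_euclideanSpace_fin, gaussianKernel_const ht]

theorem fourierInv_gaussianKernel {t : ℝ} (ht : 0 < t) (x : Rd d) :
    𝓕⁻ (fun ξ : Rd d => (gaussianKernel d t ξ : ℂ)) x = (Real.exp (-t * ‖x‖ ^ 2) : ℝ) := by
  have hpi := Real.pi_pos
  have hb : 0 < ((Real.pi ^ 2 / t : ℝ) : ℂ).re := by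
    rw [Complex.ofReal_re]; positivity
  have h := fourier_gaussian_innerProductSpace hb (-x)
  have h1 : (fun ξ : Rd d => (gaussianKernel d t ξ : ℂ)) =
      fun ξ : Rd d => (((Real.pi / t) ^ ((d : ℝ) / 2) : ℝ) : ℂ) •
        Complex.exp (-((Real.pi ^ 2 / t : ℝ) : ℂ) * ‖ξ‖ ^ 2) := by
    ext ξ
    simp [gaussianKernel]
  rw [h1, Real.fourierInv_eq_fourier_neg]
  have h2 : 𝓕 (fun ξ : Rd d => (((Real.pi / t) ^ ((d : ℝ) / 2) : ℝ) : ℂ) •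
        Complex.exp (-((Real.pi ^ 2 / t : ℝ) : ℂ) * ‖ξ‖ ^ 2)) (-x)
      = (((Real.pi / t) ^ ((d : ℝ) / 2) : ℝ) : ℂ) •
        𝓕 (fun ξ : Rd d => Complex.exp (-((Real.pi ^ 2 / t : ℝ) : ℂ) * ‖ξ‖ ^ 2)) (-x) := by
    simp only [Real.fourier_eq]
    rw [← integral_smul]
    congr 1 with ξ
    rw [smul_comm]
  rw [h2, h, norm_neg, finrank_euclideanSpace_fin, smul_eq_mul, ← mul_assoc]
  have h3 : ((Real.pi : ℂ) / ((Real.pi ^ 2 / t : ℝ) : ℂ)) ^ ((d : ℂ) / 2)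
      = (((Real.pi / (Real.pi ^ 2 / t)) ^ ((d : ℝ) / 2) : ℝ) : ℂ) := by
    rw [Complex.ofReal_cpow (by positivity)]
    push_cast
    rfl
  rw [h3, ← Complex.ofReal_mul, gaussianKernel_const ht, Complex.ofReal_one, one_mul,
    Complex.ofReal_exp]
  congr 1
  have : (t : ℂ) ≠ 0 := by exact_mod_cast ht.ne'
  have : (Real.pi : ℂ) ≠ 0 := by exact_mod_cast hpi.ne'
  push_cast
  field_simp

/-- Subordination: `Γ(a) (1 + |x|²)^(-a) = ∫₀^∞ t^(a-1) e^(-t) e^(-t|x|²) dt`. Each Gaussian is the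
transform of a nonnegative kernel of mass one, so the superposition of these kernels is integrable
and Fubini applies. -/
theorem exists_fourierInv_eq_rpow (d : ℕ) {a : ℝ} (ha : 0 < a) :
    ∃ K : Rd d → ℂ, Integrable K ∧ ∀ x, 𝓕⁻ K x = (((1 + ‖x‖ ^ 2) ^ (-a) : ℝ) : ℂ) := by
  set μ : Measure ℝ := volume.restrict (Set.Ioi 0)
  set w : ℝ → ℝ := fun t => (Real.Gamma a)⁻¹ * (t ^ (a - 1) * Real.exp (-t))
  have hΓ := Real.Gamma_pos_of_pos ha
  have hw : Integrable w μ := by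
    refine Integrable.const_mul ?_ _
    refine (Real.GammaIntegral_convergent ha).congr (Eventually.of_forall fun t => mul_comm _ _)
  have hmeas : Measurable fun p : ℝ × Rd d => w p.1 * gaussianKernel d p.1 p.2 := by
    unfold gaussianKernel
    fun_prop
  have hint : Integrable (fun p : ℝ × Rd d => w p.1 * gaussianKernel d p.1 p.2) (μ.prod volume) := by
    rw [integrable_prod_iff hmeas.aestronglyMeasurable]
    constructor
    · filter_upwards [ae_restrict_mem measurableSet_Ioi] with t ht
      exact (integrable_gaussianKernel ht).const_mul _
    · refine hw.norm.congr ?_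
      filter_upwards [ae_restrict_mem measurableSet_Ioi] with t ht
      simp_rw [norm_mul]
      rw [integral_const_mul]
      simp_rw [fun ξ : Rd d => Real.norm_of_nonneg (gaussianKernel_nonneg ht ξ)]
      rw [integral_gaussianKernel ht, mul_one]
  refine ⟨fun ξ => ((∫ t, w t * gaussianKernel d t ξ ∂μ : ℝ) : ℂ), hint.integral_prod_right.ofReal,
    fun x => ?_⟩
  have hint2 : Integrable (fun p : Rd d × ℝ => Complex.exp (↑(2 * Real.pi * inner ℝ p.1 x) *
      Complex.I) • ((w p.2 * gaussianKernel d p.2 p.1 : ℝ) : ℂ)) (volume.prod μ) := by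
    refine Integrable.bdd_smul (𝕜 := ℂ) hint.swap.ofReal 1 ?_ ?_
    · exact Continuous.aestronglyMeasurable (by fun_prop)
    · exact Eventually.of_forall fun p => by rw [Complex.norm_exp_ofReal_mul_I]
  rw [Real.fourierInv_eq']
  calc ∫ ξ : Rd d, Complex.exp (↑(2 * Real.pi * inner ℝ ξ x) * Complex.I) •
        ((∫ t, w t * gaussianKernel d t ξ ∂μ : ℝ) : ℂ)
      = ∫ ξ : Rd d, ∫ t, Complex.exp (↑(2 * Real.pi * inner ℝ ξ x) * Complex.I) •
        ((w t * gaussianKernel d t ξ : ℝ) : ℂ) ∂μ := by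
        congr 1 with ξ
        rw [integral_smul, integral_complex_ofReal]
    _ = ∫ t, (∫ ξ : Rd d, Complex.exp (↑(2 * Real.pi * inner ℝ ξ x) * Complex.I) •
        ((w t * gaussianKernel d t ξ : ℝ) : ℂ)) ∂μ := integral_integral_swap hint2
    _ = ∫ t, (((Real.Gamma a)⁻¹ * (t ^ (a - 1) * Real.exp (-((1 + ‖x‖ ^ 2) * t))) : ℝ) : ℂ) ∂μ := by
        refine integral_congr_ae ?_
        filter_upwards [ae_restrict_mem measurableSet_Ioi] with t ht
        have h1 := fourierInv_gaussianKernel ht x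
        rw [Real.fourierInv_eq'] at h1
        simp_rw [Complex.ofReal_mul (w t), smul_eq_mul, mul_left_comm _ (w t : ℂ)]
        simp_rw [smul_eq_mul] at h1
        rw [integral_const_mul, h1, ← Complex.ofReal_mul]
        congr 1
        simp only [w]
        rw [mul_assoc, mul_assoc, ← Real.exp_add]
        ring_nf
    _ = _ := by
        rw [integral_complex_ofReal, integral_const_mul, Real.integral_rpow_mul_exp_neg_mul_Ioi ha
          (by positivity)]
        congr 1
        rw [one_div, Real.inv_rpow (by positivity), Real.rpow_neg (by positivity)]
        field_simp

/-! ### Convolution -/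

section Conv

variable {F : Type*} [NormedAddCommGroup F] [NormedSpace ℂ F]

/-- `∫ φ(η - ζ) G(ζ) dζ`. -/
def conv (φ : Rd d → ℂ) (G : Rd d → F) : Rd d → F :=
  convolution φ G (ContinuousLinearMap.lsmul ℂ ℂ) volume

theorem conv_apply (φ : Rd d → ℂ) (G : Rd d → F) (η : Rd d) :
    conv φ G η = ∫ ζ, φ (η - ζ) • G ζ := convolution_lsmul_swap

theorem integrable_conv {φ : Rd d → ℂ} {G : Rd d → F} (hφ : Integrable φ) (hG : Integrable G) :
    Integrable (conv φ G) := hφ.integrable_convolution _ hG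

theorem fourierInv_conv [CompleteSpace F] {φ : Rd d → ℂ} {G : Rd d → F} (hφ : Integrable φ)
    (hG : Integrable G) (x : Rd d) : 𝓕⁻ (conv φ G) x = 𝓕⁻ φ x • 𝓕⁻ G x := by
  simp only [Real.fourierInv_eq_fourier_neg]
  exact Real.fourier_smul_convolution_eq hφ hG (-x)

end Conv

/-- A continuous `f ∈ H^{m,σ}` with `m > d / 2`, `σ > 0` is the inverse Fourier transform of an
integrable function, and `⟨x⟩^σ f` is bounded. -/
theorem exists_fourierInv_of_memHw_weighted {m σ : ℝ} (hm : (d : ℝ) / 2 < m) (hσ : 0 < σ)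
    {f : Rd d → Cs s} (hfc : Continuous f) (hf : MemHw m σ f) :
    (∃ G : Rd d → Cs s, Integrable G ∧ 𝓕⁻ G = f) ∧
      ∃ C, 0 ≤ C ∧ ∀ x, ‖f x‖ ≤ C * (1 + ‖x‖ ^ 2) ^ (-(σ / 2)) := by
  have hc : Continuous (weighted σ f) := by
    unfold weighted
    refine Continuous.smul (Complex.continuous_ofReal.comp ?_) hfc
    exact Continuous.rpow_const (by fun_prop) fun x => Or.inl (by positivity)
  have hw0 : weighted 0 (weighted σ f) = weighted σ f := by
    ext1 x; simp [weighted]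
  obtain ⟨G, -, hG, -, hGf⟩ := exists_fourierInv_of_memHw hm hc
    (by unfold MemHw at hf ⊢; rwa [hw0])
  -- `f` is `⟨x⟩^(-σ)`, the transform of `K`, times `⟨x⟩^σ f`, the transform of `G`; hence it is the
  -- transform of `K * G`.
  obtain ⟨K, hK, hKx⟩ := exists_fourierInv_eq_rpow d (half_pos hσ)
  have hcancel : ∀ x : Rd d, (1 + ‖x‖ ^ 2) ^ (-(σ / 2)) * (1 + ‖x‖ ^ 2) ^ (σ / 2) = 1 := fun x => by
    rw [← Real.rpow_add (by positivity), neg_add_cancel, Real.rpow_zero]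
  have hfx : ∀ x, f x = (((1 + ‖x‖ ^ 2) ^ (-(σ / 2)) : ℝ) : ℂ) • weighted σ f x := fun x => by
    rw [weighted, smul_smul, ← Complex.ofReal_mul, hcancel, Complex.ofReal_one, one_smul]
  refine ⟨⟨conv K G, integrable_conv hK hG, ?_⟩, ∫ η, ‖G η‖,
    integral_nonneg fun _ => norm_nonneg _, fun x => ?_⟩
  · ext1 x
    rw [fourierInv_conv hK hG, hKx, hGf]
    exact (hfx x).symm
  · rw [hfx, norm_smul, Complex.norm_real, Real.norm_of_nonneg (by positivity), mul_comm, ← hGf]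
    gcongr
    exact norm_fourierInv_le G x

/-! ### Riemann sums -/

theorem volume_tile {h : ℝ} (hh : 0 < h) : volume (tile d h) = ENNReal.ofReal (h ^ d) := by
  have h1 := (PiLp.volume_preserving_ofLp (Fin d)).measure_preimage
    (s := Set.univ.pi fun _ : Fin d => Set.Ioc (-(h / 2)) (h / 2))
    (MeasurableSet.univ_pi fun _ => measurableSet_Ioc).nullMeasurableSet
  have h2 : (WithLp.ofLp ⁻¹' Set.univ.pi fun _ : Fin d => Set.Ioc (-(h / 2)) (h / 2))
      = tile d h := by
    ext x; simp [tile]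
  rw [h2] at h1
  rw [h1, Real.volume_pi_Ioc]
  simp only [sub_neg_eq_add, add_halves]
  rw [Finset.prod_const, Finset.card_univ, Fintype.card_fin, ENNReal.ofReal_pow hh.le]

/-- Riemann sums of `(1 + |x|)^(-b)`, `b > d`, over fine lattices are uniformly bounded. -/
theorem exists_riemann_sum_bound (d : ℕ) {b : ℝ} (hb : (d : ℝ) < b) :
    ∃ C : ℝ, 0 ≤ C ∧ ∀ h : ℝ, 0 < h → h ≤ 1 →
      Summable (fun n : Fin d → ℤ => (1 + ‖h • intVec n‖) ^ (-b)) ∧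
        h ^ d * ∑' n : Fin d → ℤ, (1 + ‖h • intVec n‖) ^ (-b) ≤ C := by
  have hb0 : 0 < b := lt_of_le_of_lt (Nat.cast_nonneg d) hb
  set R : ℝ := (d : ℝ) * (1 / 2)
  have hR : 0 ≤ R := by positivity
  set I : ENNReal := ∫⁻ x : Rd d, ENNReal.ofReal ((1 + ‖x‖) ^ (-b))
  have hI : I < ⊤ := finite_integral_one_add_norm (by rwa [finrank_euclideanSpace_fin])
  set C : ENNReal := ENNReal.ofReal ((1 + R) ^ b) * I
  have hC : C < ⊤ := ENNReal.mul_lt_top ENNReal.ofReal_lt_top hI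
  refine ⟨C.toReal, ENNReal.toReal_nonneg, fun h hh hh1 => ?_⟩
  have hkey : ENNReal.ofReal (h ^ d) *
      ∑' n : Fin d → ℤ, ENNReal.ofReal ((1 + ‖h • intVec n‖) ^ (-b)) ≤ C := by
    have hφ : Measurable fun x : Rd d => ENNReal.ofReal ((1 + ‖x‖) ^ (-b)) := by fun_prop
    simp only [C, I]
    rw [lintegral_eq_tsum_tile hh, ← ENNReal.tsum_mul_left, ← ENNReal.tsum_mul_left]
    refine ENNReal.tsum_le_tsum fun n => ?_
    rw [← lintegral_const_mul _ (by fun_prop), ← volume_tile hh, mul_comm, ← setLIntegral_const]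
    refine setLIntegral_mono (by fun_prop) fun x hx => ?_
    rw [← ENNReal.ofReal_mul (by positivity)]
    refine ENNReal.ofReal_le_ofReal ?_
    have hx1 : ‖x‖ ≤ R := (norm_le_of_mem_closedTile (tile_subset_closedTile h hx)).trans (by
      simp only [R]; gcongr)
    -- For `h ≤ 1` the points of a tile are within `R = d / 2` of its centre, so the weight varies
    -- over a tile by at most the factor `(1 + R) ^ b`, and the sum is dominated by the integral.
    have h1 : 1 + ‖x + h • intVec n‖ ≤ (1 + R) * (1 + ‖h • intVec n‖) := by
      have := norm_add_le x (h • intVec n)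
      nlinarith [norm_nonneg (h • intVec n : Rd d), mul_nonneg hR (norm_nonneg (h • intVec n : Rd d))]
    calc (1 + ‖h • intVec n‖) ^ (-b)
        = (1 + R) ^ b * ((1 + R) * (1 + ‖h • intVec n‖)) ^ (-b) := by
          rw [Real.mul_rpow (by positivity) (by positivity), ← mul_assoc,
            ← Real.rpow_add (by positivity), add_neg_cancel, Real.rpow_zero, one_mul]
      _ ≤ _ := by
          gcongr ?_ * ?_
          exact Real.rpow_le_rpow_of_nonpos (by positivity) h1 (by linarith)
  have hS : ∑' n : Fin d → ℤ, ENNReal.ofReal ((1 + ‖h • intVec n‖) ^ (-b)) ≠ ⊤ := by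
    intro h0
    rw [h0, ENNReal.mul_top (by simpa using pow_pos hh d)] at hkey
    exact absurd hC (not_lt.2 hkey)
  have hsum : Summable (fun n : Fin d → ℤ => (1 + ‖h • intVec n‖) ^ (-b)) := by
    have := ENNReal.summable_toReal hS
    refine this.congr fun n => ENNReal.toReal_ofReal (by positivity)
  refine ⟨hsum, ?_⟩
  rw [← ENNReal.ofReal_tsum_of_nonneg (fun n => by positivity) hsum,
    ← ENNReal.ofReal_mul (by positivity)] at hkey
  exact (ENNReal.ofReal_le_iff_le_toReal hC.ne).1 hkey

theorem lp_norm_sq_eq_tsum (u : lp (fun _ : Fin d → ℤ => Cs s) 2) :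
    ‖u‖ ^ 2 = ∑' n, ‖u n‖ ^ 2 := by
  have := lp.norm_rpow_eq_tsum (p := 2) (by norm_num) u
  simpa using this

theorem memℓp_two_iff {u : (Fin d → ℤ) → Cs s} :
    Memℓp u 2 ↔ Summable fun n => ‖u n‖ ^ 2 := by
  have := memℓp_gen_iff (p := 2) (f := u) (by norm_num)
  simpa using this

/-- The restrictions to `hℤᵈ` of a function decaying like `⟨x⟩^{-σ}`, `σ > d`, have `ℓ²` norms of
size `h^{-d/2}`. -/
theorem exists_lattice_restriction {f : Rd d → Cs s} {C σ : ℝ} (hσ : (d : ℝ) < σ) (hC : 0 ≤ C)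
    (hf : ∀ x, ‖f x‖ ≤ C * (1 + ‖x‖ ^ 2) ^ (-(σ / 2))) :
    ∃ C', 0 ≤ C' ∧ ∀ h : ℝ, 0 < h → h ≤ 1 → ∃ F : lp (fun _ : Fin d → ℤ => Cs s) 2,
      (∀ n, F n = f (h • intVec n)) ∧ h ^ d * ‖F‖ ^ 2 ≤ C' := by
  have hσ0 : 0 < σ := lt_of_le_of_lt (Nat.cast_nonneg d) hσ
  obtain ⟨D, hD, hb⟩ := exists_riemann_sum_bound d hσ
  set c : ℝ := (C * 2 ^ (σ / 2)) ^ 2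
  have hfx : ∀ x, ‖f x‖ ^ 2 ≤ c * (1 + ‖x‖) ^ (-σ) := fun x => by
    have h1 : ‖f x‖ ≤ C * 2 ^ (σ / 2) * (1 + ‖x‖) ^ (-σ) := by
      refine (hf x).trans ?_
      rw [mul_assoc, ← neg_div]
      exact mul_le_mul_of_nonneg_left (rpow_neg_one_add_norm_sq_le x hσ0) hC
    -- One of the two decay factors of `‖f x‖ ^ 2` is discarded; the other is summable since `σ >
    -- d`.
    have h2 : (1 + ‖x‖) ^ (-σ) ≤ 1 :=
      Real.rpow_le_one_of_one_le_of_nonpos (by linarith [norm_nonneg x]) (by linarith)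
    calc ‖f x‖ ^ 2 ≤ (C * 2 ^ (σ / 2) * (1 + ‖x‖) ^ (-σ)) ^ 2 := by gcongr
      _ = c * (((1 + ‖x‖) ^ (-σ)) * (1 + ‖x‖) ^ (-σ)) := by simp only [c]; ring
      _ ≤ c * (1 * (1 + ‖x‖) ^ (-σ)) := by gcongr
      _ = _ := by rw [one_mul]
  refine ⟨c * D, by positivity, fun h hh hh1 => ?_⟩
  obtain ⟨hs, hle⟩ := hb h hh hh1
  have hsum : Summable fun n : Fin d → ℤ => ‖f (h • intVec n)‖ ^ 2 :=
    Summable.of_nonneg_of_le (fun n => by positivity) (fun n => hfx _) (hs.mul_left c)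
  refine ⟨⟨fun n => f (h • intVec n), memℓp_two_iff.2 hsum⟩, fun n => rfl, ?_⟩
  rw [lp_norm_sq_eq_tsum]
  calc h ^ d * ∑' n : Fin d → ℤ, ‖f (h • intVec n)‖ ^ 2
      ≤ h ^ d * ∑' n : Fin d → ℤ, c * (1 + ‖h • intVec n‖) ^ (-σ) := by
        gcongr
        · exact hs.mul_left c
        · exact hfx _
    _ = c * (h ^ d * ∑' n : Fin d → ℤ, (1 + ‖h • intVec n‖) ^ (-σ)) := by
        rw [tsum_mul_left]; ring
    _ ≤ c * D := by gcongr

theorem memLp_two_of_decay {f : Rd d → Cs s} {C σ : ℝ} (hσ : (d : ℝ) < σ) (hfc : Continuous f)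
    (hf : ∀ x, ‖f x‖ ≤ C * (1 + ‖x‖ ^ 2) ^ (-(σ / 2))) : MemLp f 2 := by
  have hI := integrable_rpow_neg_one_add_norm_sq (E := Rd d) (μ := volume) (r := 2 * σ)
    (by rw [finrank_euclideanSpace_fin]; have : (0:ℝ) ≤ d := Nat.cast_nonneg d; linarith)
  refine (memLp_two_iff_integrable_sq_norm hfc.aestronglyMeasurable).2 ?_
  refine (hI.const_mul (C ^ 2)).mono' (by fun_prop) (Eventually.of_forall fun x => ?_)
  rw [Real.norm_of_nonneg (by positivity)]
  calc ‖f x‖ ^ 2 ≤ (C * (1 + ‖x‖ ^ 2) ^ (-(σ / 2))) ^ 2 := by gcongr; exact hf x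
    _ = _ := by
      rw [mul_pow, ← Real.rpow_mul_natCast (by positivity)]
      congr 2
      push_cast
      ring

/-! ### The discrete equation -/

section Discrete

variable {Γ : PeriodicGraph d s} {ν E₀ : ℝ} {d₁ : Rd d} {V : Rd d → ℝ} {z : ℂ} {f : Rd d → Cs s}
  {h : ℝ} {u : lp (fun _ : Fin d → ℤ => Cs s) 2}

/-- The gauge transformed kinetic term of a solution is `f_h - V_h u + z u`. -/
theorem exists_kinetic (hu : SolvesDiscrete Γ ν E₀ d₁ V z f h u) {M : ℝ} (hV : ∀ x, |V x| ≤ M)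
    (F : lp (fun _ : Fin d → ℤ => Cs s) 2) (hF : ∀ n, F n = f (h • intVec n)) :
    ∃ W : lp (fun _ : Fin d → ℤ => Cs s) 2, (∀ n, W n = (V (h • intVec n) : ℂ) • u n) ∧
      ∀ n, (F - W + z • u) n = -gaugeAdj d₁ h (laplacianDisc Γ ν E₀ h (gauge d₁ h u)) n := by
  have hsum : Summable fun n : Fin d → ℤ => ‖(V (h • intVec n) : ℂ) • u n‖ ^ 2 := by
    refine Summable.of_nonneg_of_le (fun n => by positivity) (fun n => ?_)
      ((memℓp_two_iff.1 (lp.memℓp u)).mul_left (M ^ 2))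
    rw [norm_smul, Complex.norm_real, mul_pow]
    gcongr
    exact hV _
  refine ⟨⟨_, memℓp_two_iff.2 hsum⟩, fun n => rfl, fun n => ?_⟩
  have := hu n
  simp only [lp.coeFn_add, lp.coeFn_sub, lp.coeFn_smul, Pi.add_apply, Pi.sub_apply, Pi.smul_apply,
    hF]
  rw [← this]
  abel

/-- By Plancherel the kinetic form is an integral of quadratic forms of Hermitian matrices. -/
theorem im_inner_dft_eq_zero (hh : 0 < h) {y : lp (fun _ : Fin d → ℤ => Cs s) 2}
    (hy : ∀ n, y n = -gaugeAdj d₁ h (laplacianDisc Γ ν E₀ h (gauge d₁ h u)) n) :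
    (inner ℂ u y).im = 0 := by
  have h1 := integral_inner_dft hh u y
  have h2 : ∫ η, inner ℂ (dft h u η) (dft h y η)
      = ∫ η, (((inner ℂ (dft h u η) (dft h y η)).re : ℝ) : ℂ) := by
    refine integral_congr_ae ?_
    filter_upwards [dft_laplacianDisc hh Γ ν E₀ d₁ u y hy] with η hη
    rw [hη]
    exact ((isSymmetric_symbolH Γ ν E₀ h _).coe_re_inner_self_apply _).symm
  rw [h2, integral_complex_ofReal] at h1
  have h3 := congrArg Complex.im h1
  rw [Complex.ofReal_im, Complex.im_ofReal_mul] at h3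
  exact (mul_eq_zero.1 h3.symm).resolve_left (pow_pos hh d).ne'

/-- Pair the equation with `u`: the kinetic and potential terms are real, so only `Im z ‖u‖²`
balances `Im ⟨u, F⟩`. -/
theorem abs_im_mul_norm_solution_le (hh : 0 < h) (hu : SolvesDiscrete Γ ν E₀ d₁ V z f h u) {M : ℝ}
    (hV : ∀ x, |V x| ≤ M) (F : lp (fun _ : Fin d → ℤ => Cs s) 2)
    (hF : ∀ n, F n = f (h • intVec n)) : |z.im| * ‖u‖ ≤ ‖F‖ := by
  obtain ⟨W, hW, hy⟩ := exists_kinetic hu hV F hF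
  have h1 := im_inner_dft_eq_zero hh hy
  have h2 : (inner ℂ u W).im = 0 := by
    rw [lp.inner_eq_tsum]
    have : ∀ n, inner ℂ (u n) (W n) = ((V (h • intVec n) * ‖u n‖ ^ 2 : ℝ) : ℂ) := fun n => by
      rw [hW, inner_smul_right, inner_self_eq_norm_sq_to_K]; push_cast; rfl
    simp_rw [this]
    rw [← Complex.ofReal_tsum, Complex.ofReal_im]
  rw [inner_add_right, inner_sub_right, inner_smul_right, inner_self_eq_norm_sq_to_K,
    Complex.add_im, Complex.sub_im, h2, Complex.mul_im] at h1
  simp only [Complex.coe_algebraMap, ← Complex.ofReal_pow, Complex.ofReal_re,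
    Complex.ofReal_im] at h1
  by_cases hu0 : ‖u‖ = 0
  · rw [hu0, mul_zero]; exact norm_nonneg _
  have hpos : 0 < ‖u‖ := lt_of_le_of_ne (norm_nonneg _) (Ne.symm hu0)
  refine le_of_mul_le_mul_right ?_ hpos
  have h3 := (Complex.abs_im_le_norm _).trans (norm_inner_le_norm (𝕜 := ℂ) u F)
  have h4 : (inner ℂ u F).im = -(z.im * ‖u‖ ^ 2) := by linarith
  rw [h4, abs_neg, abs_mul, abs_of_nonneg (sq_nonneg ‖u‖)] at h3
  nlinarith

theorem lp_sub_apply (a b : lp (fun _ : Fin d → ℤ => Cs s) 2) (n : Fin d → ℤ) :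
    (a - b) n = a n - b n := rfl

/-- Linearity of `dft`, in the shape needed to split off `z u`, read off from the lattice samples.
-/
theorem dft_sub_smul_ae_eq (hh : 0 < h) (a u : lp (fun _ : Fin d → ℤ => Cs s) 2) (z : ℂ) :
    dft h a =ᵐ[volume] fun η => dft h (a + z • u) η - z • dft h u η := by
  have h1 := integrable_dft hh a
  have h2 := integrable_dft hh (a + z • u)
  have h3 : Integrable fun η => z • dft h u η := (integrable_dft hh u).smul z
  have hz : ∀ x, 𝓕⁻ (fun η => z • dft h u η) x = z • 𝓕⁻ (dft h u) x := fun x => by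
    simp only [Real.fourierInv_eq']
    rw [← integral_smul]
    congr 1 with η
    rw [smul_comm]
  have h4 := ae_eq_zero_of_fourierInv_lattice (F := dft h a - (dft h (a + z • u)
    - fun η => z • dft h u η)) (h1.sub (h2.sub h3)) hh (Eventually.of_forall fun η hη => by
      simp [dft_of_notMem, hη]) fun n => by
      rw [fourierInv_sub_apply h1 (h2.sub h3), fourierInv_sub_apply h2 h3, hz,
        fourierInv_dft_lattice hh, fourierInv_dft_lattice hh, fourierInv_dft_lattice hh]
      change a n - ((a n + z • u n) - z • u n) = 0
      abel
  filter_upwards [h4] with η hη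
  exact sub_eq_zero.1 hη

/-- The discrete equation on the Fourier side: with `G = dft u`, `V = 𝓕⁻ φ`, `f = 𝓕⁻ k`, the function
`(𝓛_h - z) G` is the periodization of `k - φ * G`, restricted to the cell. -/
theorem exists_fourier_equation (hh : 0 < h) (hu : SolvesDiscrete Γ ν E₀ d₁ V z f h u) {M : ℝ}
    (hV : ∀ x, |V x| ≤ M) (F : lp (fun _ : Fin d → ℤ => Cs s) 2)
    (hF : ∀ n, F n = f (h • intVec n)) {φ : Rd d → ℂ} (hφ : Integrable φ)
    (hφV : ∀ x, 𝓕⁻ φ x = V x) {k : Rd d → Cs s} (hk : Integrable k) (hkf : 𝓕⁻ k = f) :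
    ∃ Y : Rd d → Cs s, StronglyMeasurable Y ∧
      (∀ᵐ η, Y η = symLin Γ ν E₀ d₁ h ((2 * Real.pi) • η) (dft h u η) - z • dft h u η) ∧
      ∫⁻ η, ‖Y η‖ₑ ≤ ∫⁻ η, ‖k η - conv φ (dft h u) η‖ₑ ∧
      ∫⁻ η, ‖Y η - (k η - conv φ (dft h u) η)‖ₑ
        ≤ 2 * ∫⁻ η in (tile d h⁻¹)ᶜ, ‖k η - conv φ (dft h u) η‖ₑ := by
  obtain ⟨W, hW, hy⟩ := exists_kinetic hu hV F hF
  have hG := integrable_dft hh u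
  have hc := integrable_conv hφ hG
  -- `f_h - V_h u` consists of samples of the function `f - V ũ_h` on `ℝᵈ`, the inverse transform of
  -- `k - φ * G`. This is what brings in the aliasing estimates.
  have hlat : ∀ n, (F - W) n = 𝓕⁻ (k - conv φ (dft h u)) (h • intVec n) := fun n => by
    rw [fourierInv_sub_apply hk hc, fourierInv_conv hφ hG, hkf, hφV, fourierInv_dft_lattice hh,
      lp_sub_apply, hF, hW]
  refine ⟨dft h (F - W), stronglyMeasurable_dft h _, ?_, lintegral_dft_le hh (hk.sub hc) _ hlat,
    lintegral_dft_sub_le hh (hk.sub hc) _ hlat⟩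
  filter_upwards [dft_laplacianDisc hh Γ ν E₀ d₁ u _ hy, dft_sub_smul_ae_eq hh (F - W) u z]
    with η h1 h2
  rw [h2, h1]

end Discrete

/-! ### Estimates of convolutions -/

section ConvEstimates

variable {F : Type*} [NormedAddCommGroup F] [NormedSpace ℂ F]

theorem memLp_comp_sub_left {φ : Rd d → ℂ} (hφ : MemLp φ 2) (η : Rd d) :
    MemLp (fun ζ => φ (η - ζ)) 2 :=
  hφ.comp_measurePreserving (Measure.measurePreserving_sub_left volume η)

theorem enorm_integral_smul_le {ψ : Rd d → ℂ} {G : Rd d → F} (hψ : MemLp ψ 2) (hG : MemLp G 2) :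
    ‖∫ ζ, ψ ζ • G ζ‖ₑ ≤ eLpNorm ψ 2 * eLpNorm G 2 := by
  refine (enorm_integral_le_lintegral_enorm _).trans ?_
  have := eLpNorm_smul_le_mul_eLpNorm (p := 2) (q := 2) (r := 1) hG.1 hψ.1
  rwa [eLpNorm_one_eq_lintegral_enorm] at this

theorem enorm_conv_le {φ : Rd d → ℂ} {G : Rd d → F} (hφ : MemLp φ 2) (hG : MemLp G 2) (η : Rd d) :
    ‖conv φ G η‖ₑ ≤ eLpNorm φ 2 * eLpNorm G 2 := by
  rw [conv_apply]
  refine (enorm_integral_smul_le (memLp_comp_sub_left hφ η) hG).trans (le_of_eq ?_)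
  congr 1
  exact eLpNorm_comp_measurePreserving hφ.1 (Measure.measurePreserving_sub_left volume η)

theorem lintegral_lintegral_sub_mul {a b : Rd d → ENNReal} (ha : Measurable a) (hb : Measurable b) :
    ∫⁻ η, ∫⁻ ζ, a (η - ζ) * b ζ = (∫⁻ η, a η) * ∫⁻ ζ, b ζ := by
  rw [lintegral_lintegral_swap (by fun_prop)]
  calc ∫⁻ ζ, ∫⁻ η, a (η - ζ) * b ζ = ∫⁻ ζ, (∫⁻ η, a η) * b ζ := by
        refine lintegral_congr fun ζ => ?_
        rw [lintegral_mul_const _ (by fun_prop), lintegral_sub_right_eq_self]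
    _ = _ := lintegral_const_mul _ hb

theorem enorm_conv_le_lintegral (φ : Rd d → ℂ) (G : Rd d → F) (η : Rd d) :
    ‖conv φ G η‖ₑ ≤ ∫⁻ ζ, ‖φ (η - ζ)‖ₑ * ‖G ζ‖ₑ := by
  rw [conv_apply]
  refine (enorm_integral_le_lintegral_enorm _).trans (le_of_eq ?_)
  simp_rw [enorm_smul]

theorem lintegral_conv_le {φ : Rd d → ℂ} {G : Rd d → F} (hφ : StronglyMeasurable φ)
    (hG : StronglyMeasurable G) :
    ∫⁻ η, ‖conv φ G η‖ₑ ≤ (∫⁻ η, ‖φ η‖ₑ) * ∫⁻ ζ, ‖G ζ‖ₑ := by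
  rw [← lintegral_lintegral_sub_mul hφ.enorm hG.enorm]
  exact lintegral_mono fun η => enorm_conv_le_lintegral φ G η

theorem measurableSet_norm_ge (R : ℝ) : MeasurableSet {η : Rd d | R ≤ ‖η‖} :=
  (isClosed_le continuous_const continuous_norm).measurableSet

/-- The tail of a convolution. -/
theorem lintegral_conv_tail_le {φ : Rd d → ℂ} {G : Rd d → F} (hφ : StronglyMeasurable φ)
    (hG : StronglyMeasurable G) (R : ℝ) :
    ∫⁻ η in {η | 2 * R ≤ ‖η‖}, ‖conv φ G η‖ₑ
      ≤ (∫⁻ η in {η | R ≤ ‖η‖}, ‖φ η‖ₑ) * (∫⁻ ζ, ‖G ζ‖ₑ)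
        + (∫⁻ η, ‖φ η‖ₑ) * ∫⁻ ζ in {η | R ≤ ‖η‖}, ‖G ζ‖ₑ := by
  set B := {η : Rd d | R ≤ ‖η‖}
  have hB : MeasurableSet B := measurableSet_norm_ge R
  have h1 := hφ.enorm
  have h2 := hG.enorm
  have h3 : Measurable (B.indicator fun η => ‖φ η‖ₑ) := h1.indicator hB
  have h4 : Measurable (B.indicator fun η => ‖G η‖ₑ) := h2.indicator hB
  rw [← lintegral_indicator hB, ← lintegral_indicator hB, ← lintegral_lintegral_sub_mul h3 h2,
    ← lintegral_lintegral_sub_mul h1 h4, ← lintegral_add_left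
      (Measurable.lintegral_prod_right' (f := fun p : Rd d × Rd d =>
        B.indicator (fun η => ‖φ η‖ₑ) (p.1 - p.2) * ‖G p.2‖ₑ) (by fun_prop))]
  refine (setLIntegral_mono' (measurableSet_norm_ge _) fun η hη => ?_).trans
    (setLIntegral_le_lintegral {η | 2 * R ≤ ‖η‖} _)
  rw [← lintegral_add_left (by fun_prop)]
  refine (enorm_conv_le_lintegral φ G η).trans (lintegral_mono fun ζ => ?_)
  -- If `‖η‖ ≥ 2R`, then `‖ζ‖ ≥ R` or `‖η - ζ‖ ≥ R`.
  by_cases hζ : ζ ∈ B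
  · rw [Set.indicator_of_mem hζ]
    exact le_add_self
  · have : η - ζ ∈ B := by
      have hη' : 2 * R ≤ ‖η‖ := hη
      have hζ' : ‖ζ‖ < R := not_le.1 hζ
      change R ≤ ‖η - ζ‖
      have := norm_sub_norm_le η ζ
      linarith
    rw [Set.indicator_of_mem this]
    exact le_self_add

end ConvEstimates

section Tails

variable {F : Type*} [NormedAddCommGroup F]

theorem tendsto_tail {G : Rd d → F} (hG : Integrable G) :
    Tendsto (fun R : ℝ => ∫⁻ η in {η | R ≤ ‖η‖}, ‖G η‖ₑ) atTop (𝓝 0) := by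
  simp_rw [← lintegral_indicator (measurableSet_norm_ge _)]
  have := tendsto_lintegral_filter_of_dominated_convergence' (μ := (volume : Measure (Rd d)))
    (l := atTop) (F := fun R : ℝ => {η : Rd d | R ≤ ‖η‖}.indicator fun η => ‖G η‖ₑ)
    (f := fun _ => 0) (fun η => ‖G η‖ₑ)
    (Eventually.of_forall fun R => hG.1.enorm.indicator (measurableSet_norm_ge R))
    (Eventually.of_forall fun R => Eventually.of_forall fun η => Set.indicator_le_self _ _ _)
    hG.2.ne (Eventually.of_forall fun η => ?_)
  · simpa using this
  · refine tendsto_const_nhds.congr' ?_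
    filter_upwards [eventually_gt_atTop ‖η‖] with R hR
    rw [Set.indicator_of_notMem]
    exact not_le.2 hR

/-- Vitali's theorem in a simple case. -/
theorem tendsto_lintegral_sub_of_tight {c : ℕ → Rd d → F} {c₀ : Rd d → F}
    (hc : ∀ n, AEStronglyMeasurable (c n)) (hlim : ∀ η, Tendsto (fun n => c n η) atTop (𝓝 (c₀ η)))
    {M : ENNReal} (hM : M ≠ ⊤) (hb : ∀ n η, ‖c n η‖ₑ ≤ M)
    (htight : ∀ ε : ENNReal, 0 < ε → ∃ R : ℝ, ∀ n, ∫⁻ η in {η | R ≤ ‖η‖}, ‖c n η‖ₑ ≤ ε) :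
    Tendsto (fun n => ∫⁻ η, ‖c n η - c₀ η‖ₑ) atTop (𝓝 0) := by
  have hc₀ : AEStronglyMeasurable c₀ := aestronglyMeasurable_of_tendsto_ae atTop hc
    (Eventually.of_forall hlim)
  have hb₀ : ∀ η, ‖c₀ η‖ₑ ≤ M := fun η =>
    le_of_tendsto ((continuous_enorm.tendsto _).comp (hlim η)) (Eventually.of_forall fun n => hb n η)
  refine ENNReal.tendsto_nhds_zero.2 fun ε hε => ?_
  have hε3 : 0 < ε / 3 := ENNReal.div_pos hε.ne' (by norm_num)
  obtain ⟨R, hR⟩ := htight (ε / 3) hε3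
  set A := {η : Rd d | R ≤ ‖η‖}
  have hA : MeasurableSet A := measurableSet_norm_ge R
  -- Fatou carries the uniform tail bound over to the limit; on the remaining ball the constant
  -- bound is integrable and dominated convergence applies.
  have hR₀ : ∫⁻ η in A, ‖c₀ η‖ₑ ≤ ε / 3 := by
    refine (lintegral_mono_ae (g := fun η => liminf (fun n => ‖c n η‖ₑ) atTop)
      (Eventually.of_forall fun η => ?_)).trans ((lintegral_liminf_le' fun n => (hc n).enorm.restrict).trans
        (liminf_le_of_le (by isBoundedDefault) fun b hb => ?_))
    · exact (((continuous_enorm.tendsto _).comp (hlim η)).liminf_eq).ge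
    · obtain ⟨n, hn⟩ := hb.exists
      exact hn.trans (hR n)
  have hball : Tendsto (fun n => ∫⁻ η in Aᶜ, ‖c n η - c₀ η‖ₑ) atTop (𝓝 0) := by
    have hfin : volume (Aᶜ : Set (Rd d)) < ⊤ := by
      refine lt_of_le_of_lt (measure_mono (t := Metric.ball 0 R) fun η hη => ?_)
        measure_ball_lt_top
      simpa [A] using hη
    have := tendsto_lintegral_of_dominated_convergence' (μ := volume.restrict Aᶜ)
      (F := fun n η => ‖c n η - c₀ η‖ₑ) (f := fun _ => 0) (fun _ => M + M)
      (fun n => ((hc n).sub hc₀).enorm.restrict)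
      (fun n => Eventually.of_forall fun η => enorm_sub_le.trans (add_le_add (hb n η) (hb₀ η)))
      (by
        rw [lintegral_const, Measure.restrict_apply_univ]
        exact (ENNReal.mul_lt_top (ENNReal.add_lt_top.2 ⟨hM.lt_top, hM.lt_top⟩) hfin).ne)
      (Eventually.of_forall fun η => by
        have := ((hlim η).sub_const (c₀ η)).enorm
        simpa using this)
    simpa using this
  filter_upwards [ENNReal.tendsto_nhds_zero.1 hball _ hε3] with n hn
  rw [← lintegral_add_compl _ hA]
  have h1 : ∫⁻ η in A, ‖c n η - c₀ η‖ₑ ≤ ε / 3 + ε / 3 := by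
    refine (lintegral_mono fun η => enorm_sub_le).trans ?_
    rw [lintegral_add_left' (hc n).enorm.restrict]
    exact add_le_add (hR n) hR₀
  refine (add_le_add h1 hn).trans (le_of_eq (ENNReal.add_thirds ε))

end Tails

/-! ### Weak compactness in `L²` -/

/-- Sequential Banach-Alaoglu in the dual of a separable Hilbert space. The conjugation appears
because the Riesz map pairs in the other order. -/
theorem exists_weak_limit (g : ℕ → Lp (Cs s) 2 (volume : Measure (Rd d))) {C : ℝ}
    (hg : ∀ n, ‖g n‖ ≤ C) :
    ∃ g₀ : Lp (Cs s) 2 (volume : Measure (Rd d)), ∃ θ : ℕ → ℕ, StrictMono θ ∧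
      ∀ a, Tendsto (fun n => inner ℂ a (g (θ n))) atTop (𝓝 (inner ℂ a g₀)) := by
  let H := Lp (Cs s) 2 (volume : Measure (Rd d))
  have : Fact ((2 : ENNReal) ≠ ⊤) := ⟨by norm_num⟩
  have hsep : TopologicalSpace.SeparableSpace H := inferInstance
  have hK := WeakDual.isSeqCompact_closedBall ℂ H 0 C
  obtain ⟨T, -, θ, hθ, hT⟩ := hK (x := fun n => StrongDual.toWeakDual
    (InnerProductSpace.toDual ℂ H (g n))) (fun n => by
      simpa using hg n)
  refine ⟨(InnerProductSpace.toDual ℂ H).symm (WeakDual.toStrongDual T), θ, hθ, fun a => ?_⟩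
  have h1 := (WeakDual.eval_continuous a).tendsto T |>.comp hT
  have h2 := (Complex.continuous_conj.tendsto _).comp h1
  have h3 : ∀ x : H, inner ℂ a x = (starRingEnd ℂ) (InnerProductSpace.toDual ℂ H x a) := fun x => by
    rw [InnerProductSpace.toDual_apply_apply, inner_conj_symm]
  simp_rw [h3, LinearIsometryEquiv.apply_symm_apply]
  exact h2

/-- Each coordinate of the vector integral is an inner product with `conj ψ` times a basis vector.
The case `ψ = φ(η - ·)` gives pointwise convergence of convolutions. -/
theorem tendsto_integral_smul_of_weak {g : ℕ → Rd d → Cs s} {g₀ : Rd d → Cs s}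
    (hg : ∀ n, MemLp (g n) 2) (hg₀ : MemLp g₀ 2)
    (hw : ∀ a : Lp (Cs s) 2 (volume : Measure (Rd d)),
      Tendsto (fun n => inner ℂ a ((hg n).toLp (g n))) atTop (𝓝 (inner ℂ a (hg₀.toLp g₀))))
    {ψ : Rd d → ℂ} (hψ : MemLp ψ 2) :
    Tendsto (fun n => ∫ ζ, ψ ζ • g n ζ) atTop (𝓝 (∫ ζ, ψ ζ • g₀ ζ)) := by
  have hI : ∀ {f : Rd d → Cs s}, MemLp f 2 → Integrable fun ζ => ψ ζ • f ζ := fun hf =>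
    memLp_one_iff_integrable.1 (MemLp.smul (p := 2) (q := 2) (r := 1) hf hψ)
  have hcoord : ∀ (i : Fin s), ∃ a : Lp (Cs s) 2 (volume : Measure (Rd d)),
      ∀ (f : Rd d → Cs s) (hf : MemLp f 2), inner ℂ a (hf.toLp f) = (∫ ζ, ψ ζ • f ζ) i := by
    intro i
    have ha : MemLp (fun ζ => (starRingEnd ℂ) (ψ ζ) • EuclideanSpace.single i (1 : ℂ)) 2 := by
      refine MemLp.of_le hψ ?_ (Eventually.of_forall fun ζ => ?_)
      · exact ((Complex.continuous_conj.comp_aestronglyMeasurable hψ.1).smul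
          aestronglyMeasurable_const)
      · rw [norm_smul, RCLike.norm_conj, PiLp.norm_single, norm_one, mul_one]
    refine ⟨ha.toLp _, fun f hf => ?_⟩
    rw [L2.inner_def]
    have h1 : (∫ ζ, ψ ζ • f ζ) i = ∫ ζ, (ψ ζ • f ζ) i :=
      ((EuclideanSpace.proj i : Cs s →L[ℂ] ℂ).integral_comp_comm (hI hf)).symm
    rw [h1]
    refine integral_congr_ae ?_
    filter_upwards [ha.coeFn_toLp, hf.coeFn_toLp] with ζ h2 h3
    rw [h2, h3, inner_smul_left, EuclideanSpace.inner_single_left]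
    simp
  have h2 : Tendsto (fun n => (∫ ζ, ψ ζ • g n ζ).ofLp) atTop (𝓝 (∫ ζ, ψ ζ • g₀ ζ).ofLp) := by
    refine tendsto_pi_nhds.2 fun i => ?_
    obtain ⟨a, ha⟩ := hcoord i
    have := hw a
    simp_rw [ha] at this
    exact this
  exact ((PiLp.continuous_toLp 2 _).tendsto _).comp h2

theorem exists_weak_limit_smul {g : ℕ → Rd d → Cs s} {C : ENNReal} (hC : C ≠ ⊤)
    (hg : ∀ n, MemLp (g n) 2) (hgC : ∀ n, eLpNorm (g n) 2 ≤ C) :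
    ∃ g₀ : Rd d → Cs s, MemLp g₀ 2 ∧ ∃ θ : ℕ → ℕ, StrictMono θ ∧
      ∀ ψ : Rd d → ℂ, MemLp ψ 2 →
        Tendsto (fun n => ∫ ζ, ψ ζ • g (θ n) ζ) atTop (𝓝 (∫ ζ, ψ ζ • g₀ ζ)) := by
  obtain ⟨g₀, θ, hθ, hw⟩ := exists_weak_limit (fun n => (hg n).toLp (g n)) (C := C.toReal)
    (fun n => by rw [Lp.norm_toLp]; exact ENNReal.toReal_mono hC (hgC n))
  refine ⟨g₀, Lp.memLp g₀, θ, hθ, fun ψ hψ => ?_⟩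
  refine tendsto_integral_smul_of_weak (g := fun n => g (θ n)) (fun n => hg (θ n)) (Lp.memLp g₀)
    (fun a => ?_) hψ
  rw [Lp.toLp_coeFn]
  exact hw a

/-! ### Compactness of the solutions -/

/-- Cauchy-Schwarz on a ball: it controls the low frequencies in `L¹`. -/
theorem lintegral_ball_le {G : Rd d → Cs s} (hG : AEStronglyMeasurable G) (R : ℝ) :
    ∫⁻ η in {η | R ≤ ‖η‖}ᶜ, ‖G η‖ₑ
      ≤ eLpNorm G 2 * volume {η : Rd d | R ≤ ‖η‖}ᶜ ^ (1 / 2 : ℝ) := by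
  have h1 := eLpNorm_le_eLpNorm_mul_rpow_measure_univ (p := 1) (q := 2)
    (μ := volume.restrict {η : Rd d | R ≤ ‖η‖}ᶜ) (by norm_num) hG.restrict
  rw [eLpNorm_one_eq_lintegral_enorm, Measure.restrict_apply_univ] at h1
  refine h1.trans ?_
  have h2 : (1 / (1 : ENNReal).toReal - 1 / (2 : ENNReal).toReal) = (1 / 2 : ℝ) := by norm_num
  rw [h2]
  exact mul_le_mul_left (eLpNorm_mono_measure G Measure.restrict_le_self) _

theorem volume_compl_norm_ge_lt_top (R : ℝ) : volume {η : Rd d | R ≤ ‖η‖}ᶜ < ⊤ := by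
  refine lt_of_le_of_lt (measure_mono (t := Metric.ball 0 R) fun η hη => ?_) measure_ball_lt_top
  simpa using hη

theorem compl_tile_subset (T : ℝ) : (tile d T)ᶜ ⊆ {η : Rd d | T / 2 ≤ ‖η‖} := by
  intro η hη
  by_contra h
  refine hη fun i => ?_
  have h1 : |η i| < T / 2 := lt_of_le_of_lt (PiLp.norm_apply_le η i) (not_le.1 h)
  exact ⟨(abs_lt.1 h1).1, (abs_lt.1 h1).2.le⟩

section Compactness

variable {φ : Rd d → ℂ} {k : Rd d → Cs s} {G Y : ℕ → Rd d → Cs s} {T : ℕ → ℝ} {C : ENNReal}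

/-- Uniform `L¹` bound. -/
theorem exists_lintegral_bound (hφ : Integrable φ) (hφm : StronglyMeasurable φ)
    (hk : Integrable k) (hGm : ∀ n, StronglyMeasurable (G n)) (hGi : ∀ n, Integrable (G n))
    (hC : C ≠ ⊤) (hG2 : ∀ n, eLpNorm (G n) 2 ≤ C)
    (hhigh : ∀ ε : ENNReal, 0 < ε → ∃ R : ℝ, ∀ n, ∀ᵐ η, R ≤ ‖η‖ → ‖G n η‖ₑ ≤ ε * ‖Y n η‖ₑ)
    (hYm : ∀ n, StronglyMeasurable (Y n))
    (hY : ∀ n, ∫⁻ η, ‖Y n η‖ₑ ≤ ∫⁻ η, ‖k η - conv φ (G n) η‖ₑ) :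
    ∃ C₁ : ENNReal, C₁ ≠ ⊤ ∧ ∀ n, ∫⁻ η, ‖G n η‖ₑ ≤ C₁ ∧ ∫⁻ η, ‖Y n η‖ₑ ≤ C₁ := by
  set A := ∫⁻ η, ‖φ η‖ₑ
  set B := ∫⁻ η, ‖k η‖ₑ
  have hA : A ≠ ⊤ := hφ.2.ne
  have hB : B ≠ ⊤ := hk.2.ne
  have hYle : ∀ n, ∫⁻ η, ‖Y n η‖ₑ ≤ B + A * ∫⁻ η, ‖G n η‖ₑ := fun n => by
    refine (hY n).trans ((lintegral_mono fun η => enorm_sub_le).trans ?_)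
    rw [lintegral_add_left' hk.1.enorm]
    gcongr
    exact lintegral_conv_le hφm (hGm n)
  -- With this constant the high frequencies contribute at most half of `∫ ‖G n‖`, since `∫ ‖Y n‖`
  -- grows with slope `A` in `∫ ‖G n‖`. That half is absorbed on the left.
  have hε : 0 < (2 * (A + 1))⁻¹ := ENNReal.inv_pos.2 (by finiteness)
  obtain ⟨R, hR⟩ := hhigh _ hε
  set S := {η : Rd d | R ≤ ‖η‖}
  set D : ENNReal := C * volume Sᶜ ^ (1 / 2 : ℝ) + B
  have hD : D ≠ ⊤ := by
    have := volume_compl_norm_ge_lt_top (d := d) R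
    have h2 : volume Sᶜ ^ (1 / 2 : ℝ) ≠ ⊤ := ENNReal.rpow_ne_top_of_nonneg (by norm_num) this.ne
    finiteness
  have hGle : ∀ n, ∫⁻ η, ‖G n η‖ₑ ≤ 2 * D := fun n => by
    have h1 : ∫⁻ η, ‖G n η‖ₑ ≤ D + 2⁻¹ * ∫⁻ η, ‖G n η‖ₑ := by
      have h2 : ∫⁻ η in S, ‖G n η‖ₑ ≤ (2 * (A + 1))⁻¹ * ∫⁻ η, ‖Y n η‖ₑ := by
        calc ∫⁻ η in S, ‖G n η‖ₑ ≤ ∫⁻ η in S, (2 * (A + 1))⁻¹ * ‖Y n η‖ₑ := by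
              refine lintegral_mono_ae ((ae_restrict_iff' (measurableSet_norm_ge R)).2 ?_)
              exact hR n
          _ ≤ ∫⁻ η, (2 * (A + 1))⁻¹ * ‖Y n η‖ₑ := setLIntegral_le_lintegral _ _
          _ = _ := lintegral_const_mul _ (hYm n).enorm
      have h3 : (2 * (A + 1))⁻¹ * ∫⁻ η, ‖Y n η‖ₑ ≤ B + 2⁻¹ * ∫⁻ η, ‖G n η‖ₑ := by
        refine (mul_le_mul_right (hYle n) _).trans ?_
        rw [mul_add, ← mul_assoc]
        gcongr
        · refine (mul_le_mul_left (ENNReal.inv_le_one.2 ?_) B).trans (one_mul B).le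
          calc (1 : ENNReal) ≤ 2 * 1 := by norm_num
            _ ≤ 2 * (A + 1) := by gcongr; exact le_add_self
        · rw [ENNReal.mul_inv (by norm_num) (by norm_num), mul_assoc]
          refine (mul_le_mul_right ?_ _).trans (mul_one _).le
          rw [mul_comm, ← div_eq_mul_inv]
          exact ENNReal.div_le_of_le_mul (by rw [one_mul]; exact le_self_add)
      have h4 : ∫⁻ η in Sᶜ, ‖G n η‖ₑ ≤ C * volume Sᶜ ^ (1 / 2 : ℝ) :=
        (lintegral_ball_le (hGm n).aestronglyMeasurable R).trans (by gcongr; exact hG2 n)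
      calc ∫⁻ η, ‖G n η‖ₑ = (∫⁻ η in S, ‖G n η‖ₑ) + ∫⁻ η in Sᶜ, ‖G n η‖ₑ :=
            (lintegral_add_compl _ (measurableSet_norm_ge R)).symm
        _ ≤ (B + 2⁻¹ * ∫⁻ η, ‖G n η‖ₑ) + C * volume Sᶜ ^ (1 / 2 : ℝ) :=
            add_le_add (h2.trans h3) h4
        _ = _ := by simp only [D]; ring
    -- Absorption needs finiteness of the norm beforehand, for each `n` separately.
    have hfin : ∫⁻ η, ‖G n η‖ₑ ≠ ⊤ := (hGi n).2.ne
    have h5 : 2 * ∫⁻ η, ‖G n η‖ₑ ≤ 2 * D + ∫⁻ η, ‖G n η‖ₑ := by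
      calc 2 * ∫⁻ η, ‖G n η‖ₑ ≤ 2 * (D + 2⁻¹ * ∫⁻ η, ‖G n η‖ₑ) := by gcongr
        _ = _ := by
          rw [mul_add, ← mul_assoc, ENNReal.mul_inv_cancel (by norm_num) (by norm_num), one_mul]
    rw [two_mul] at h5
    exact (ENNReal.add_le_add_iff_right hfin).1 h5
  refine ⟨2 * D + (B + A * (2 * D)), by finiteness, fun n => ⟨(hGle n).trans le_self_add,
    (hYle n).trans ?_⟩⟩
  refine le_trans ?_ le_add_self
  gcongr
  exact hGle n

/-- Uniform decay of the convolutions at infinity. -/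
theorem exists_conv_tail_le (hφ : Integrable φ) (hφm : StronglyMeasurable φ)
    (hGm : ∀ n, StronglyMeasurable (G n)) (hYm : ∀ n, StronglyMeasurable (Y n))
    (hhigh : ∀ ε : ENNReal, 0 < ε → ∃ R : ℝ, ∀ n, ∀ᵐ η, R ≤ ‖η‖ → ‖G n η‖ₑ ≤ ε * ‖Y n η‖ₑ)
    {C₁ : ENNReal} (hC₁ : C₁ ≠ ⊤) (hG1 : ∀ n, ∫⁻ η, ‖G n η‖ₑ ≤ C₁)
    (hY1 : ∀ n, ∫⁻ η, ‖Y n η‖ₑ ≤ C₁) {ε : ENNReal} (hε : 0 < ε) :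
    ∃ R : ℝ, ∀ n, ∫⁻ η in {η | R ≤ ‖η‖}, ‖conv φ (G n) η‖ₑ ≤ ε := by
  set A := ∫⁻ η, ‖φ η‖ₑ
  have hA : A ≠ ⊤ := hφ.2.ne
  have hε2 : 0 < ε / 2 := ENNReal.half_pos hε.ne'
  -- The tail of `G n` is then at most this constant times `C₁`, and its product with `A` at most `ε
  -- / 2`; the summand `1` guards against a zero denominator.
  have hδ : 0 < (ε / 2) / (A * C₁ + 1) := ENNReal.div_pos hε2.ne' (by finiteness)
  obtain ⟨R₁, hR₁⟩ := hhigh _ hδ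
  have h1 : Tendsto (fun R : ℝ => (∫⁻ η in {η | R ≤ ‖η‖}, ‖φ η‖ₑ) * C₁) atTop (𝓝 0) := by
    have := ENNReal.Tendsto.mul_const (tendsto_tail hφ) (Or.inr hC₁ : (0 : ENNReal) ≠ 0 ∨ C₁ ≠ ⊤)
    rwa [zero_mul] at this
  obtain ⟨R, hR, hR2⟩ := ((ENNReal.tendsto_nhds_zero.1 h1 _ hε2).and
    (eventually_ge_atTop R₁)).exists
  refine ⟨2 * R, fun n => (lintegral_conv_tail_le hφm (hGm n) R).trans ?_⟩
  rw [← ENNReal.add_halves ε]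
  refine add_le_add (le_trans ?_ hR) ?_
  · gcongr
    exact hG1 n
  · have h2 : ∫⁻ ζ in {η | R ≤ ‖η‖}, ‖G n ζ‖ₑ ≤ (ε / 2) / (A * C₁ + 1) * C₁ := by
      calc ∫⁻ ζ in {η | R ≤ ‖η‖}, ‖G n ζ‖ₑ
          ≤ ∫⁻ ζ in {η | R ≤ ‖η‖}, (ε / 2) / (A * C₁ + 1) * ‖Y n ζ‖ₑ := by
            refine lintegral_mono_ae ((ae_restrict_iff' (measurableSet_norm_ge R)).2 ?_)
            filter_upwards [hR₁ n] with η hη hη2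
            exact hη (hR2.trans hη2)
        _ ≤ ∫⁻ ζ, (ε / 2) / (A * C₁ + 1) * ‖Y n ζ‖ₑ := setLIntegral_le_lintegral _ _
        _ = (ε / 2) / (A * C₁ + 1) * ∫⁻ ζ, ‖Y n ζ‖ₑ := lintegral_const_mul _ (hYm n).enorm
        _ ≤ _ := by gcongr; exact hY1 n
    calc A * ∫⁻ ζ in {η | R ≤ ‖η‖}, ‖G n ζ‖ₑ ≤ A * ((ε / 2) / (A * C₁ + 1) * C₁) := by gcongr
      _ = (ε / 2) / (A * C₁ + 1) * (A * C₁) := by ring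
      _ ≤ (ε / 2) / (A * C₁ + 1) * (A * C₁ + 1) := by gcongr; exact le_self_add
      _ = ε / 2 := ENNReal.div_mul_cancel (by simp) (by finiteness)

theorem integrable_of_tendsto_lintegral_sub {F : Type*} [NormedAddCommGroup F] {c : ℕ → Rd d → F}
    {c₀ : Rd d → F} (hc : ∀ n, Integrable (c n)) (hc₀ : AEStronglyMeasurable c₀)
    (h : Tendsto (fun n => ∫⁻ η, ‖c n η - c₀ η‖ₑ) atTop (𝓝 0)) : Integrable c₀ := by
  refine ⟨hc₀, ?_⟩
  obtain ⟨n, hn⟩ := (ENNReal.tendsto_nhds_zero.1 h 1 one_pos).exists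
  have h1 : ∫⁻ η, ‖c₀ η‖ₑ ≤ (∫⁻ η, ‖c n η‖ₑ) + ∫⁻ η, ‖c n η - c₀ η‖ₑ := by
    rw [← lintegral_add_left' (hc _).1.enorm]
    refine lintegral_mono fun η => ?_
    have := enorm_sub_le (a := c n η) (b := c n η - c₀ η)
    rwa [sub_sub_cancel] at this
  exact lt_of_le_of_lt (h1.trans (add_le_add le_rfl hn))
    (ENNReal.add_lt_top.2 ⟨(hc _).2, ENNReal.one_lt_top⟩)

/-- The cells eventually contain any fixed ball, while the tails of `k` and, uniformly in `n`, of `c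
n` are small; so the aliasing error disappears. -/
theorem tendsto_lintegral_of_cell_estimate {c Y : ℕ → Rd d → Cs s} (hk : Integrable k)
    (hT : Tendsto T atTop atTop)
    (htail : ∀ ε : ENNReal, 0 < ε → ∃ R : ℝ, ∀ n, ∫⁻ η in {η | R ≤ ‖η‖}, ‖c n η‖ₑ ≤ ε)
    (hYk : ∀ n, ∫⁻ η, ‖Y n η - (k η - c n η)‖ₑ
      ≤ 2 * ∫⁻ η in (tile d (T n))ᶜ, ‖k η - c n η‖ₑ) :
    Tendsto (fun n => ∫⁻ η, ‖Y n η - (k η - c n η)‖ₑ) atTop (𝓝 0) := by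
  refine ENNReal.tendsto_nhds_zero.2 fun ε hε => ?_
  have hε4 : 0 < ε / 2 / 2 := ENNReal.half_pos (ENNReal.half_pos hε.ne').ne'
  obtain ⟨R, hR⟩ := htail _ hε4
  obtain ⟨R', hR', hRR'⟩ := ((ENNReal.tendsto_nhds_zero.1 (tendsto_tail hk) _ hε4).and
    (eventually_ge_atTop R)).exists
  filter_upwards [hT.eventually_ge_atTop (2 * R')] with n hn
  refine (hYk n).trans ?_
  have hsub : (tile d (T n))ᶜ ⊆ {η : Rd d | R' ≤ ‖η‖} := fun η hη => by
    have : T n / 2 ≤ ‖η‖ := compl_tile_subset _ hη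
    change R' ≤ ‖η‖
    linarith
  calc 2 * ∫⁻ η in (tile d (T n))ᶜ, ‖k η - c n η‖ₑ
      ≤ 2 * ∫⁻ η in {η | R' ≤ ‖η‖}, ‖k η‖ₑ + ‖c n η‖ₑ :=
        mul_le_mul_right ((lintegral_mono_set hsub).trans
          (lintegral_mono fun η => enorm_sub_le)) _
    _ = 2 * ((∫⁻ η in {η | R' ≤ ‖η‖}, ‖k η‖ₑ) + ∫⁻ η in {η | R' ≤ ‖η‖}, ‖c n η‖ₑ) := by
        rw [lintegral_add_left' hk.1.enorm.restrict]
    _ ≤ 2 * (ε / 2 / 2 + ε / 2 / 2) :=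
        mul_le_mul_right (add_le_add hR' ((lintegral_mono_set
          fun η (hη : R' ≤ ‖η‖) => hRR'.trans hη).trans (hR n))) _
    _ = ε := by
        rw [ENNReal.add_halves, ENNReal.mul_div_cancel (by norm_num) (by norm_num)]

/-- Convolution with `φ ∈ L²` upgrades weak convergence: the convolutions converge pointwise, are
uniformly bounded and are tight, hence converge in `L¹`. Then `Y n` converges strongly although `G
n` is so far only known to converge weakly. -/
theorem exists_subseq_limit (hφ : Integrable φ) (hφm : StronglyMeasurable φ) (hφ2 : MemLp φ 2)
    (hk : Integrable k) (hGm : ∀ n, StronglyMeasurable (G n)) (hGi : ∀ n, Integrable (G n))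
    (hC : C ≠ ⊤) (hG2 : ∀ n, eLpNorm (G n) 2 ≤ C)
    (hhigh : ∀ ε : ENNReal, 0 < ε → ∃ R : ℝ, ∀ n, ∀ᵐ η, R ≤ ‖η‖ → ‖G n η‖ₑ ≤ ε * ‖Y n η‖ₑ)
    (hYm : ∀ n, StronglyMeasurable (Y n))
    (hY : ∀ n, ∫⁻ η, ‖Y n η‖ₑ ≤ ∫⁻ η, ‖k η - conv φ (G n) η‖ₑ) (hT : Tendsto T atTop atTop)
    (hYk : ∀ n, ∫⁻ η, ‖Y n η - (k η - conv φ (G n) η)‖ₑ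
      ≤ 2 * ∫⁻ η in (tile d (T n))ᶜ, ‖k η - conv φ (G n) η‖ₑ) :
    ∃ θ : ℕ → ℕ, StrictMono θ ∧ ∃ G₀ : Rd d → Cs s, MemLp G₀ 2 ∧ Integrable (conv φ G₀) ∧
      Tendsto (fun n => ∫⁻ η, ‖Y (θ n) η - (k η - conv φ G₀ η)‖ₑ) atTop (𝓝 0) ∧
      ∀ ψ : Rd d → ℂ, MemLp ψ 2 →
        Tendsto (fun n => ∫ η, ψ η • G (θ n) η) atTop (𝓝 (∫ η, ψ η • G₀ η)) := by
  obtain ⟨C₁, hC₁, hb⟩ := exists_lintegral_bound hφ hφm hk hGm hGi hC hG2 hhigh hYm hY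
  have hmem : ∀ n, MemLp (G n) 2 := fun n =>
    ⟨(hGm n).aestronglyMeasurable, lt_of_le_of_lt (hG2 n) hC.lt_top⟩
  obtain ⟨g₀, hg₀, θ, hθ, hweak⟩ := exists_weak_limit_smul hC hmem hG2
  have hci : ∀ n, Integrable (conv φ (G n)) := fun n => integrable_conv hφ (hGi n)
  have hlim : ∀ η, Tendsto (fun n => conv φ (G (θ n)) η) atTop (𝓝 (conv φ g₀ η)) := fun η => by
    simp_rw [conv_apply]
    exact hweak _ (memLp_comp_sub_left hφ2 η)
  have htail := fun (ε : ENNReal) (hε : 0 < ε) => exists_conv_tail_le hφ hφm hGm hYm hhigh hC₁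
    (fun n => (hb n).1) (fun n => (hb n).2) hε
  have hcM : ∀ n η, ‖conv φ (G (θ n)) η‖ₑ ≤ eLpNorm φ 2 * C := fun n η =>
    (enorm_conv_le hφ2 (hmem _) η).trans (mul_le_mul_right (hG2 _) _)
  have htail' : ∀ ε : ENNReal, 0 < ε →
      ∃ R : ℝ, ∀ n, ∫⁻ η in {η | R ≤ ‖η‖}, ‖conv φ (G (θ n)) η‖ₑ ≤ ε := fun ε hε => by
    obtain ⟨R, hR⟩ := htail ε hε
    exact ⟨R, fun n => hR (θ n)⟩
  have hL1 : Tendsto (fun n => ∫⁻ η, ‖conv φ (G (θ n)) η - conv φ g₀ η‖ₑ) atTop (𝓝 0) :=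
    tendsto_lintegral_sub_of_tight (c := fun n => conv φ (G (θ n))) (fun n => (hci (θ n)).1) hlim
      (ENNReal.mul_ne_top hφ2.2.ne hC) hcM htail'
  have hc₀m : AEStronglyMeasurable (conv φ g₀) := aestronglyMeasurable_of_tendsto_ae atTop
    (fun n => (hci (θ n)).1) (Eventually.of_forall hlim)
  have hc₀ : Integrable (conv φ g₀) :=
    integrable_of_tendsto_lintegral_sub (fun n => hci (θ n)) hc₀m hL1
  have hcell := tendsto_lintegral_of_cell_estimate (c := fun n => conv φ (G (θ n)))
    (Y := fun n => Y (θ n)) hk (hT.comp hθ.tendsto_atTop)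
    htail' (fun n => hYk (θ n))
  refine ⟨θ, hθ, g₀, hg₀, hc₀, ?_, hweak⟩
  refine tendsto_of_tendsto_of_tendsto_of_le_of_le tendsto_const_nhds
    (by simpa using hcell.add hL1) (fun n => zero_le) fun n => ?_
  have hm : AEMeasurable fun η => ‖Y (θ n) η - (k η - conv φ (G (θ n)) η)‖ₑ :=
    ((hYm (θ n)).aestronglyMeasurable.sub (hk.1.sub (hci (θ n)).1)).enorm
  change _ ≤ (∫⁻ η, ‖Y (θ n) η - (k η - conv φ (G (θ n)) η)‖ₑ) + ∫⁻ η, _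
  rw [← lintegral_add_left' hm]
  refine lintegral_mono fun η => ?_
  have := enorm_sub_le (a := Y (θ n) η - (k η - conv φ (G (θ n)) η))
    (b := conv φ (G (θ n)) η - conv φ g₀ η)
  refine le_trans (le_of_eq ?_) this
  congr 1
  abel

end Compactness

/-! ### The resolvent of the symbol -/

/-- Schwartz functions are both bounded and square integrable, so they may be tested against either
mode of convergence. -/
theorem ae_eq_of_tendsto_of_weak {F : Type*} [NormedAddCommGroup F] [NormedSpace ℂ F]
    [CompleteSpace F] {G : ℕ → Rd d → F} {G₀ N : Rd d → F} (hG : ∀ n, Integrable (G n))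
    (hG₀ : MemLp G₀ 2) (hN : Integrable N)
    (h : Tendsto (fun n => ∫⁻ η, ‖G n η - N η‖ₑ) atTop (𝓝 0))
    (hw : ∀ ψ : Rd d → ℂ, MemLp ψ 2 →
      Tendsto (fun n => ∫ η, ψ η • G n η) atTop (𝓝 (∫ η, ψ η • G₀ η))) :
    G₀ =ᵐ[volume] N := by
  refine ae_eq_of_integral_schwartz_smul_eq (hG₀.locallyIntegrable (by norm_num))
    hN.locallyIntegrable fun ψ => ?_
  set B := SchwartzMap.seminorm ℝ 0 0 ψ
  have hB : ∀ η, ‖ψ η‖ ≤ B := fun η => ψ.norm_le_seminorm ℝ η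
  have hI : ∀ {f : Rd d → F}, Integrable f → Integrable fun η => ψ η • f η := fun hf =>
    Integrable.bdd_smul (𝕜 := ℂ) hf B ψ.continuous.aestronglyMeasurable (Eventually.of_forall hB)
  refine tendsto_nhds_unique (hw ψ (ψ.memLp 2 volume)) ?_
  refine tendsto_integral_of_L1 _ (hI hN).1 (Eventually.of_forall fun n => hI (hG n)) ?_
  have h2 : Tendsto (fun n => ENNReal.ofReal B * ∫⁻ η, ‖G n η - N η‖ₑ) atTop (𝓝 0) := by
    have := ENNReal.Tendsto.const_mul h (Or.inr ENNReal.ofReal_ne_top : _ ∨ ENNReal.ofReal B ≠ ⊤)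
    rwa [mul_zero] at this
  refine tendsto_of_tendsto_of_tendsto_of_le_of_le tendsto_const_nhds h2 (fun n => zero_le)
    fun n => ?_
  rw [← lintegral_const_mul' _ _ ENNReal.ofReal_ne_top]
  refine lintegral_mono fun η => ?_
  rw [← smul_sub, enorm_smul, ← ofReal_norm (ψ η)]
  gcongr
  exact hB η

/-- The resolvent `(𝓛_h(2πη + d_h) - z)⁻¹`. -/
def resolv (Γ : PeriodicGraph d s) (ν E₀ : ℝ) (d₁ : Rd d) (z : ℂ) (h : ℝ) (η : Rd d) :
    Cs s →ₗ[ℂ] Cs s :=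
  Matrix.toEuclideanLin ((symbolH Γ ν E₀ h ((2 * Real.pi) • η + h⁻¹ • d₁)
    - z • (1 : Matrix (Fin s) (Fin s) ℂ))⁻¹)

section Resolvent

variable {Γ : PeriodicGraph d s} {ν E₀ : ℝ} {d₁ : Rd d} {z : ℂ}

theorem toEuclideanLin_mul_apply (A B : Matrix (Fin s) (Fin s) ℂ) (x : Cs s) :
    Matrix.toEuclideanLin (A * B) x = Matrix.toEuclideanLin A (Matrix.toEuclideanLin B x) := by
  ext i
  simp [Matrix.toLpLin_apply, Matrix.mulVec_mulVec]

theorem toEuclideanLin_one_apply (x : Cs s) :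
    Matrix.toEuclideanLin (1 : Matrix (Fin s) (Fin s) ℂ) x = x := by
  ext i
  simp

theorem toEuclideanLin_sub_smul_one_apply (A : Matrix (Fin s) (Fin s) ℂ) (x : Cs s) :
    Matrix.toEuclideanLin (A - z • (1 : Matrix (Fin s) (Fin s) ℂ)) x
      = Matrix.toEuclideanLin A x - z • x := by
  rw [map_sub, map_smul, LinearMap.sub_apply, LinearMap.smul_apply, toEuclideanLin_one_apply]

theorem det_symbolH_sub_ne_zero (hz : z.im ≠ 0) (h : ℝ) (η : Rd d) :
    (symbolH Γ ν E₀ h η - z • (1 : Matrix (Fin s) (Fin s) ℂ)).det ≠ 0 := by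
  intro h0
  obtain ⟨v, hv, hv0⟩ := Matrix.exists_mulVec_eq_zero_iff.2 h0
  have h1 := abs_im_mul_norm_le (isSymmetric_symbolH Γ ν E₀ h η) z (WithLp.toLp 2 v)
  rw [← toEuclideanLin_sub_smul_one_apply, Matrix.toLpLin_toLp, Matrix.toLin'_apply, hv0,
    WithLp.toLp_zero, norm_zero] at h1
  have h2 : 0 < |z.im| := abs_pos.2 hz
  have h3 : ‖(WithLp.toLp 2 v : Cs s)‖ ≤ 0 := by
    by_contra h4
    exact absurd h1 (not_le.2 (mul_pos h2 (not_le.1 h4)))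
  exact hv ((WithLp.toLp_eq_zero 2).1 (norm_le_zero_iff.1 h3))

theorem resolv_right (hz : z.im ≠ 0) (h : ℝ) (η : Rd d) (x : Cs s) :
    symLin Γ ν E₀ d₁ h ((2 * Real.pi) • η) (resolv Γ ν E₀ d₁ z h η x)
      - z • resolv Γ ν E₀ d₁ z h η x = x := by
  rw [symLin, ← toEuclideanLin_sub_smul_one_apply, resolv, ← toEuclideanLin_mul_apply,
    Matrix.mul_nonsing_inv _ (det_symbolH_sub_ne_zero hz _ _).isUnit, toEuclideanLin_one_apply]

theorem resolv_left (hz : z.im ≠ 0) (h : ℝ) (η : Rd d) (x : Cs s) :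
    resolv Γ ν E₀ d₁ z h η (symLin Γ ν E₀ d₁ h ((2 * Real.pi) • η) x - z • x) = x := by
  rw [symLin, ← toEuclideanLin_sub_smul_one_apply, resolv, ← toEuclideanLin_mul_apply,
    Matrix.nonsing_inv_mul _ (det_symbolH_sub_ne_zero hz _ _).isUnit, toEuclideanLin_one_apply]

theorem norm_resolv_le (hz : z.im ≠ 0) (h : ℝ) (η : Rd d) (x : Cs s) :
    ‖resolv Γ ν E₀ d₁ z h η x‖ ≤ |z.im|⁻¹ * ‖x‖ := by
  have h1 := abs_im_mul_norm_le (isSymmetric_symbolH Γ ν E₀ h ((2 * Real.pi) • η + h⁻¹ • d₁)) z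
    (resolv Γ ν E₀ d₁ z h η x)
  have h2 := resolv_right (Γ := Γ) (ν := ν) (E₀ := E₀) (d₁ := d₁) hz h η x
  rw [symLin] at h2
  rw [h2] at h1
  rwa [← div_eq_inv_mul, le_div_iff₀' (abs_pos.2 hz)]

theorem continuous_resolv (hz : z.im ≠ 0) (h : ℝ) :
    Continuous fun p : Rd d × Cs s => resolv Γ ν E₀ d₁ z h p.1 p.2 := by
  unfold resolv
  refine continuous_toEuclideanLin ?_ continuous_snd
  have h1 : Continuous fun p : Rd d × Cs s =>
      symbolH Γ ν E₀ h ((2 * Real.pi) • p.1 + h⁻¹ • d₁) - z • (1 : Matrix (Fin s) (Fin s) ℂ) :=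
    ((continuous_symbolH Γ ν E₀ h).comp (by fun_prop)).sub continuous_const
  simp_rw [Matrix.inv_def, Ring.inverse_eq_inv']
  exact (h1.matrix_det.inv₀ fun p => det_symbolH_sub_ne_zero hz _ _).smul h1.matrix_adjugate

theorem aestronglyMeasurable_resolv (hz : z.im ≠ 0) (h : ℝ) {g : Rd d → Cs s}
    (hg : AEStronglyMeasurable g) :
    AEStronglyMeasurable fun η => resolv Γ ν E₀ d₁ z h η (g η) := by
  have h1 : AEStronglyMeasurable fun η => (η, g η) :=
    aestronglyMeasurable_id.prodMk hg
  exact Continuous.comp_aestronglyMeasurable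
    (g := fun p : Rd d × Cs s => resolv Γ ν E₀ d₁ z h p.1 p.2) (f := fun η => (η, g η))
    (continuous_resolv hz h) h1

variable {j : Fin s} {K₀ : Set (Rd d)} {P : Rd d → ℝ} {Pi₀ : Rd d → Matrix (Fin s) (Fin s) ℂ}
  {Q : Matrix (Fin s) (Fin s) ℂ}

/-- The limit `(P(2πη) - z)⁻¹ Q` of the resolvents. -/
def limitResolv (P : Rd d → ℝ) (Q : Matrix (Fin s) (Fin s) ℂ) (z : ℂ) (η : Rd d) (x : Cs s) :
    Cs s :=
  ((P ((2 * Real.pi) • η) : ℂ) - z)⁻¹ • Matrix.toEuclideanLin Q x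

theorem tendsto_resolv (hν : 0 < ν) (hB3 : HypB3 Γ ν E₀ j K₀ d₁ P)
    (hB4 : HypB4 Γ ν E₀ {j} d₁ Pi₀) (hC2 : HypC2 Γ E₀ j) (hQ : ∀ ξ, ξ ≠ 0 → Pi₀ ξ = Q)
    (hz : z.im ≠ 0) {η : Rd d} (hη : η ≠ 0) (x : Cs s) :
    Tendsto (fun h => resolv Γ ν E₀ d₁ z h η x) (𝓝[>] 0) (𝓝 (limitResolv P Q z η x)) := by
  have hη' : (2 * Real.pi) • η ≠ 0 := smul_ne_zero (by positivity) hη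
  have := tendsto_resolvent hν hB3 hB4 hC2 hz hη' (v := x)
    (x := fun h => resolv Γ ν E₀ d₁ z h η x)
    (Eventually.of_forall fun h => resolv_right hz h η x)
  rwa [hQ _ hη'] at this

/-- Write the difference as `R_h (Y - g) + (R_h - R₀) g`. The uniform bound `|Im z|⁻¹` handles the
first term, dominated convergence the second. Pointwise convergence may fail only at `η = 0`, a null
set as `d > 0`. -/
theorem tendsto_lintegral_resolv (hd : 0 < d) (hν : 0 < ν) (hB3 : HypB3 Γ ν E₀ j K₀ d₁ P)
    (hB4 : HypB4 Γ ν E₀ {j} d₁ Pi₀) (hC2 : HypC2 Γ E₀ j) (hQ : ∀ ξ, ξ ≠ 0 → Pi₀ ξ = Q)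
    (hz : z.im ≠ 0) {h : ℕ → ℝ} (hh : Tendsto h atTop (𝓝[>] 0)) {Y : ℕ → Rd d → Cs s}
    {g : Rd d → Cs s} (hYm : ∀ n, StronglyMeasurable (Y n)) (hg : Integrable g)
    (hY : Tendsto (fun n => ∫⁻ η, ‖Y n η - g η‖ₑ) atTop (𝓝 0)) :
    Integrable (fun η => limitResolv P Q z η (g η)) ∧
      Tendsto (fun n => ∫⁻ η, ‖resolv Γ ν E₀ d₁ z (h n) η (Y n η) - limitResolv P Q z η (g η)‖ₑ)
        atTop (𝓝 0) := by
  have : Nonempty (Fin d) := ⟨⟨0, hd⟩⟩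
  have : Nontrivial (Rd d) := inferInstance
  have hne : ∀ᵐ η : Rd d, η ≠ 0 := Measure.ae_ne volume 0
  set a := |z.im|⁻¹
  have hlim : ∀ᵐ η, Tendsto (fun n => resolv Γ ν E₀ d₁ z (h n) η (g η)) atTop
      (𝓝 (limitResolv P Q z η (g η))) := by
    filter_upwards [hne] with η hη
    exact (tendsto_resolv hν hB3 hB4 hC2 hQ hz hη (g η)).comp hh
  have hm : AEStronglyMeasurable fun η => limitResolv P Q z η (g η) :=
    aestronglyMeasurable_of_tendsto_ae atTop
      (fun n => aestronglyMeasurable_resolv hz (h n) hg.1) hlim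
  have hbd : ∀ᵐ η, ‖limitResolv P Q z η (g η)‖ ≤ a * ‖g η‖ := by
    filter_upwards [hlim] with η hη
    exact le_of_tendsto hη.norm (Eventually.of_forall fun n => norm_resolv_le hz _ _ _)
  have hI : Integrable fun η => limitResolv P Q z η (g η) := (hg.norm.const_mul a).mono' hm hbd
  refine ⟨hI, ?_⟩
  have hRg : ∀ n, Integrable fun η => resolv Γ ν E₀ d₁ z (h n) η (g η) := fun n =>
    (hg.norm.const_mul a).mono' (aestronglyMeasurable_resolv hz _ hg.1)
      (Eventually.of_forall fun η => norm_resolv_le hz _ _ _)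
  have h1 : Tendsto (fun n => ∫⁻ η, ‖resolv Γ ν E₀ d₁ z (h n) η (g η)
      - limitResolv P Q z η (g η)‖ₑ) atTop (𝓝 0) := by
    have hgi := (hg.norm.const_mul (2 * a))
    have := tendsto_lintegral_of_dominated_convergence' (μ := (volume : Measure (Rd d)))
      (F := fun n η => ‖resolv Γ ν E₀ d₁ z (h n) η (g η) - limitResolv P Q z η (g η)‖ₑ)
      (f := fun _ => 0) (fun η => ‖2 * a * ‖g η‖‖ₑ) (fun n => ((hRg n).1.sub hm).enorm)
      (fun n => ?_) hgi.2.ne ?_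
    · simpa using this
    · filter_upwards [hbd] with η hη
      refine enorm_le_iff_norm_le.2 ?_
      rw [Real.norm_of_nonneg (by positivity)]
      refine (norm_sub_le _ _).trans ?_
      have := norm_resolv_le (Γ := Γ) (ν := ν) (E₀ := E₀) (d₁ := d₁) hz (h n) η (g η)
      linarith
    · filter_upwards [hlim] with η hη
      have := (hη.sub_const (limitResolv P Q z η (g η))).enorm
      simpa using this
  have h2 : Tendsto (fun n => ENNReal.ofReal a * ∫⁻ η, ‖Y n η - g η‖ₑ) atTop (𝓝 0) := by
    have := ENNReal.Tendsto.const_mul hY (Or.inr ENNReal.ofReal_ne_top : _ ∨ ENNReal.ofReal a ≠ ⊤)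
    rwa [mul_zero] at this
  refine tendsto_of_tendsto_of_tendsto_of_le_of_le tendsto_const_nhds
    (by simpa using h2.add h1) (fun n => zero_le) fun n => ?_
  change _ ≤ (ENNReal.ofReal a * ∫⁻ η, ‖Y n η - g η‖ₑ) + ∫⁻ η, _
  have hm1 : AEMeasurable fun η => ENNReal.ofReal a * ‖Y n η - g η‖ₑ :=
    ((hYm n).aestronglyMeasurable.sub hg.1).enorm.const_mul _
  rw [← lintegral_const_mul' _ _ ENNReal.ofReal_ne_top, ← lintegral_add_left' hm1]
  refine lintegral_mono fun η => ?_
  calc ‖resolv Γ ν E₀ d₁ z (h n) η (Y n η) - limitResolv P Q z η (g η)‖ₑ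
      = ‖resolv Γ ν E₀ d₁ z (h n) η (Y n η - g η) + (resolv Γ ν E₀ d₁ z (h n) η (g η)
        - limitResolv P Q z η (g η))‖ₑ := by rw [map_sub]; congr 1; abel
    _ ≤ _ := (enorm_add_le _ _).trans (add_le_add ?_ le_rfl)
  rw [← ofReal_norm, ← ofReal_norm, ← ENNReal.ofReal_mul (by positivity)]
  exact ENNReal.ofReal_le_ofReal (norm_resolv_le hz _ _ _)

end Resolvent

/-! ### The limit equation -/

/-- The limit equation `(P(2πη) - z) G = Q (k - φ * G)` on the Fourier side. -/
def IsLimit (P : Rd d → ℝ) (Q : Matrix (Fin s) (Fin s) ℂ) (z : ℂ) (φ : Rd d → ℂ)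
    (k G : Rd d → Cs s) : Prop :=
  Integrable G ∧ MemLp G 2 ∧ ∀ᵐ η, G η = limitResolv P Q z η (k η - conv φ G η)

theorem integrable_conv_integrand {φ : Rd d → ℂ} {G : Rd d → Cs s} (hφ : MemLp φ 2)
    (hG : MemLp G 2) (η : Rd d) : Integrable fun ζ => φ (η - ζ) • G ζ :=
  memLp_one_iff_integrable.1 (MemLp.smul (p := 2) (q := 2) (r := 1) hG (memLp_comp_sub_left hφ η))

theorem conv_sub_apply {φ : Rd d → ℂ} {G H : Rd d → Cs s} (hφ : MemLp φ 2) (hG : MemLp G 2)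
    (hH : MemLp H 2) (η : Rd d) : conv φ (G - H) η = conv φ G η - conv φ H η := by
  rw [conv_apply, conv_apply, conv_apply, ← integral_sub (integrable_conv_integrand hφ hG η)
    (integrable_conv_integrand hφ hH η)]
  simp_rw [Pi.sub_apply, smul_sub]

section Limit

variable {P : Rd d → ℝ} {Q : Matrix (Fin s) (Fin s) ℂ} {z : ℂ} {φ : Rd d → ℂ}
  {k G H : Rd d → Cs s} {V : Rd d → ℝ} {M : ℝ}

theorem ofReal_sub_ne_zero (hz : z.im ≠ 0) (t : ℝ) : (t : ℂ) - z ≠ 0 := fun h0 =>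
  hz (by rw [← sub_eq_zero.1 h0, Complex.ofReal_im])

theorem toEuclideanLin_limitResolv (hQ : IsIdempotentElem Q) (η : Rd d) (x : Cs s) :
    Matrix.toEuclideanLin Q (limitResolv P Q z η x) = limitResolv P Q z η x := by
  rw [limitResolv, map_smul, ← toEuclideanLin_mul_apply, hQ.eq]

theorem IsLimit.toEuclideanLin_ae_eq (hQ : IsIdempotentElem Q) (hG : IsLimit P Q z φ k G) :
    ∀ᵐ η, Matrix.toEuclideanLin Q (G η) = G η := by
  filter_upwards [hG.2.2] with η hη
  rw [hη, toEuclideanLin_limitResolv hQ]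

theorem IsLimit.smul_ae_eq (hz : z.im ≠ 0) (hG : IsLimit P Q z φ k G) :
    ∀ᵐ η, ((P ((2 * Real.pi) • η) : ℂ) - z) • G η
      = Matrix.toEuclideanLin Q (k η - conv φ G η) := by
  filter_upwards [hG.2.2] with η hη
  conv_lhs => rw [hη, limitResolv, smul_smul, mul_inv_cancel₀ (ofReal_sub_ne_zero hz _), one_smul]

theorem memLp_real_smul {w : Rd d → Cs s} (hw : MemLp w 2) (hVc : Continuous V)
    (hVM : ∀ x, |V x| ≤ M) : MemLp (fun x => (V x : ℂ) • w x) 2 := by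
  refine (hw.const_smul M).of_le ?_ (Eventually.of_forall fun x => ?_)
  · exact (Complex.continuous_ofReal.comp hVc).aestronglyMeasurable.smul hw.1
  · rw [norm_smul, Pi.smul_apply, norm_smul, Complex.norm_real, Real.norm_eq_abs]
    gcongr
    exact (hVM x).trans (le_abs_self M)

theorem fourierInv_conv_eq (hφ : Integrable φ) (hφV : ∀ x, 𝓕⁻ φ x = V x) (hG : Integrable G) :
    𝓕⁻ (conv φ G) = fun x => (V x : ℂ) • 𝓕⁻ G x := by
  ext1 x
  rw [fourierInv_conv hφ hG, hφV]

/-- In position space the convolution becomes multiplication by a bounded function. -/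
theorem memLp_conv (hφ : Integrable φ) (hφV : ∀ x, 𝓕⁻ φ x = V x) (hVc : Continuous V)
    (hVM : ∀ x, |V x| ≤ M) (hG : Integrable G) (hG2 : MemLp G 2) : MemLp (conv φ G) 2 := by
  have h1 : MemLp (𝓕⁻ (conv φ G)) 2 := by
    rw [fourierInv_conv_eq hφ hφV hG]
    exact memLp_real_smul (memLp_fourierInv hG hG2) hVc hVM
  exact (memLp_congr_ae (fourier_toLp_fourierInv_ae_eq (integrable_conv hφ hG) h1)).1 (Lp.memLp _)

/-- Convolution with the Fourier transform of a real potential is symmetric. -/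
theorem im_integral_inner_conv (hφ : Integrable φ) (hφV : ∀ x, 𝓕⁻ φ x = V x) (hVc : Continuous V)
    (hVM : ∀ x, |V x| ≤ M) (hG : Integrable G) (hG2 : MemLp G 2) :
    (∫ η, inner ℂ (G η) (conv φ G η)).im = 0 := by
  have hw := memLp_fourierInv hG hG2
  have hc : MemLp (𝓕⁻ (conv φ G)) 2 := by
    rw [fourierInv_conv_eq hφ hφV hG]
    exact memLp_real_smul hw hVc hVM
  have h1 := Lp.inner_fourier_eq (hw.toLp (𝓕⁻ G)) (hc.toLp (𝓕⁻ (conv φ G)))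
  rw [L2.inner_def, L2.inner_def] at h1
  have h2 : ∫ η, inner ℂ (G η) (conv φ G η) = ∫ η, inner ℂ
      ((𝓕 (hw.toLp (𝓕⁻ G)) : Lp (Cs s) 2 (volume : Measure (Rd d))) η)
      ((𝓕 (hc.toLp (𝓕⁻ (conv φ G))) : Lp (Cs s) 2 (volume : Measure (Rd d))) η) := by
    refine integral_congr_ae ?_
    filter_upwards [fourier_toLp_fourierInv_ae_eq hG hw,
      fourier_toLp_fourierInv_ae_eq (integrable_conv hφ hG) hc] with η h3 h4
    rw [h3, h4]
  have h5 : ∫ x, inner ℂ (hw.toLp (𝓕⁻ G) x) (hc.toLp (𝓕⁻ (conv φ G)) x)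
      = ∫ x, ((V x * ‖𝓕⁻ G x‖ ^ 2 : ℝ) : ℂ) := by
    refine integral_congr_ae ?_
    filter_upwards [hw.coeFn_toLp, hc.coeFn_toLp] with x h3 h4
    rw [h3, h4, fourierInv_conv_eq hφ hφV hG, inner_smul_right, inner_self_eq_norm_sq_to_K]
    push_cast
    rfl
  rw [h2, h1, h5, integral_complex_ofReal, Complex.ofReal_im]

/-- Uniqueness for the limit equation. -/
theorem IsLimit.unique (hz : z.im ≠ 0) (hQ : IsIdempotentElem Q)
    (hQs : (Matrix.toEuclideanLin Q).IsSymmetric) (hφ : Integrable φ) (hφ2 : MemLp φ 2)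
    (hφV : ∀ x, 𝓕⁻ φ x = V x) (hVc : Continuous V) (hVM : ∀ x, |V x| ≤ M)
    (hG : IsLimit P Q z φ k G) (hH : IsLimit P Q z φ k H) : G =ᵐ[volume] H := by
  have hD : Integrable (G - H) := hG.1.sub hH.1
  have hD2 : MemLp (G - H) 2 := hG.2.1.sub hH.2.1
  have hc2 := memLp_conv hφ hφV hVc hVM hD hD2
  -- The difference `D` satisfies `Q D = D` and `(P - z) D = -Q (φ * D)`. Pairing with `D`, symmetry
  -- of `Q` removes it from `⟨D, φ * D⟩`, and the imaginary part is `Im z ‖D‖²`. Its integral is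
  -- zero because `V` is real.
  have h1 : ∀ᵐ η, (inner ℂ ((G - H) η) (conv φ (G - H) η)).im = z.im * ‖(G - H) η‖ ^ 2 := by
    filter_upwards [hG.smul_ae_eq hz, hH.smul_ae_eq hz, hG.toEuclideanLin_ae_eq hQ,
      hH.toEuclideanLin_ae_eq hQ] with η h1 h2 h3 h4
    have h5 : Matrix.toEuclideanLin Q ((G - H) η) = (G - H) η := by
      rw [Pi.sub_apply, map_sub, h3, h4]
    have h6 : Matrix.toEuclideanLin Q (conv φ (G - H) η)
        = -(((P ((2 * Real.pi) • η) : ℂ) - z) • (G - H) η) := by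
      rw [Pi.sub_apply, smul_sub, h1, h2, conv_sub_apply hφ2 hG.2.1 hH.2.1, map_sub, map_sub,
        map_sub]
      abel
    rw [← h5, hQs, h6, inner_neg_right, inner_smul_right, h5, inner_self_eq_norm_sq_to_K]
    simp only [Complex.coe_algebraMap, ← Complex.ofReal_pow, Complex.neg_im, Complex.mul_im,
      Complex.sub_im, Complex.ofReal_im, Complex.ofReal_re]
    ring
  have hI : Integrable fun η => inner ℂ ((G - H) η) (conv φ (G - H) η) := by
    refine (L2.integrable_inner (𝕜 := ℂ) (hD2.toLp (G - H)) (hc2.toLp _)).congr ?_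
    filter_upwards [hD2.coeFn_toLp, hc2.coeFn_toLp] with η h3 h4
    rw [h3, h4]
  have h2 : ∫ η, (inner ℂ ((G - H) η) (conv φ (G - H) η)).im = 0 :=
    (integral_im hI).trans (im_integral_inner_conv hφ hφV hVc hVM hD hD2)
  rw [integral_congr_ae h1, integral_const_mul] at h2
  have h3 := (mul_eq_zero.1 h2).resolve_left hz
  have h4 := (integral_eq_zero_iff_of_nonneg (fun η => by positivity)
    ((memLp_two_iff_integrable_sq_norm hD2.1).1 hD2)).1 h3
  filter_upwards [h4] with η hη
  have : ‖(G - H) η‖ ^ 2 = 0 := hη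
  rw [sq_eq_zero_iff, norm_eq_zero] at this
  exact sub_eq_zero.1 this

end Limit

/-! ### Convergence of the Fourier transforms of the solutions -/

section Convergence

variable {Γ : PeriodicGraph d s} {ν E₀ : ℝ} {j : Fin s} {K₀ : Set (Rd d)} {d₁ : Rd d}
  {P : Rd d → ℝ} {Pi₀ : Rd d → Matrix (Fin s) (Fin s) ℂ} {Q : Matrix (Fin s) (Fin s) ℂ}
  {z : ℂ} {V : Rd d → ℝ} {M C : ℝ} {f : Rd d → Cs s} {φ : Rd d → ℂ} {k : Rd d → Cs s}

/-- By ellipticity the symbol eventually dominates `(δ⁻¹ + ‖z‖) ‖x‖`, uniformly in `h`; subtracting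
`z x` still leaves `δ⁻¹ ‖x‖`. -/
theorem exists_high_frequency_bound (hν : 0 < ν) (hB1 : HypB1 Γ E₀ j K₀ d₁)
    (hB3 : HypB3 Γ ν E₀ j K₀ d₁ P) (hC1 : HypC1 Γ E₀ j d₁) (hC2 : HypC2 Γ E₀ j)
    (hγ : ∀ t : ℝ, 0 < t → ∀ ξ, P (t • ξ) = t ^ ν * P ξ) (z : ℂ) {ε : ENNReal} (hε : 0 < ε) :
    ∃ R : ℝ, ∀ h : ℝ, 0 < h → ∀ η ∈ closedTile d h⁻¹, R ≤ ‖η‖ → ∀ x : Cs s,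
      ‖x‖ₑ ≤ ε * ‖symLin Γ ν E₀ d₁ h ((2 * Real.pi) • η) x - z • x‖ₑ := by
  obtain ⟨c, hc, hb⟩ := exists_norm_symLin_ge hν hB1 hB3 hC1 hC2 hγ
  -- The truncation at `1` covers `ε = ⊤`.
  set δ : ℝ := (min ε 1).toReal
  have hδ1 : min ε 1 ≠ ⊤ := ne_top_of_le_ne_top ENNReal.one_ne_top (min_le_right _ _)
  have hδ : 0 < δ := ENNReal.toReal_pos (lt_min hε one_pos).ne' hδ1
  have hδε : ENNReal.ofReal δ ≤ ε := by
    rw [ENNReal.ofReal_toReal hδ1]; exact min_le_left _ _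
  obtain ⟨R, hR0, hR⟩ := (((tendsto_rpow_atTop hν).const_mul_atTop hc).eventually_ge_atTop
    (δ⁻¹ + ‖z‖)).and (eventually_ge_atTop (0 : ℝ)) |>.exists
  refine ⟨R, fun h hh η hη hηR x => ?_⟩
  refine le_trans ?_ (mul_le_mul_left hδε _)
  rw [← ofReal_norm, ← ofReal_norm, ← ENNReal.ofReal_mul hδ.le]
  refine ENNReal.ofReal_le_ofReal ?_
  have h1 := hb h hh η hη x
  have h2 : δ⁻¹ + ‖z‖ ≤ c * ‖η‖ ^ ν := hR0.trans (by gcongr)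
  have h3 : ‖symLin Γ ν E₀ d₁ h ((2 * Real.pi) • η) x‖
      ≤ ‖symLin Γ ν E₀ d₁ h ((2 * Real.pi) • η) x - z • x‖ + ‖z‖ * ‖x‖ := by
    have := norm_add_le (symLin Γ ν E₀ d₁ h ((2 * Real.pi) • η) x - z • x) (z • x)
    rwa [sub_add_cancel, norm_smul] at this
  have h4 : (δ⁻¹ + ‖z‖) * ‖x‖ ≤ c * ‖η‖ ^ ν * ‖x‖ := by gcongr
  have h5 : δ⁻¹ * ‖x‖ ≤ ‖symLin Γ ν E₀ d₁ h ((2 * Real.pi) • η) x - z • x‖ := by linarith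
  rwa [inv_mul_le_iff₀ hδ] at h5

theorem eLpNorm_two_le {g : Rd d → Cs s} (hg : MemLp g 2) {C : ℝ} (hC : ∫ x, ‖g x‖ ^ 2 ≤ C) :
    eLpNorm g 2 ≤ ENNReal.ofReal (C ^ (1 / 2 : ℝ)) := by
  rw [hg.eLpNorm_eq_integral_rpow_norm (by norm_num) (by norm_num)]
  refine ENNReal.ofReal_le_ofReal ?_
  simp only [ENNReal.toReal_ofNat, Real.rpow_ofNat]
  rw [one_div]
  exact Real.rpow_le_rpow (integral_nonneg fun x => by positivity) hC (by norm_num)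

/-- Since `G_h` is the resolvent applied to `Y_h`, strong convergence of `Y_h` gives that of `G_h`.
Its strong limit is expressed through the weak limit `G`; as the two coincide, the equation for `G`
closes. -/
theorem exists_subseq_isLimit (hd : 0 < d) (hν : 0 < ν) (hB1 : HypB1 Γ E₀ j K₀ d₁)
    (hB3 : HypB3 Γ ν E₀ j K₀ d₁ P) (hB4 : HypB4 Γ ν E₀ {j} d₁ Pi₀) (hC1 : HypC1 Γ E₀ j d₁)
    (hC2 : HypC2 Γ E₀ j) (hγ : ∀ t : ℝ, 0 < t → ∀ ξ, P (t • ξ) = t ^ ν * P ξ)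
    (hQ : ∀ ξ, ξ ≠ 0 → Pi₀ ξ = Q) (hz : z.im ≠ 0)
    (hVM : ∀ x, |V x| ≤ M) (hφ : Integrable φ) (hφm : StronglyMeasurable φ) (hφ2 : MemLp φ 2)
    (hφV : ∀ x, 𝓕⁻ φ x = V x) (hk : Integrable k) (hkf : 𝓕⁻ k = f)
    {u : ℝ → lp (fun _ : Fin d → ℤ => Cs s) 2} {h : ℕ → ℝ} (hh : Tendsto h atTop (𝓝[>] 0))
    (hpos : ∀ n, 0 < h n) (hu : ∀ n, SolvesDiscrete Γ ν E₀ d₁ V z f (h n) (u (h n)))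
    (hF : ∀ n, ∃ F : lp (fun _ : Fin d → ℤ => Cs s) 2, ∀ m, F m = f (h n • intVec m))
    (hC : ∀ n, ∫ η, ‖dft (h n) (u (h n)) η‖ ^ 2 ≤ C) :
    ∃ θ : ℕ → ℕ, ∃ G : Rd d → Cs s, IsLimit P Q z φ k G ∧
      Tendsto (fun n => ∫⁻ η, ‖dft (h (θ n)) (u (h (θ n))) η - G η‖ₑ) atTop (𝓝 0) := by
  choose F hF using hF
  choose Y hYm hYeq hY1 hY2 using fun n =>
    exists_fourier_equation (hpos n) (hu n) hVM (F n) (hF n) hφ hφV hk hkf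
  have hT : Tendsto (fun n => (h n)⁻¹) atTop atTop := tendsto_inv_nhdsGT_zero.comp hh
  have hhigh : ∀ ε : ENNReal, 0 < ε → ∃ R : ℝ, ∀ n, ∀ᵐ η, R ≤ ‖η‖ →
      ‖dft (h n) (u (h n)) η‖ₑ ≤ ε * ‖Y n η‖ₑ := fun ε hε => by
    obtain ⟨R, hR⟩ := exists_high_frequency_bound hν hB1 hB3 hC1 hC2 hγ z hε
    refine ⟨R, fun n => ?_⟩
    filter_upwards [hYeq n] with η hη hηR
    by_cases hmem : η ∈ closedTile d (h n)⁻¹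
    · rw [hη]
      exact hR _ (hpos n) η hmem hηR _
    · rw [dft_of_notMem _ _ hmem, enorm_zero]
      exact zero_le
  have hGi := fun n => integrable_dft (hpos n) (u (h n))
  obtain ⟨θ, hθ, G, hG2, hcG, hYG, hw⟩ := exists_subseq_limit
    (G := fun n => dft (h n) (u (h n))) (Y := Y) hφ hφm hφ2 hk
    (fun n => stronglyMeasurable_dft _ _) hGi (ENNReal.ofReal_ne_top (r := C ^ (1 / 2 : ℝ)))
    (fun n => eLpNorm_two_le (memLp_dft (hpos n) _) (hC n)) hhigh hYm hY1 hT hY2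
  obtain ⟨hN, hlim⟩ := tendsto_lintegral_resolv (Γ := Γ) (d₁ := d₁) hd hν hB3 hB4 hC2 hQ hz
    (hh.comp hθ.tendsto_atTop) (Y := fun n => Y (θ n)) (fun n => hYm (θ n)) (hk.sub hcG) hYG
  set N : Rd d → Cs s := fun η => limitResolv P Q z η (k η - conv φ G η)
  have hlim2 : Tendsto (fun n => ∫⁻ η, ‖dft (h (θ n)) (u (h (θ n))) η - N η‖ₑ) atTop (𝓝 0) := by
    refine hlim.congr fun n => lintegral_congr_ae ?_
    filter_upwards [hYeq (θ n)] with η hη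
    simp only [Function.comp_apply, hη, resolv_left hz]
    rfl
  have hGN : G =ᵐ[volume] N := ae_eq_of_tendsto_of_weak (fun n => hGi (θ n)) hG2 hN hlim2 hw
  refine ⟨θ, G, ⟨hN.congr hGN.symm, hG2, hGN⟩, hlim2.congr fun n => lintegral_congr_ae ?_⟩
  filter_upwards [hGN] with η hη
  rw [hη]

end Convergence

/-! ### Weighted convergence -/

theorem norm_weighted {t : ℝ} (g : Rd d → Cs s) (x : Rd d) :
    ‖weighted (-t) g x‖ = (1 + ‖x‖ ^ 2) ^ (-(t / 2)) * ‖g x‖ := by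
  rw [weighted, norm_smul, Complex.norm_real, Real.norm_of_nonneg (by positivity), neg_div]

theorem weight_le_one {t : ℝ} (ht : 0 < t) (x : Rd d) : (1 + ‖x‖ ^ 2) ^ (-(t / 2)) ≤ 1 :=
  Real.rpow_le_one_of_one_le_of_nonpos (by nlinarith [norm_nonneg x]) (by linarith)

theorem aestronglyMeasurable_weighted (t : ℝ) {g : Rd d → Cs s} (hg : AEStronglyMeasurable g) :
    AEStronglyMeasurable (weighted t g) := by
  have : Continuous fun x : Rd d => (((1 + ‖x‖ ^ 2) ^ (t / 2) : ℝ) : ℂ) :=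
    Complex.continuous_ofReal.comp
      (Continuous.rpow_const (by fun_prop) fun x => Or.inl (by positivity))
  exact this.aestronglyMeasurable.smul hg

theorem memL2w_of_memLp {t : ℝ} (ht : 0 < t) {g : Rd d → Cs s} (hg : MemLp g 2) :
    MemL2w (-t) g := by
  refine hg.of_le (aestronglyMeasurable_weighted _ hg.1) (Eventually.of_forall fun x => ?_)
  rw [norm_weighted]
  exact (mul_le_mul_of_nonneg_right (weight_le_one ht x) (norm_nonneg _)).trans (one_mul _).le

/-- Functions bounded in `L²` and converging uniformly to `0` converge to `0` in `L^{2,-t}`. -/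
theorem tendsto_eLpNorm_weighted {t : ℝ} (ht : 0 < t) {l : Filter ℝ} {g : ℝ → Rd d → Cs s}
    {a : ℝ → ENNReal} {C : ENNReal} (hC : C ≠ ⊤) (hm : ∀ᶠ h in l, AEStronglyMeasurable (g h))
    (hgC : ∀ᶠ h in l, eLpNorm (g h) 2 ≤ C) (hga : ∀ᶠ h in l, ∀ x, ‖g h x‖ₑ ≤ a h)
    (ha : Tendsto a l (𝓝 0)) :
    Tendsto (fun h => eLpNorm (weighted (-t) (g h)) 2) l (𝓝 0) := by
  refine ENNReal.tendsto_nhds_zero.2 fun ε hε => ?_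
  have hε2 : 0 < ε / 2 := ENNReal.half_pos hε.ne'
  have hw : Tendsto (fun R : ℝ => ENNReal.ofReal ((1 + R ^ 2) ^ (-(t / 2))) * C) atTop (𝓝 0) := by
    have h1 : Tendsto (fun R : ℝ => 1 + R ^ 2) atTop atTop :=
      tendsto_atTop_add_const_left _ _ (tendsto_pow_atTop two_ne_zero)
    have h2 := ENNReal.tendsto_ofReal ((tendsto_rpow_neg_atTop (half_pos ht)).comp h1)
    have h3 := ENNReal.Tendsto.mul_const h2 (Or.inr hC : _ ∨ C ≠ ⊤)
    rwa [ENNReal.ofReal_zero, zero_mul] at h3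
  -- Beyond radius `R` the small weight multiplies the `L²` bound; inside, the uniform bound
  -- multiplies the square root of the volume.
  obtain ⟨R, hR, hR0⟩ := ((ENNReal.tendsto_nhds_zero.1 hw _ hε2).and
    (eventually_ge_atTop (0 : ℝ))).exists
  set S := {η : Rd d | R ≤ ‖η‖}
  have hS : MeasurableSet S := measurableSet_norm_ge R
  set v : ENNReal := volume Sᶜ ^ (1 / 2 : ℝ)
  have hv : v ≠ ⊤ := ENNReal.rpow_ne_top_of_nonneg (by norm_num) (volume_compl_norm_ge_lt_top R).ne
  have hav : Tendsto (fun h => a h * v) l (𝓝 0) := by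
    have := ENNReal.Tendsto.mul_const ha (Or.inr hv : _ ∨ v ≠ ⊤)
    rwa [zero_mul] at this
  filter_upwards [hm, hgC, hga, ENNReal.tendsto_nhds_zero.1 hav _ hε2] with h h1 h2 h3 h4
  have hwm := aestronglyMeasurable_weighted (-t) h1
  have hle : ∀ x, ‖weighted (-t) (g h) x‖ ≤ ‖g h x‖ := fun x => by
    rw [norm_weighted]
    exact (mul_le_mul_of_nonneg_right (weight_le_one ht x) (norm_nonneg _)).trans (one_mul _).le
  rw [← Set.indicator_self_add_compl S (weighted (-t) (g h)), ← ENNReal.add_halves ε]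
  refine (eLpNorm_add_le (hwm.indicator hS) (hwm.indicator hS.compl) (by norm_num)).trans
    (add_le_add ?_ ?_)
  · refine (eLpNorm_le_mul_eLpNorm_of_ae_le_mul (g := g h) (c := (1 + R ^ 2) ^ (-(t / 2)))
      (Eventually.of_forall fun x => ?_) 2).trans ?_
    · by_cases hx : x ∈ S
      · rw [Set.indicator_of_mem hx, norm_weighted]
        have hx' : R ≤ ‖x‖ := hx
        gcongr ?_ * _
        exact Real.rpow_le_rpow_of_nonpos (by positivity) (by gcongr) (by linarith)
      · rw [Set.indicator_of_notMem hx, norm_zero]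
        positivity
    · exact (mul_le_mul_right h2 _).trans hR
  · rw [eLpNorm_indicator_eq_eLpNorm_restrict hS.compl]
    refine (eLpNorm_le_of_ae_enorm_bound (C := a h) (Eventually.of_forall fun x => ?_)).trans ?_
    · exact (enorm_le_iff_norm_le.2 (hle x)).trans (h3 x)
    · rw [Measure.restrict_apply_univ]
      refine le_trans (le_of_eq ?_) h4
      simp [v]

theorem enorm_fourierInv_sub_le {F G : Rd d → Cs s} (hF : Integrable F) (hG : Integrable G)
    (x : Rd d) : ‖𝓕⁻ F x - 𝓕⁻ G x‖ₑ ≤ ∫⁻ η, ‖F η - G η‖ₑ := by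
  rw [← fourierInv_sub_apply hF hG, ← ofReal_norm]
  refine (ENNReal.ofReal_le_ofReal (norm_fourierInv_le _ x)).trans (le_of_eq ?_)
  rw [ofReal_integral_norm_eq_lintegral_enorm (hF.sub hG)]
  rfl

/-! ### Convergence of the interpolations -/

section Interpolation

variable {G : Rd d → Cs s} {u : ℝ → lp (fun _ : Fin d → ℤ => Cs s) 2}

theorem tendstoLocallyUniformly_interpolate (hG : Integrable G)
    (h : Tendsto (fun h : ℝ => ∫⁻ η, ‖dft h (u h) η - G η‖ₑ) (𝓝[>] 0) (𝓝 0)) :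
    TendstoLocallyUniformly (fun h => interpolate h (u h)) (𝓕⁻ G) (𝓝[>] 0) := by
  refine TendstoUniformly.tendstoLocallyUniformly ?_
  rw [EMetric.tendstoUniformly_iff]
  intro ε hε
  filter_upwards [self_mem_nhdsWithin, h.eventually_lt_const hε] with δ hδ h1 x
  have hδ' : 0 < δ := hδ
  rw [edist_comm, edist_eq_enorm_sub, ← fourierInv_dft hδ']
  exact (enorm_fourierInv_sub_le (integrable_dft hδ' _) hG x).trans_lt h1

theorem memLp_interpolate {h : ℝ} (hh : 0 < h) (u : lp (fun _ : Fin d → ℤ => Cs s) 2) :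
    MemLp (interpolate h u) 2 := by
  rw [← fourierInv_dft hh]
  exact memLp_fourierInv (integrable_dft hh u) (memLp_dft hh u)

theorem tendstoL2w_interpolate {C t : ℝ} (ht : 0 < t) (hG : Integrable G) (hG2 : MemLp G 2)
    (h : Tendsto (fun h : ℝ => ∫⁻ η, ‖dft h (u h) η - G η‖ₑ) (𝓝[>] 0) (𝓝 0))
    (hC : ∀ᶠ h in 𝓝[>] (0 : ℝ), ∫ η, ‖dft h (u h) η‖ ^ 2 ≤ C) :
    TendstoL2w (-t) (fun h => interpolate h (u h)) (𝓕⁻ G) := by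
  have hw := memLp_fourierInv hG hG2
  refine ⟨?_, memL2w_of_memLp ht hw, ?_⟩
  · filter_upwards [self_mem_nhdsWithin] with δ hδ
    exact memL2w_of_memLp ht (memLp_interpolate hδ _)
  refine tendsto_eLpNorm_weighted ht
    (C := ENNReal.ofReal (C ^ (1 / 2 : ℝ)) + eLpNorm (𝓕⁻ G) 2) (by have := hw.2; finiteness)
    ?_ ?_ ?_ h
  · filter_upwards [self_mem_nhdsWithin] with δ hδ
    exact ((memLp_interpolate hδ _).sub hw).1
  · filter_upwards [self_mem_nhdsWithin, hC] with δ hδ hCδ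
    have hδ' : 0 < δ := hδ
    refine (eLpNorm_sub_le (memLp_interpolate hδ _).1 hw.1 (by norm_num)).trans
      (add_le_add (eLpNorm_two_le (memLp_interpolate hδ _) ?_) le_rfl)
    rw [← fourierInv_dft hδ', norm_sq_fourierInv (integrable_dft hδ' _) (memLp_dft hδ' _)]
    exact hCδ
  · filter_upwards [self_mem_nhdsWithin] with δ hδ x
    have hδ' : 0 < δ := hδ
    rw [Pi.sub_apply, ← fourierInv_dft hδ']
    exact enorm_fourierInv_sub_le (integrable_dft hδ' _) hG x

end Interpolation

/-! ### The limit equation in position space -/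

section Multiplier

variable {P : Rd d → ℝ} {Pi₀ : Rd d → Matrix (Fin s) (Fin s) ℂ} {Q : Matrix (Fin s) (Fin s) ℂ}
  {z : ℂ} {φ : Rd d → ℂ} {k G : Rd d → Cs s} {V : Rd d → ℝ} {M : ℝ}

theorem isFourierMultiplier_fourierInv {a : Rd d → Matrix (Fin s) (Fin s) ℂ} {A B : Rd d → Cs s}
    (hA : Integrable A) (hB : Integrable B) (hA2 : MemLp (𝓕⁻ A) 2) (hB2 : MemLp (𝓕⁻ B) 2)
    (h : ∀ᵐ η, B η = Matrix.toEuclideanLin (a ((2 * Real.pi) • η)) (A η)) :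
    IsFourierMultiplier a (𝓕⁻ A) (𝓕⁻ B) := by
  refine ⟨hA2, hB2, ?_⟩
  filter_upwards [fourier_toLp_fourierInv_ae_eq hA hA2, fourier_toLp_fourierInv_ae_eq hB hB2, h]
    with η h1 h2 h3
  rw [h1, h2, h3]

/-- A constant matrix passes under the convolution integral. Here the independence of `Π₀` from `ξ`
is essential: it removes the projection from the potential term. -/
theorem toEuclideanLin_conv_eq (hφ2 : MemLp φ 2) (hG2 : MemLp G 2)
    (hQG : ∀ᵐ η, Matrix.toEuclideanLin Q (G η) = G η) (η : Rd d) :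
    Matrix.toEuclideanLin Q (conv φ G η) = conv φ G η := by
  have h1 := (Matrix.toEuclideanLin Q).toContinuousLinearMap.integral_comp_comm
    (integrable_conv_integrand hφ2 hG2 η)
  rw [conv_apply]
  refine Eq.trans h1.symm (integral_congr_ae ?_)
  filter_upwards [hQG] with ζ hζ
  simp [hζ]

/-- The inverse Fourier transform of the solution of the limit equation solves
`(P(D) + V - z) w = Π₀ f`. -/
theorem IsLimit.solves (hd : 0 < d) (hz : z.im ≠ 0) (hQ : IsIdempotentElem Q)
    (hPi : ∀ ξ, ξ ≠ 0 → Pi₀ ξ = Q) (hφ : Integrable φ) (hφ2 : MemLp φ 2)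
    (hφV : ∀ x, 𝓕⁻ φ x = V x) (hVc : Continuous V) (hVM : ∀ x, |V x| ≤ M) (hk : Integrable k)
    (hk2 : MemLp (𝓕⁻ k) 2) (hG : IsLimit P Q z φ k G) :
    IsFourierMultiplier Pi₀ (𝓕⁻ G) (𝓕⁻ G) ∧ ∃ Pw g : Rd d → Cs s,
      IsFourierMultiplier (fun ξ => (P ξ : ℂ) • (1 : Matrix (Fin s) (Fin s) ℂ)) (𝓕⁻ G) Pw ∧
      IsFourierMultiplier Pi₀ (𝓕⁻ k) g ∧
      ∀ x : Rd d, Pw x + (V x : ℂ) • 𝓕⁻ G x - z • 𝓕⁻ G x = g x := by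
  have : Nonempty (Fin d) := ⟨⟨0, hd⟩⟩
  have hPiae : ∀ᵐ η : Rd d, Pi₀ ((2 * Real.pi) • η) = Q := by
    filter_upwards [Measure.ae_ne (volume : Measure (Rd d)) 0] with η hη
    exact hPi _ (smul_ne_zero (by positivity) hη)
  have hw := memLp_fourierInv hG.1 hG.2.1
  have hQG := hG.toEuclideanLin_ae_eq hQ
  set L := (Matrix.toEuclideanLin Q).toContinuousLinearMap
  have hkL2 : MemLp k 2 := (memLp_congr_ae (fourier_toLp_fourierInv_ae_eq hk hk2)).1 (Lp.memLp _)
  have hQk : Integrable fun η => Matrix.toEuclideanLin Q (k η) := L.integrable_comp hk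
  have hQk2 : MemLp (fun η => Matrix.toEuclideanLin Q (k η)) 2 := L.comp_memLp' hkL2
  have hc := integrable_conv hφ hG.1
  have hc2 := memLp_conv hφ hφV hVc hVM hG.1 hG.2.1
  have hzG : Integrable (z • G) := hG.1.smul z
  have hzG2 : MemLp (z • G) 2 := hG.2.1.const_smul z
  have hzw : ∀ x, 𝓕⁻ (z • G) x = z • 𝓕⁻ G x := fun x => by
    simp only [Real.fourierInv_eq', Pi.smul_apply]
    rw [← integral_smul]
    congr 1 with η
    rw [smul_comm]
  have hA : Integrable (z • G + fun η => Matrix.toEuclideanLin Q (k η)) := hzG.add hQk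
  refine ⟨isFourierMultiplier_fourierInv hG.1 hG.1 hw hw ?_,
    -- `P(D) w` is defined by solving the limit equation for `P G`, which shows at once that it is
    -- in `L²`.
    𝓕⁻ ((z • G + fun η => Matrix.toEuclideanLin Q (k η)) - conv φ G),
    𝓕⁻ (fun η => Matrix.toEuclideanLin Q (k η)),
    isFourierMultiplier_fourierInv hG.1 (hA.sub hc) hw
      (memLp_fourierInv (hA.sub hc) ((hzG2.add hQk2).sub hc2)) ?_,
    isFourierMultiplier_fourierInv hk hQk hk2 (memLp_fourierInv hQk hQk2) ?_, fun x => ?_⟩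
  · filter_upwards [hPiae, hQG] with η h1 h2
    rw [h1, h2]
  · filter_upwards [hG.smul_ae_eq hz] with η h1
    rw [map_sub, toEuclideanLin_conv_eq hφ2 hG.2.1 hQG, sub_smul, sub_eq_iff_eq_add] at h1
    rw [map_smul, LinearMap.smul_apply, toEuclideanLin_one_apply, h1, Pi.sub_apply, Pi.add_apply,
      Pi.smul_apply]
    abel
  · filter_upwards [hPiae] with η h1
    rw [h1]
  · rw [fourierInv_sub_apply hA hc, fourierInv_add_apply hzG hQk, hzw,
      congrFun (fourierInv_conv_eq hφ hφV hG.1) x]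
    abel

end Multiplier

/-! ### Convergence of the whole family -/

section Main

variable {Γ : PeriodicGraph d s} {ν E₀ : ℝ} {j : Fin s} {K₀ : Set (Rd d)} {d₁ : Rd d}
  {P : Rd d → ℝ} {Pi₀ : Rd d → Matrix (Fin s) (Fin s) ℂ} {Q : Matrix (Fin s) (Fin s) ℂ}
  {z : ℂ} {V : Rd d → ℝ} {M C : ℝ} {f : Rd d → Cs s} {φ : Rd d → ℂ} {k : Rd d → Cs s}

/-- The Fourier transforms of the solutions converge in `L¹` to a solution of the limit equation. -/
theorem exists_isLimit_tendsto (hd : 0 < d) (hν : 0 < ν) (hB1 : HypB1 Γ E₀ j K₀ d₁)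
    (hB3 : HypB3 Γ ν E₀ j K₀ d₁ P) (hB4 : HypB4 Γ ν E₀ {j} d₁ Pi₀) (hC1 : HypC1 Γ E₀ j d₁)
    (hC2 : HypC2 Γ E₀ j) (hγ : ∀ t : ℝ, 0 < t → ∀ ξ, P (t • ξ) = t ^ ν * P ξ)
    (hPi : ∀ ξ, ξ ≠ 0 → Pi₀ ξ = Q) (hQ : IsIdempotentElem Q)
    (hQs : (Matrix.toEuclideanLin Q).IsSymmetric) (hz : z.im ≠ 0) (hVc : Continuous V)
    (hVM : ∀ x, |V x| ≤ M) (hφ : Integrable φ) (hφm : StronglyMeasurable φ) (hφ2 : MemLp φ 2)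
    (hφV : ∀ x, 𝓕⁻ φ x = V x) (hk : Integrable k) (hkf : 𝓕⁻ k = f)
    {u : ℝ → lp (fun _ : Fin d → ℤ => Cs s) 2} {h₁ : ℝ} (hh₁ : 0 < h₁)
    (hu : ∀ h, 0 < h → h < h₁ → SolvesDiscrete Γ ν E₀ d₁ V z f h (u h))
    (hF : ∀ h, 0 < h → h < h₁ →
      ∃ F : lp (fun _ : Fin d → ℤ => Cs s) 2, ∀ m, F m = f (h • intVec m))
    (hC : ∀ h, 0 < h → h < h₁ → ∫ η, ‖dft h (u h) η‖ ^ 2 ≤ C) :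
    ∃ G : Rd d → Cs s, IsLimit P Q z φ k G ∧
      Tendsto (fun h : ℝ => ∫⁻ η, ‖dft h (u h) η - G η‖ₑ) (𝓝[>] 0) (𝓝 0) := by
  have hev : ∀ᶠ h in 𝓝[>] (0 : ℝ), 0 < h ∧ h < h₁ := by
    filter_upwards [Ioo_mem_nhdsGT hh₁] with h hh
    exact hh
  -- Every sequence of mesh sizes has a subsequence with a limit. One sequence supplies the
  -- candidate `G`, and uniqueness identifies all other limits with it.
  have key : ∀ h : ℕ → ℝ, Tendsto h atTop (𝓝[>] 0) → ∃ θ : ℕ → ℕ, ∃ G : Rd d → Cs s,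
      IsLimit P Q z φ k G ∧
        Tendsto (fun n => ∫⁻ η, ‖dft (h (θ n)) (u (h (θ n))) η - G η‖ₑ) atTop (𝓝 0) := by
    intro h hh
    obtain ⟨N, hN⟩ := eventually_atTop.1 (hh.eventually hev)
    have hN' : ∀ n, 0 < h (n + N) ∧ h (n + N) < h₁ := fun n => hN _ (Nat.le_add_left N n)
    obtain ⟨θ, G, hG, hlim⟩ := exists_subseq_isLimit hd hν hB1 hB3 hB4 hC1 hC2 hγ hPi hz hVM hφ hφm
      hφ2 hφV hk hkf (u := u) (h := fun n => h (n + N)) (hh.comp (tendsto_add_atTop_nat N))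
      (fun n => (hN' n).1) (fun n => hu _ (hN' n).1 (hN' n).2)
      (fun n => hF _ (hN' n).1 (hN' n).2) (fun n => hC _ (hN' n).1 (hN' n).2)
    exact ⟨fun n => θ n + N, G, hG, hlim⟩
  obtain ⟨h, hh⟩ := exists_seq_tendsto (𝓝[>] (0 : ℝ))
  obtain ⟨-, G, hG, -⟩ := key h hh
  refine ⟨G, hG, tendsto_of_subseq_tendsto fun h hh => ?_⟩
  obtain ⟨θ, H, hH, hlim⟩ := key h hh
  refine ⟨θ, hlim.congr fun n => lintegral_congr_ae ?_⟩
  filter_upwards [hG.unique hz hQ hQs hφ hφ2 hφV hVc hVM hH] with η hη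
  rw [hη]

theorem integral_norm_sq_dft_solution_le {h C : ℝ} (hh : 0 < h) (hz : z.im ≠ 0)
    (hVM : ∀ x, |V x| ≤ M) {u F : lp (fun _ : Fin d → ℤ => Cs s) 2}
    (hu : SolvesDiscrete Γ ν E₀ d₁ V z f h u) (hF : ∀ n, F n = f (h • intVec n))
    (hC : h ^ d * ‖F‖ ^ 2 ≤ C) : ∫ η, ‖dft h u η‖ ^ 2 ≤ (|z.im| ^ 2)⁻¹ * C := by
  have hz' : 0 < |z.im| := abs_pos.2 hz
  have h1 := abs_im_mul_norm_solution_le hh hu hVM F hF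
  rw [integral_norm_sq_dft hh, ← div_eq_inv_mul, le_div_iff₀ (by positivity)]
  calc h ^ d * ‖u‖ ^ 2 * |z.im| ^ 2 = h ^ d * (|z.im| * ‖u‖) ^ 2 := by ring
    _ ≤ h ^ d * ‖F‖ ^ 2 := by gcongr
    _ ≤ C := hC

end Main

end ContinuumLimit

end

/-! ### The theorem -/

theorem mainTheorem5 {d s : ℕ} (hd : 2 ≤ d) (Γ : ContinuumLimit.PeriodicGraph d s)
    (ν E₀ : ℝ) (j : Fin s) (K₀ : Set (ContinuumLimit.Rd d)) (d₁ : ContinuumLimit.Rd d)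
    (P : ContinuumLimit.Rd d → ℝ)
    (Pi₀ : ContinuumLimit.Rd d → Matrix (Fin s) (Fin s) ℂ)
    -- hypotheses on the characteristic roots
    (hB1 : ContinuumLimit.HypB1 Γ E₀ j K₀ d₁)
    (hB24 : (ContinuumLimit.HypB21 Γ E₀ j K₀ ∧ ContinuumLimit.HypB4 Γ ν E₀ {j} d₁ Pi₀) ∨
      ∃ i : Fin s, ContinuumLimit.HypB22 Γ E₀ i j K₀ ∧
        ContinuumLimit.HypB4 Γ ν E₀ {i, j} d₁ Pi₀)
    (hB3 : ContinuumLimit.HypB3 Γ ν E₀ j K₀ d₁ P)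
    (hC1 : ContinuumLimit.HypC1 Γ E₀ j d₁)
    (hC2 : ContinuumLimit.HypC2 Γ E₀ j)
    (hC3 : ContinuumLimit.HypC3 Γ ν E₀ j d₁ P)
    -- the real-valued compactly supported potential
    (V : ContinuumLimit.Rd d → ℝ) (r : ℝ) (hr : (d : ℝ) / 2 < r)
    (hVc : Continuous V) (hVs : HasCompactSupport V)
    (hV : ContinuumLimit.MemHw r 0 (fun x => (V x : ℂ)))
    -- the right-hand side
    (f : ContinuumLimit.Rd d → ContinuumLimit.Cs s) (m σ : ℝ)
    (hm : ((d / 2 : ℕ) : ℝ) + 1 < m) (hσ : (d : ℝ) + 1 < σ)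
    (hfc : Continuous f) (hf : ContinuumLimit.MemHw m σ f)
    -- the energy and the square-summable solutions
    (z : ℂ) (hz : z.im ≠ 0) (h₀ : ℝ) (hh₀ : 0 < h₀)
    (u : ℝ → lp (fun _ : Fin d → ℤ => ContinuumLimit.Cs s) 2)
    (hu : ∀ h : ℝ, 0 < h → h < h₀ → ContinuumLimit.SolvesDiscrete Γ ν E₀ d₁ V z f h (u h)) :
    ∃ w : ContinuumLimit.Rd d → ContinuumLimit.Cs s,
      (∀ t : ℝ, 0 < t → t < 1 / 2 →
        ContinuumLimit.TendstoL2w (-t) (fun h => ContinuumLimit.interpolate h (u h)) w) ∧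
      TendstoLocallyUniformly (fun h => ContinuumLimit.interpolate h (u h)) w
        (nhdsWithin (0 : ℝ) (Set.Ioi 0)) ∧
      ContinuumLimit.IsFourierMultiplier Pi₀ w w ∧
      ∃ Pw g : ContinuumLimit.Rd d → ContinuumLimit.Cs s,
        ContinuumLimit.IsFourierMultiplier
          (fun ξ => (P ξ : ℂ) • (1 : Matrix (Fin s) (Fin s) ℂ)) w Pw ∧
        ContinuumLimit.IsFourierMultiplier Pi₀ f g ∧
        ∀ᵐ x : ContinuumLimit.Rd d, Pw x + (V x : ℂ) • w x - z • w x = g x := by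
  have hd0 : 0 < d := by omega
  have hB4 : ContinuumLimit.HypB4 Γ ν E₀ {j} d₁ Pi₀ := by
    rcases hB24 with h | ⟨i, hi, -⟩
    · exact h.2
    · exact absurd hi (ContinuumLimit.not_hypB22 hB1 hC2)
  have hne : Nonempty (Fin d) := ⟨⟨0, hd0⟩⟩
  -- `e` is an arbitrary reference direction; the constant projection is represented by its value
  -- there.
  obtain ⟨e, he⟩ := exists_ne (0 : ContinuumLimit.Rd d)
  obtain ⟨γ, hγ0, hγ⟩ := hB3.2.1
  obtain rfl : ν = γ := ContinuumLimit.exponent_eq hB1 hB3 hγ he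
  obtain ⟨ε, hε, hC⟩ := id hC2
  have hPi : ∀ ξ, ξ ≠ 0 → Pi₀ ξ = Pi₀ e := fun ξ hξ =>
    ContinuumLimit.Pi₀_eq hε hC hγ0 hB3 hB4 hξ he
  have hQ : IsIdempotentElem (Pi₀ e) := hB4.1 e he
  have hQs := ContinuumLimit.isSymmetric_Pi₀ hB4 he
  obtain ⟨φ, hφm, hφ, hφ2, hφV⟩ := ContinuumLimit.exists_fourierInv_of_memHw hr
    (Complex.continuous_ofReal.comp hVc) hV
  have hφV' : ∀ x, 𝓕⁻ φ x = V x := congrFun hφV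
  obtain ⟨M, hVM⟩ := hVs.exists_bound_of_continuous hVc
  have hdσ : (d : ℝ) < σ := by linarith
  have hdm : (d : ℝ) / 2 < m := by
    -- Here `d / 2` is the integer part, and `[d/2] + 1 > d / 2` gives the Sobolev condition on `m`.
    have h1 : d < 2 * (d / 2 + 1) := by omega
    have h2 : (d : ℝ) < 2 * (((d / 2 : ℕ) : ℝ) + 1) := by exact_mod_cast h1
    linarith
  have hσ0 : 0 < σ := lt_of_le_of_lt (Nat.cast_nonneg d) hdσ
  obtain ⟨⟨k, hk, hkf⟩, C, hC0, hfC⟩ :=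
    ContinuumLimit.exists_fourierInv_of_memHw_weighted hdm hσ0 hfc hf
  have hf2 : MemLp f 2 volume := ContinuumLimit.memLp_two_of_decay hdσ hfc hfC
  obtain ⟨C', -, hF⟩ := ContinuumLimit.exists_lattice_restriction hdσ hC0 hfC
  -- The Riemann sum bound behind `hF` requires `h ≤ 1`.
  have hh₁ : 0 < min h₀ 1 := lt_min hh₀ one_pos
  have hu' : ∀ h, 0 < h → h < min h₀ 1 →
      ContinuumLimit.SolvesDiscrete Γ ν E₀ d₁ V z f h (u h) := fun h hh hlt =>
    hu h hh (hlt.trans_le (min_le_left _ _))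
  have hbd : ∀ h, 0 < h → h < min h₀ 1 →
      ∫ η, ‖ContinuumLimit.dft h (u h) η‖ ^ 2 ≤ (|z.im| ^ 2)⁻¹ * C' := fun h hh hlt => by
    obtain ⟨F, hFf, hFC⟩ := hF h hh (hlt.le.trans (min_le_right _ _))
    exact ContinuumLimit.integral_norm_sq_dft_solution_le hh hz hVM (hu' h hh hlt) hFf hFC
  obtain ⟨G, hG, hlim⟩ := ContinuumLimit.exists_isLimit_tendsto hd0 hγ0 hB1 hB3 hB4 hC1 hC2 hγ hPi
    hQ hQs hz hVc hVM hφ hφm hφ2 hφV' hk hkf hh₁ hu'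
    (fun h hh hlt => (hF h hh (hlt.le.trans (min_le_right _ _))).imp fun F h1 => h1.1) hbd
  obtain ⟨h1, Pw, g, h2, h3, h4⟩ := hG.solves hd0 hz hQ hPi hφ hφ2 hφV' hVc hVM hk (by rwa [hkf])
  rw [hkf] at h3
  have hbd' : ∀ᶠ h in 𝓝[>] (0 : ℝ),
      ∫ η, ‖ContinuumLimit.dft h (u h) η‖ ^ 2 ≤ (|z.im| ^ 2)⁻¹ * C' := by
    filter_upwards [Ioo_mem_nhdsGT hh₁] with h hh
    exact hbd h hh.1 hh.2
  exact ⟨𝓕⁻ G, fun t ht _ => ContinuumLimit.tendstoL2w_interpolate ht hG.1 hG.2.1 hlim hbd',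
    ContinuumLimit.tendstoLocallyUniformly_interpolate hG.1 hlim, h1, Pw, g, h2, h3,
    Filter.Eventually.of_forall h4⟩
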